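/- Consider stack histories with the methods $\mathrm{push}$, $\mathrm{pop}$, $\mathrm{peek}$ and $\mathrm{empty}$. A history $H$ is a finite collection of $n$ operations; each operation $o$ has a process, a method (with a value as its argument, except for $\mathrm{empty}$, which has none), and rational invocation and response times $0\le \mathrm{inv}(o)<\mathrm{res}(o)$. Histories are well-formed: any two distinct operations $o,o'$ of the same process satisfy $\mathrm{res}(o)<\mathrm{inv}(o')$ or $\mathrm{res}(o')<\mathrm{inv}(o)$. $H$ is unambiguous if every value that occurs in $H$ is pushed by exactly one operation and popped by at most one operation (peeks are not restricted). $H$ is linearizable if there is an injective map $\ell:H\to\mathbb{Q}_{\ge 0}$ with $\mathrm{inv}(o)<\ell(o)<\mathrm{res}(o)$ for every $o\in H$ such that the operations, taken in increasing order of $\ell$, form a legal sequence of operations on a stack that is initially empty: $\mathrm{push}(v)$ puts $v$ on top, $\mathrm{pop}(v)$ removes the top element, which must be $v$, $\mathrm{peek}(v)$ requires that the top element is $v$, and $\mathrm{empty}$ requires that the stack is empty. Theorem. There is a deterministic algorithm that decides, given a well-formed unambiguous stack history $H$ with $n$ operations in arbitrary order, whether $H$ is linearizable, in $O(n\log n)$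 time. Here values are elements of a linearly ordered set, and time is the number of steps on a word RAM with words of $O(\log n)$ bits on which an arithmetic operation or comparison of words, a memory access, a query for the method of an operation, and a comparison of two time points or of two values of $H$ each take one step; the algorithm and the bound depend neither on the set of values nor on the set of processes. -/

import Mathlib

open scoped NNRat Asymptotics

namespace StackMonitoring

/-! ### Stack histories and linearizability -/

/-- Abstract stack operations `m(v)`; `empty` carries the dedicated non-value symbol. -/
inductive StackOp (V : Type*) where
  | push (v : V)
  | pop (v : V)
  | peek (v : V)
  | empty

/-- The value of an abstract operation, `none` for `empty`. -/
def StackOp.value {V : Type*} : StackOp V → Option V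
  | .push v => some v
  | .pop v => some v
  | .peek v => some v
  | .empty => none

/-- A concurrent operation: process, method with argument, and invocation and response times
in the nonnegative rationals. -/
structure Operation (P V : Type*) where
  proc : P
  op : StackOp V
  inv : ℚ≥0
  res : ℚ≥0
  inv_lt_res : inv < res

/-- A finite history; the index of an operation serves as its unique identifier. -/
structure History (P V : Type*) where
  size : ℕ
  opr : Fin size → Operation P V

/-- Every process is sequential. -/
def History.WellFormed {P V : Type*} (H : History P V) : Prop :=
  ∀ i j : Fin H.size, i ≠ j → (H.opr i).proc = (H.opr j).proc →
    (H.opr i).res < (H.opr j).inv ∨ (H.opr j).res < (H.opr i).inv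

/-- Every value occurring in the history is pushed exactly once and popped at most once. -/
def History.Unambiguous {P V : Type*} (H : History P V) : Prop :=
  ∀ v : V, (∃ i, (H.opr i).op.value = some v) →
    (∃! i, (H.opr i).op = .push v) ∧
    ∀ i j, (H.opr i).op = .pop v → (H.opr j).op = .pop v → i = j

/-- Transitions of the stack; a state is the list of stored values, the top being at the end. -/
inductive StackStep {V : Type*} : List V → StackOp V → List V → Prop
  | push (s : List V) (v : V) : StackStep s (.push v) (s ++ [v])
  | peek (s : List V) (v : V) : StackStep (s ++ [v]) (.peek v) (s ++ [v])
  | pop (s : List V) (v : V) : StackStep (s ++ [v]) (.pop v) s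
  | empty : StackStep [] .empty []

/-- `StackRun s τ s'`: the transition system has a run from `s` to `s'` labelled by `τ`. -/
inductive StackRun {V : Type*} : List V → List (StackOp V) → List V → Prop
  | nil (s : List V) : StackRun s [] s
  | cons {s s' s'' : List V} {o : StackOp V} {τ : List (StackOp V)} :
      StackStep s o s' → StackRun s' τ s'' → StackRun s (o :: τ) s''

/-- The sequential specification of the stack: labels of runs from the empty stack. -/
def stackSpec (V : Type*) : Set (List (StackOp V)) :=
  {τ | ∃ s, StackRun [] τ s}

/-- A linearization: distinct time points strictly inside the intervals of the operations. -/
def History.IsLinearization {P V : Type*} (H : History P V) (l : Fin H.size → ℚ≥0) : Prop :=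
  Function.Injective l ∧ ∀ i, (H.opr i).inv < l i ∧ l i < (H.opr i).res

/-- The abstract sequential history induced by `l`: the operations in increasing order of `l`. -/
def History.abstractSeq {P V : Type*} (H : History P V) (l : Fin H.size → ℚ≥0) :
    List (StackOp V) :=
  List.ofFn fun k => (H.opr (Tuple.sort l k)).op

/-- The history has a legal linearization. -/
def History.Linearizable {P V : Type*} (H : History P V) : Prop :=
  ∃ l, H.IsLinearization l ∧ H.abstractSeq l ∈ stackSpec V

/-! ### A word RAM with unit-cost comparison of time points and of values

Programs are structured: they have word variables and word arrays (each program uses a fixed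
finite number of them), and a read-only input. Words are the numbers below `W`, all arithmetic
is modulo `W`, and every elementary operation takes one step. The input is seen only
through its size, the methods of its operations, comparisons of its time points and comparisons
of its values. -/

/-- What a program can observe of its input. -/
structure Input where
  size : ℕ
  method : ℕ → ℕ
  timeLt : ℕ → ℕ → Bool
  valLt : ℕ → ℕ → Bool

/-- Code of a method. -/
def StackOp.code {V : Type*} : StackOp V → ℕ
  | .push _ => 0
  | .pop _ => 1
  | .peek _ => 2
  | .empty => 3

/-- The time point number `e`: the invocation of operation `i` for `e = 2 * i`, its response
for `e = 2 * i + 1`. -/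
def History.time {P V : Type*} (H : History P V) (e : ℕ) : Option ℚ≥0 :=
  if h : e / 2 < H.size then
    some (if e % 2 = 0 then (H.opr ⟨e / 2, h⟩).inv else (H.opr ⟨e / 2, h⟩).res)
  else none

/-- The value of the operation with index `i`, if there is one. -/
def History.val {P V : Type*} (H : History P V) (i : ℕ) : Option V :=
  if h : i < H.size then (H.opr ⟨i, h⟩).op.value else none

/-- Strict comparison, `false` if one side is missing. -/
def optLt {A : Type*} [LinearOrder A] : Option A → Option A → Bool
  | some a, some b => decide (a < b)
  | _, _ => false

/-- A history as an input. Indices out of range have method code 4 and compare as `false`. -/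
def History.input {P V : Type*} [LinearOrder V] (H : History P V) : Input where
  size := H.size
  method i := if h : i < H.size then (H.opr ⟨i, h⟩).op.code else 4
  timeLt e f := optLt (H.time e) (H.time f)
  valLt i j := optLt (H.val i) (H.val j)

/-- Binary word operations; `sub` is truncated and comparisons return 1 or 0. -/
inductive BinOp where
  | add | sub | mul | div | lt | eq

def BinOp.apply : BinOp → ℕ → ℕ → ℕ
  | .add, a, b => a + b
  | .sub, a, b => a - b
  | .mul, a, b => a * b
  | .div, a, b => a / b
  | .lt, a, b => if a < b then 1 else 0
  | .eq, a, b => if a = b then 1 else 0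

inductive Expr where
  | const (c : ℕ)
  | var (x : ℕ)
  | get (a : ℕ) (i : Expr)
  | bin (o : BinOp) (e f : Expr)
  | method (i : Expr)
  | timeLt (e f : Expr)
  | valLt (i j : Expr)

/-- Contents of the variables and of the arrays. -/
structure Store where
  var : ℕ → ℕ
  arr : ℕ → ℕ → ℕ

/-- Value of an expression on words modulo `W`. -/
def Expr.eval (W : ℕ) (I : Input) (s : Store) : Expr → ℕ
  | .const c => c % W
  | .var x => s.var x
  | .get a i => s.arr a (i.eval W I s)
  | .bin o e f => o.apply (e.eval W I s) (f.eval W I s) % W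
  | .method i => I.method (i.eval W I s) % W
  | .timeLt e f => (I.timeLt (e.eval W I s) (f.eval W I s)).toNat % W
  | .valLt i j => (I.valLt (i.eval W I s) (j.eval W I s)).toNat % W

/-- Evaluation time: one step for each node. -/
def Expr.cost : Expr → ℕ
  | .const _ => 1
  | .var _ => 1
  | .get _ i => i.cost + 1
  | .bin _ e f => e.cost + f.cost + 1
  | .method i => i.cost + 1
  | .timeLt e f => e.cost + f.cost + 1
  | .valLt i j => i.cost + j.cost + 1

inductive Program where
  | skip
  | assign (x : ℕ) (e : Expr)
  | put (a : ℕ) (i e : Expr)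
  | seq (p q : Program)
  | ite (b : Expr) (p q : Program)
  | loop (b : Expr) (p : Program)

def Store.setVar (s : Store) (x v : ℕ) : Store :=
  { s with var := Function.update s.var x v }

def Store.setArr (s : Store) (a i v : ℕ) : Store :=
  { s with arr := Function.update s.arr a (Function.update (s.arr a) i v) }

/-- `Exec W I p s s' t`: on input `I` with words modulo `W`, the program `p` started in `s` halts
in `s'` after exactly `t` steps. `loop b p` repeats `p` while `b` is nonzero. -/
inductive Exec (W : ℕ) (I : Input) : Program → Store → Store → ℕ → Prop
  | skip (s : Store) : Exec W I .skip s s 1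
  | assign (x : ℕ) (e : Expr) (s : Store) :
      Exec W I (.assign x e) s (s.setVar x (e.eval W I s)) (e.cost + 1)
  | put (a : ℕ) (i e : Expr) (s : Store) :
      Exec W I (.put a i e) s (s.setArr a (i.eval W I s) (e.eval W I s)) (i.cost + e.cost + 1)
  | seq {p q : Program} {s s' s'' : Store} {t t' : ℕ} :
      Exec W I p s s' t → Exec W I q s' s'' t' → Exec W I (.seq p q) s s'' (t + t')
  | iteTrue {b : Expr} {p q : Program} {s s' : Store} {t : ℕ} :
      b.eval W I s ≠ 0 → Exec W I p s s' t → Exec W I (.ite b p q) s s' (b.cost + t + 1)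
  | iteFalse {b : Expr} {p q : Program} {s s' : Store} {t : ℕ} :
      b.eval W I s = 0 → Exec W I q s s' t → Exec W I (.ite b p q) s s' (b.cost + t + 1)
  | loopTrue {b : Expr} {p : Program} {s s' s'' : Store} {t t' : ℕ} :
      b.eval W I s ≠ 0 → Exec W I p s s' t → Exec W I (.loop b p) s' s'' t' →
      Exec W I (.loop b p) s s'' (b.cost + t + t' + 1)
  | loopFalse {b : Expr} {p : Program} {s : Store} :
      b.eval W I s = 0 → Exec W I (.loop b p) s s (b.cost + 1)

/-- Final store and running time are determined by program, input and initial store. -/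
theorem Exec.deterministic {W : ℕ} {I : Input} {p : Program} {s s₁ s₂ : Store} {t₁ t₂ : ℕ}
    (h₁ : Exec W I p s s₁ t₁) (h₂ : Exec W I p s s₂ t₂) : s₁ = s₂ ∧ t₁ = t₂ := by
  induction h₁ generalizing s₂ t₂ with
  | skip => cases h₂; exact ⟨rfl, rfl⟩
  | assign => cases h₂; exact ⟨rfl, rfl⟩
  | put => cases h₂; exact ⟨rfl, rfl⟩
  | seq _ _ ih ih' =>
    cases h₂ with
    | seq a b =>
      obtain ⟨rfl, rfl⟩ := ih a
      obtain ⟨rfl, rfl⟩ := ih' b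
      exact ⟨rfl, rfl⟩
  | iteTrue hb _ ih =>
    cases h₂ with
    | iteTrue _ a => obtain ⟨rfl, rfl⟩ := ih a; exact ⟨rfl, rfl⟩
    | iteFalse hc _ => exact absurd hc hb
  | iteFalse hb _ ih =>
    cases h₂ with
    | iteTrue hc _ => exact absurd hb hc
    | iteFalse _ a => obtain ⟨rfl, rfl⟩ := ih a; exact ⟨rfl, rfl⟩
  | loopTrue hb _ _ ih ih' =>
    cases h₂ with
    | loopTrue _ a b =>
      obtain ⟨rfl, rfl⟩ := ih a
      obtain ⟨rfl, rfl⟩ := ih' b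
      exact ⟨rfl, rfl⟩
    | loopFalse hc => exact absurd hc hb
  | loopFalse hb =>
    cases h₂ with
    | loopTrue hc _ _ => exact absurd hb hc
    | loopFalse _ => exact ⟨rfl, rfl⟩

/-- Initially variable 0 holds the input size; everything else is 0. -/
def initStore (n : ℕ) : Store where
  var := Function.update (fun _ => 0) 0 n
  arr := fun _ _ => 0

/-- On input `I` with words modulo `W`, the program halts within `T` steps and decides `A`:
variable 0 finally holds 1 if `A` is true, and 0 if `A` is false. -/
def Program.DecidesWithin (p : Program) (W : ℕ) (I : Input) (T : ℕ) (A : Prop) : Prop :=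
  ∃ s t, Exec W I p (initStore I.size) s t ∧ t ≤ T ∧
    ((A ∧ s.var 0 = 1) ∨ (¬ A ∧ s.var 0 = 0))

end StackMonitoring

/-! Legality of a sequential order depends only on relative positions: a value is pushed before its
other operations and peeked before it is popped, a value pushed on top of another one is gone when
the lower one is popped or peeked, and nothing is left at an `empty` (`mem_stackSpec_iff_legal`).
Any order that extends the interval order is realized by time points
(`History.exists_isLinearization`), so linearizability means that a legal order of this kind exists.
Only the ranks of the `2 * n` time points matter. Gap `g` is the stretch following the point of rank
`g`, and operation `i` can take place in the gaps with `pI i ≤ g < pR i`.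

Let `b v` be the earliest response and `c v` the latest invocation among the operations of `v`,
where `c v = 2 * n` if `v` is never popped. In the gaps `b v ≤ g < c v` the value `v` is certainly
on the stack. Values with `b v < c v` are solid. All operations of any other value share a gap,
where the value can be pushed, peeked and popped in one go, so it constrains nothing. In a legal
order, the value of a set `S` of solid values that is pushed first lies below the rest of `S`, hence
its operations happen in gaps where no other value of `S` is forced onto the stack
(`Disc.necessary`). Conversely, suppose that the solid values can be removed one by one, each with
this property relative to those still present. Pushing every value as late and popping it as early
as the values removed after it permit then yields a legal order (`Disc.exists_gaps`,
`Disc.sufficient`). In both directions every `empty` must also see a gap without forced values.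
Removability survives the removal of other values (`Placeable.mono`), so a greedy removal either
succeeds or gets stuck in a set that refutes linearizability.

For the running time, a minimum tree over the gaps stores the total weight `n + 1 + v` of the values
`v` covering a gap. A total below `2 * (n + 1)` means at most one covering value and tells which one
(`load_lt_iff`, `load_sole`). Every value runs through its operations. If the next one has no
visible gap, the value waits, and the range of that operation is entered into a second tree.
Removing `v` makes gaps visible only between `b v` and `c v`, and only those covered at most once
afterwards. Such a gap wakes its sole covering value, or, if it is uncovered, the values waiting for
a range that contains it. The cover count of a gap, capped at two, can only fall twice. Hence a
potential of linear size pays for all steps, each of which consists of a bounded number of walks in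
trees of logarithmic depth. Sorting is done with a tournament tree. The costs follow from a program
logic in which a step count is bounded by the program size times the bounds of the nested loops
(`Program.stat_le`). -/

namespace StackMonitoring

/-! ### A cost-aware program logic -/

/-- Whether a program assigns to the variable `x`. -/
def Program.writesVar : Program → ℕ → Bool
  | .skip, _ => false
  | .assign y _, x => x == y
  | .put _ _ _, _ => false
  | .seq p q, x => p.writesVar x || q.writesVar x
  | .ite _ p q, x => p.writesVar x || q.writesVar x
  | .loop _ p, x => p.writesVar x

/-- Whether a program writes into the array `a`. -/
def Program.writesArr : Program → ℕ → Bool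
  | .skip, _ => false
  | .assign _ _, _ => false
  | .put b _ _, a => a == b
  | .seq p q, a => p.writesArr a || q.writesArr a
  | .ite _ p q, a => p.writesArr a || q.writesArr a
  | .loop _ p, a => p.writesArr a

/-- `s'` agrees with `s` on everything that `p` does not write. -/
structure Frame (p : Program) (s s' : Store) : Prop where
  var : ∀ x, p.writesVar x = false → s'.var x = s.var x
  arr : ∀ a, p.writesArr a = false → s'.arr a = s.arr a

theorem Frame.rfl {p : Program} {s : Store} : Frame p s s :=
  ⟨fun _ _ => Eq.refl _, fun _ _ => Eq.refl _⟩

theorem Frame.trans {p : Program} {s s' s'' : Store} (h : Frame p s s') (h' : Frame p s' s'') :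
    Frame p s s'' :=
  ⟨fun x hx => (h'.var x hx).trans (h.var x hx), fun a ha => (h'.arr a ha).trans (h.arr a ha)⟩

@[simp] theorem Store.setVar_var (s : Store) (x v y : ℕ) :
    (s.setVar x v).var y = if y = x then v else s.var y := by
  simp [Store.setVar, Function.update_apply]

@[simp] theorem Store.setVar_arr (s : Store) (x v a : ℕ) : (s.setVar x v).arr a = s.arr a := rfl

@[simp] theorem Store.setArr_var (s : Store) (a i v x : ℕ) : (s.setArr a i v).var x = s.var x := rfl

theorem Store.setArr_arr (s : Store) (a i v b : ℕ) :
    (s.setArr a i v).arr b = if b = a then Function.update (s.arr a) i v else s.arr b := by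
  simp only [Store.setArr, Function.update_apply]

theorem Store.setArr_arr_apply (s : Store) (a i v b j : ℕ) :
    (s.setArr a i v).arr b j = if b = a ∧ j = i then v else s.arr b j := by
  rw [Store.setArr_arr]
  by_cases h : b = a
  · subst h; simp [Function.update_apply]
  · simp [h]

/-- What a program may write is computed syntactically, so specifications only mention what changes,
and preservation of everything else is settled by evaluating `writesVar` or `writesArr`, mostly by
`rfl`. -/
theorem Exec.frame {W : ℕ} {I : Input} {p : Program} {s s' : Store} {t : ℕ}
    (h : Exec W I p s s' t) : Frame p s s' := by
  induction h with
  | skip => exact Frame.rfl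
  | assign x e s =>
    refine ⟨fun y hy => ?_, fun a _ => rfl⟩
    have : y ≠ x := by simpa [Program.writesVar] using hy
    simp [this]
  | put b i e s =>
    refine ⟨fun _ _ => rfl, fun a ha => ?_⟩
    have : a ≠ b := by simpa [Program.writesArr] using ha
    simp [Store.setArr_arr, this]
  | seq _ _ ih ih' =>
    refine ⟨fun x hx => ?_, fun a ha => ?_⟩
    · simp only [Program.writesVar, Bool.or_eq_false_iff] at hx
      exact (ih'.var x hx.2).trans (ih.var x hx.1)
    · simp only [Program.writesArr, Bool.or_eq_false_iff] at ha
      exact (ih'.arr a ha.2).trans (ih.arr a ha.1)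
  | iteTrue _ _ ih =>
    refine ⟨fun x hx => ?_, fun a ha => ?_⟩
    · simp only [Program.writesVar, Bool.or_eq_false_iff] at hx
      exact ih.var x hx.1
    · simp only [Program.writesArr, Bool.or_eq_false_iff] at ha
      exact ih.arr a ha.1
  | iteFalse _ _ ih =>
    refine ⟨fun x hx => ?_, fun a ha => ?_⟩
    · simp only [Program.writesVar, Bool.or_eq_false_iff] at hx
      exact ih.var x hx.2
    · simp only [Program.writesArr, Bool.or_eq_false_iff] at ha
      exact ih.arr a ha.2
  | loopTrue _ _ _ ih ih' =>
    exact ⟨fun x hx => (ih'.var x hx).trans (ih.var x hx),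
      fun a ha => (ih'.arr a ha).trans (ih.arr a ha)⟩
  | loopFalse _ => exact Frame.rfl

/-- Worst-case cost if a loop at nesting depth `d` makes at most `Ls[d]` iterations. -/
def Program.stat : Program → List ℕ → ℕ
  | .skip, _ => 1
  | .assign _ e, _ => e.cost + 1
  | .put _ i e, _ => i.cost + e.cost + 1
  | .seq p q, Ls => p.stat Ls + q.stat Ls
  | .ite b p q, Ls => b.cost + max (p.stat Ls) (q.stat Ls) + 1
  | .loop b _, [] => b.cost + 1
  | .loop b p, L :: Ls => (L + 1) * (b.cost + p.stat Ls + 1)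

/-- Number of nodes of a program. -/
def Program.nodes : Program → ℕ
  | .skip => 1
  | .assign _ e => e.cost + 1
  | .put _ i e => i.cost + e.cost + 1
  | .seq p q => p.nodes + q.nodes
  | .ite b p q => b.cost + (p.nodes + q.nodes) + 1
  | .loop b p => b.cost + p.nodes + 1

/-- Every node of the program is charged once for each round of the loops around it, the final
failing test counting as a round. No finer cost analysis is needed later, since the loops are nested
at most twice. -/
theorem Program.stat_le (p : Program) (Ls : List ℕ) :
    p.stat Ls ≤ p.nodes * (Ls.map (· + 1)).prod := by
  have hpos : ∀ Ls : List ℕ, 1 ≤ (Ls.map (· + 1)).prod := fun Ls =>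
    List.one_le_prod (fun x hx => by
      obtain ⟨y, -, rfl⟩ := List.mem_map.1 hx
      omega)
  have hle : ∀ (Ls : List ℕ) (x : ℕ), x ≤ x * (Ls.map (· + 1)).prod := fun Ls x =>
    Nat.le_mul_of_pos_right _ (hpos Ls)
  induction p generalizing Ls with
  | skip => exact hle Ls 1
  | assign x e => exact hle Ls _
  | put a i e => exact hle Ls _
  | seq p q ihp ihq =>
    have h1 := ihp Ls
    have h2 := ihq Ls
    simp only [stat, nodes, Nat.add_mul]
    omega
  | ite b p q ihp ihq =>
    have h1 := ihp Ls
    have h2 := ihq Ls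
    have h3 := hle Ls (b.cost + 1)
    simp only [stat, nodes, Nat.add_mul] at *
    omega
  | loop b p ih =>
    cases Ls with
    | nil => simp [stat, nodes]
    | cons L Ls =>
      have h1 := ih Ls
      have h3 := hle Ls (b.cost + 1)
      have : b.cost + p.stat Ls + 1 ≤ (b.cost + p.nodes + 1) * (Ls.map (· + 1)).prod := by
        simp only [Nat.add_mul] at *
        omega
      calc (Program.loop b p).stat (L :: Ls) = (L + 1) * (b.cost + p.stat Ls + 1) := rfl
        _ ≤ (L + 1) * ((b.cost + p.nodes + 1) * (Ls.map (· + 1)).prod) :=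
          Nat.mul_le_mul_left _ this
        _ = _ := by simp only [nodes, List.map_cons, List.prod_cons]; ring

/-- Started in `s`, the program `p` halts within the cost `p.stat Ls` in a store satisfying `Q`. -/
def Run (W : ℕ) (I : Input) (Ls : List ℕ) (p : Program) (s : Store) (Q : Store → Prop) : Prop :=
  ∃ s' t, Exec W I p s s' t ∧ t ≤ p.stat Ls ∧ Q s'

/-! ### Proof rules for programs with costs. -/

section Rules

variable {W : ℕ} {I : Input} {Ls : List ℕ}

theorem Run.mono {p : Program} {s : Store} {Q Q' : Store → Prop} (h : Run W I Ls p s Q)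
    (hQ : ∀ s', Frame p s s' → Q s' → Q' s') : Run W I Ls p s Q' := by
  obtain ⟨s', t, h1, h2, h3⟩ := h
  exact ⟨s', t, h1, h2, hQ s' h1.frame h3⟩

theorem Run.skip {s : Store} {Q : Store → Prop} (h : Q s) : Run W I Ls .skip s Q :=
  ⟨s, 1, .skip s, le_rfl, h⟩

theorem Run.assign {x : ℕ} {e : Expr} {s : Store} {Q : Store → Prop} {v : ℕ}
    (he : e.eval W I s = v) (h : Q (s.setVar x v)) : Run W I Ls (.assign x e) s Q := by
  subst he
  exact ⟨_, _, .assign x e s, le_rfl, h⟩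

theorem Run.put {a : ℕ} {i e : Expr} {s : Store} {Q : Store → Prop} {j v : ℕ}
    (hi : i.eval W I s = j) (he : e.eval W I s = v) (h : Q (s.setArr a j v)) :
    Run W I Ls (.put a i e) s Q := by
  subst he hi
  exact ⟨_, _, .put a i e s, le_rfl, h⟩

theorem Run.seq {p q : Program} {s : Store} {Q R : Store → Prop} (hp : Run W I Ls p s R)
    (hq : ∀ s', Frame p s s' → R s' → Run W I Ls q s' Q) : Run W I Ls (.seq p q) s Q := by
  obtain ⟨s', t, h1, h2, h3⟩ := hp
  obtain ⟨s'', t', h1', h2', h3'⟩ := hq s' h1.frame h3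
  exact ⟨s'', t + t', .seq h1 h1', Nat.add_le_add h2 h2', h3'⟩

theorem Run.assign_seq {x : ℕ} {e : Expr} {q : Program} {s : Store} {Q : Store → Prop} (v : ℕ)
    (he : e.eval W I s = v) (h : Run W I Ls q (s.setVar x v) Q) :
    Run W I Ls (.seq (.assign x e) q) s Q := by
  subst he
  obtain ⟨s'', t', h1', h2', h3'⟩ := h
  exact ⟨s'', _, .seq (.assign x e s) h1', Nat.add_le_add le_rfl h2', h3'⟩

theorem Run.put_seq {a : ℕ} {i e : Expr} {q : Program} {s : Store} {Q : Store → Prop} (j v : ℕ)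
    (hi : i.eval W I s = j) (he : e.eval W I s = v) (h : Run W I Ls q (s.setArr a j v) Q) :
    Run W I Ls (.seq (.put a i e) q) s Q := by
  subst he hi
  obtain ⟨s'', t', h1', h2', h3'⟩ := h
  exact ⟨s'', _, .seq (.put a i e s) h1', Nat.add_le_add le_rfl h2', h3'⟩

theorem Run.ite {b : Expr} {p q : Program} {s : Store} {Q : Store → Prop}
    (hp : b.eval W I s ≠ 0 → Run W I Ls p s Q) (hq : b.eval W I s = 0 → Run W I Ls q s Q) :
    Run W I Ls (.ite b p q) s Q := by
  by_cases hb : b.eval W I s = 0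
  · obtain ⟨s', t, h1, h2, h3⟩ := hq hb
    refine ⟨s', _, .iteFalse hb h1, ?_, h3⟩
    simp only [Program.stat]
    omega
  · obtain ⟨s', t, h1, h2, h3⟩ := hp hb
    refine ⟨s', _, .iteTrue hb h1, ?_, h3⟩
    simp only [Program.stat]
    omega

/-- Loop rule with an invariant and a measure. -/
theorem Run.loop {L : ℕ} {b : Expr} {p : Program} {s : Store} (Inv : Store → Prop)
    (μ : Store → ℕ) (h0 : Inv s) (hL : μ s ≤ L)
    (hstep : ∀ s', Frame p s s' → Inv s' → b.eval W I s' ≠ 0 →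
      Run W I Ls p s' (fun s'' => Inv s'' ∧ μ s'' < μ s')) :
    Run W I (L :: Ls) (.loop b p) s (fun s' => Inv s' ∧ b.eval W I s' = 0) := by
  -- The test is evaluated once more than the body, whence `k + 1`. The frame is carried along so
  -- that the step may use all that the loop leaves unchanged.
  suffices h : ∀ (k : ℕ) (s' : Store), Frame p s s' → Inv s' → μ s' ≤ k →
      ∃ s'' t, Exec W I (.loop b p) s' s'' t ∧ t ≤ (k + 1) * (b.cost + p.stat Ls + 1) ∧
        (Inv s'' ∧ b.eval W I s'' = 0) by
    obtain ⟨s'', t, h1, h2, h3⟩ := h L s Frame.rfl h0 hL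
    exact ⟨s'', t, h1, h2, h3⟩
  intro k
  induction k with
  | zero =>
    intro s' hf hI hk
    by_cases hb : b.eval W I s' = 0
    · refine ⟨s', _, .loopFalse hb, ?_, hI, hb⟩
      omega
    · obtain ⟨s'', t, -, -, -, h⟩ := hstep s' hf hI hb
      omega
  | succ k ih =>
    intro s' hf hI hk
    by_cases hb : b.eval W I s' = 0
    · refine ⟨s', _, .loopFalse hb, ?_, hI, hb⟩
      have := Nat.le_mul_of_pos_left (b.cost + p.stat Ls + 1) (Nat.succ_pos (k + 1))
      simp only [Nat.succ_eq_add_one] at this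
      omega
    · obtain ⟨s'', t, h1, h2, hI', h⟩ := hstep s' hf hI hb
      obtain ⟨s3, t', h1', h2', h3⟩ := ih s'' (hf.trans h1.frame) hI' (by omega)
      refine ⟨s3, _, .loopTrue hb h1 h1', ?_, h3⟩
      rw [Nat.succ_mul (k + 1)]
      omega

/-- Rule for loops that count a variable up to a bound. -/
theorem Run.forLoop {L : ℕ} {b : Expr} {p : Program} {s : Store} (Inv : ℕ → Store → Prop) (B : ℕ)
    (x : ℕ) (hx : s.var x ≤ B) (h0 : Inv (s.var x) s) (hL : B ≤ L)
    (hb : ∀ s', Frame p s s' → (b.eval W I s' ≠ 0 ↔ s'.var x < B))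
    (hstep : ∀ s', Frame p s s' → s'.var x < B → Inv (s'.var x) s' →
      Run W I Ls p s' (fun s'' => s''.var x = s'.var x + 1 ∧ Inv (s'.var x + 1) s'')) :
    Run W I (L :: Ls) (.loop b p) s (fun s' => Inv B s') := by
  refine (Run.loop (L := L) (fun s' => Frame p s s' ∧ s'.var x ≤ B ∧ Inv (s'.var x) s')
    (fun s' => B - s'.var x) ⟨Frame.rfl, hx, h0⟩ (by omega) ?_).mono ?_
  · rintro s' - ⟨hf, h1, h2⟩ h3
    have h4 := (hb s' hf).1 h3
    refine (hstep s' hf h4 h2).mono ?_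
    rintro s'' hf' ⟨h5, h6⟩
    refine ⟨⟨hf.trans hf', by omega, by rwa [h5]⟩, by omega⟩
  · rintro s' - ⟨⟨hf, h1, h2⟩, h3⟩
    have : ¬ s'.var x < B := fun h => (hb s' hf).2 h h3
    rwa [show B = s'.var x by omega]

end Rules

/-! ### Legality of a sequential order in terms of the order of operations -/

section Legal

variable {V : Type*}

/-- The value pushed by an operation. -/
def StackOp.pushVal : StackOp V → Option V
  | .push v => some v
  | _ => none

theorem StackOp.pushVal_eq_some {o : StackOp V} {v : V} : o.pushVal = some v ↔ o = .push v := by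
  cases o <;> simp [StackOp.pushVal]

open Classical in
/-- The stack after a legal sequence of operations with distinct pushed values. -/
noncomputable def stackAfter (τ : List (StackOp V)) : List V :=
  (τ.filterMap StackOp.pushVal).filter fun v => StackOp.pop v ∉ τ

/-- The operation `o` is enabled in the stack `s`. -/
def StepOK (s : List V) : StackOp V → Prop
  | .push _ => True
  | .pop v => ∃ s', s = s' ++ [v]
  | .peek v => ∃ s', s = s' ++ [v]
  | .empty => s = []

theorem mem_stackAfter {τ : List (StackOp V)} {v : V} :
    v ∈ stackAfter τ ↔ StackOp.push v ∈ τ ∧ StackOp.pop v ∉ τ := by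
  simp [stackAfter, StackOp.pushVal_eq_some]

theorem StackRun.append_singleton {s s' : List V} {τ : List (StackOp V)} {o : StackOp V} :
    StackRun s (τ ++ [o]) s' ↔ ∃ s₁, StackRun s τ s₁ ∧ StackStep s₁ o s' := by
  induction τ generalizing s with
  | nil =>
    constructor
    · intro h
      cases h with
      | cons h1 h2 => cases h2; exact ⟨s, .nil s, h1⟩
    · rintro ⟨s₁, h1, h2⟩
      cases h1
      exact .cons h2 (.nil _)
  | cons a τ ih =>
    constructor
    · intro h
      cases h with
      | cons h1 h2 =>
        obtain ⟨s₁, h3, h4⟩ := ih.1 h2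
        exact ⟨s₁, .cons h1 h3, h4⟩
    · rintro ⟨s₁, h1, h2⟩
      cases h1 with
      | cons h3 h4 => exact .cons h3 (ih.2 ⟨s₁, h4, h2⟩)

/-- Since pushed values are distinct and pops are preceded by their pushes, the stack is determined
by the past: the values pushed and not popped, in the order of the pushes. `stackAfter` would delete
a popped value from any place, so that `v` is on top is demanded separately by `StepOK`. -/
theorem stackStep_stackAfter {τ : List (StackOp V)} {o : StackOp V} {s : List V}
    (hnd : ((τ ++ [o]).filterMap StackOp.pushVal).Nodup)
    (hpop : ∀ v, StackOp.pop v ∈ τ → StackOp.push v ∈ τ) :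
    StackStep (stackAfter τ) o s ↔ StepOK (stackAfter τ) o ∧ s = stackAfter (τ ++ [o]) := by
  classical
  have hnd' : (τ.filterMap StackOp.pushVal).Nodup :=
    (List.nodup_append.1 (by simpa [List.filterMap_append] using hnd)).1
  have hst : (stackAfter τ).Nodup := hnd'.filter _
  cases o with
  | push v =>
    have hv : StackOp.push v ∉ τ := by
      intro h
      rw [List.filterMap_append, List.nodup_append] at hnd
      exact hnd.2.2 v (List.mem_filterMap.2 ⟨_, h, rfl⟩) v (by simp [StackOp.pushVal]) rfl
    have hv' : StackOp.pop v ∉ τ := fun h => hv (hpop v h)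
    have : stackAfter (τ ++ [.push v]) = stackAfter τ ++ [v] := by
      simp [stackAfter, List.filterMap_append, List.filter_append, StackOp.pushVal, hv']
    rw [this]
    constructor
    · intro h
      generalize stackAfter τ = s0 at h
      cases h
      exact ⟨trivial, rfl⟩
    · rintro ⟨-, rfl⟩
      exact .push _ _
  | pop v =>
    have h1 : stackAfter (τ ++ [.pop v]) = (stackAfter τ).filter (· ≠ v) := by
      simp [stackAfter, List.filterMap_append, StackOp.pushVal, List.filter_filter, not_or,
        and_comm]
    have h2 : ∀ s', stackAfter τ = s' ++ [v] → stackAfter (τ ++ [.pop v]) = s' := by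
      intro s' h
      rw [h1, h, List.filter_append]
      rw [h, List.nodup_append] at hst
      rw [List.filter_eq_self.2]
      · simp
      · intro a ha
        simpa using fun h => hst.2.2 a ha v (by simp) h
    constructor
    · intro h
      generalize hs : stackAfter τ = s0 at h
      cases h
      exact ⟨⟨s, rfl⟩, (h2 _ hs).symm⟩
    · rintro ⟨⟨s', h⟩, rfl⟩
      rw [h2 s' h, h]
      exact .pop _ _
  | peek v =>
    have h1 : stackAfter (τ ++ [.peek v]) = stackAfter τ := by
      simp [stackAfter, List.filterMap_append, StackOp.pushVal]
    rw [h1]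
    constructor
    · intro h
      generalize stackAfter τ = s0 at h
      cases h
      exact ⟨⟨_, rfl⟩, rfl⟩
    · rintro ⟨⟨s', h⟩, rfl⟩
      rw [h]
      exact .peek _ _
  | empty =>
    have h1 : stackAfter (τ ++ [.empty]) = stackAfter τ := by
      simp [stackAfter, List.filterMap_append, StackOp.pushVal]
    rw [h1]
    constructor
    · intro h
      generalize stackAfter τ = s0 at h
      cases h
      exact ⟨rfl, rfl⟩
    · rintro ⟨h, rfl⟩
      simp only [StepOK] at h
      rw [h]
      exact .empty

theorem stackRun_iff {τ : List (StackOp V)} (hnd : (τ.filterMap StackOp.pushVal).Nodup)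
    {s : List V} : StackRun [] τ s ↔
      s = stackAfter τ ∧ ∀ α o β, τ = α ++ o :: β → StepOK (stackAfter α) o := by
  -- The induction must also carry that enabled sequences pop only pushed values, because
  -- `stackStep_stackAfter` relies on it.
  suffices h : ((∀ α o β, τ = α ++ o :: β → StepOK (stackAfter α) o) →
      ∀ v, StackOp.pop v ∈ τ → StackOp.push v ∈ τ) ∧ ∀ s, (StackRun [] τ s ↔
      s = stackAfter τ ∧ ∀ α o β, τ = α ++ o :: β → StepOK (stackAfter α) o) from h.2 s
  clear s
  induction τ using List.reverseRecOn with
  | nil =>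
    refine ⟨by simp, fun s => ⟨?_, ?_⟩⟩
    · rintro ⟨⟩
      simp [stackAfter]
    · rintro ⟨rfl, -⟩
      exact .nil _
  | append_singleton τ o ih =>
    have hnd' : (τ.filterMap StackOp.pushVal).Nodup :=
      (List.nodup_append.1 (by simpa [List.filterMap_append] using hnd)).1
    obtain ⟨ih1, ih2⟩ := ih hnd'
    have hsplit : (∀ α o' β, τ ++ [o] = α ++ o' :: β → StepOK (stackAfter α) o') ↔
        (∀ α o' β, τ = α ++ o' :: β → StepOK (stackAfter α) o') ∧ StepOK (stackAfter τ) o := by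
      constructor
      · intro h
        exact ⟨fun α o' β hτ => h α o' (β ++ [o]) (by simp [hτ]), h τ o [] rfl⟩
      · rintro ⟨h1, h2⟩ α o' β hτ
        rcases List.eq_nil_or_concat β with rfl | ⟨β', b, rfl⟩
        · obtain ⟨rfl, h⟩ := List.append_inj' hτ rfl
          obtain rfl : o = o' := by simpa using h
          exact h2
        · have : τ ++ [o] = (α ++ o' :: β') ++ [b] := by simpa using hτ
          obtain ⟨rfl, -⟩ := List.append_inj' this rfl
          exact h1 _ _ _ rfl
    rw [hsplit]
    refine ⟨?_, fun s => ?_⟩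
    · rintro ⟨h1, h2⟩ v hv
      rw [List.mem_append] at hv ⊢
      rcases hv with hv | hv
      · exact .inl (ih1 h1 v hv)
      · obtain rfl : StackOp.pop v = o := by simpa using hv
        obtain ⟨s', hs⟩ := h2
        exact .inl (mem_stackAfter.1 (hs ▸ by simp : v ∈ stackAfter τ)).1
    · rw [StackRun.append_singleton]
      constructor
      · rintro ⟨s₁, h1, h2⟩
        obtain ⟨rfl, h3⟩ := (ih2 _).1 h1
        have := (stackStep_stackAfter hnd (ih1 h3)).1 h2
        exact ⟨this.2, h3, this.1⟩
      · rintro ⟨rfl, h1, h2⟩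
        exact ⟨_, (ih2 _).2 ⟨rfl, h1⟩, (stackStep_stackAfter hnd (ih1 h1)).2 ⟨h2, rfl⟩⟩

/-- Legality of operations in the order of `key`. -/
structure Legal {n : ℕ} {α : Type*} [LinearOrder α] (op : Fin n → StackOp V) (key : Fin n → α) :
    Prop where
  push_before : ∀ v j, (op j = .pop v ∨ op j = .peek v) → ∃ i, op i = .push v ∧ key i < key j
  peek_before : ∀ v i j, op i = .pop v → op j = .peek v → key j < key i
  lifo : ∀ v w i j k, op i = .push v → op j = .push w → (op k = .pop v ∨ op k = .peek v) →
    key i < key j → key j < key k → ∃ l, op l = .pop w ∧ key l < key k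
  empty : ∀ w j k, op j = .push w → op k = .empty → key j < key k →
    ∃ l, op l = .pop w ∧ key l < key k

/-- The stack before `k` holds the values pushed and not popped before `k`, ordered by their pushes.
So `v` is on top exactly if it is present and no value pushed later is present, and both parts are
statements about keys. -/
theorem mem_stackSpec_iff_legal {n : ℕ} {α : Type*} [LinearOrder α] {op : Fin n → StackOp V}
    {key : Fin n → α} (hpush : ∀ v i j, op i = .push v → op j = .push v → i = j)
    (hpop : ∀ v i j, op i = .pop v → op j = .pop v → i = j) {L : List (Fin n)}
    (hL : L.Pairwise fun i j => key i < key j) (hmem : ∀ i, i ∈ L) :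
    L.map op ∈ stackSpec V ↔ Legal op key := by
  have hLnd : L.Nodup := hL.imp fun h e => by simp [e] at h
  have hnd : ((L.map op).filterMap StackOp.pushVal).Nodup := by
    rw [List.filterMap_map]
    refine hLnd.filterMap ?_
    intro a a' b hb hb'
    exact hpush b a a' (StackOp.pushVal_eq_some.1 hb) (StackOp.pushVal_eq_some.1 hb')
  have hpre : ∀ A k B, L = A ++ k :: B → ∀ i, i ∈ A ↔ key i < key k := by
    rintro A k B rfl i
    rw [List.pairwise_append] at hL
    constructor
    · intro h
      exact hL.2.2 i h k (by simp)
    · intro h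
      have := hmem i
      rw [List.mem_append, List.mem_cons] at this
      rcases this with h1 | rfl | h1
      · exact h1
      · simp at h
      · have := (List.pairwise_cons.1 hL.2.1).1 i h1
        exact absurd h this.asymm
  have hord : ∀ A k B, L = A ++ k :: B → (stackAfter (A.map op)).Pairwise
      fun a b => ∃ i j, op i = .push a ∧ op j = .push b ∧ key i < key j := by
    rintro A k B rfl
    rw [List.pairwise_append] at hL
    refine List.Pairwise.filter _ ?_
    rw [List.filterMap_map]
    refine List.Pairwise.filterMap _ ?_ hL.1
    intro i j hij a ha b hb
    exact ⟨i, j, StackOp.pushVal_eq_some.1 ha, StackOp.pushVal_eq_some.1 hb, hij⟩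
  have hmemA : ∀ A k B, L = A ++ k :: B → ∀ v, v ∈ stackAfter (A.map op) ↔
      (∃ i, op i = .push v ∧ key i < key k) ∧ ¬ ∃ i, op i = .pop v ∧ key i < key k := by
    intro A k B h v
    simp [mem_stackAfter, hpre A k B h, and_comm]
  have hspec : L.map op ∈ stackSpec V ↔
      ∀ A k B, L = A ++ k :: B → StepOK (stackAfter (A.map op)) (op k) := by
    constructor
    · rintro ⟨s, hs⟩ A k B rfl
      exact ((stackRun_iff hnd).1 hs).2 _ _ (B.map op) (by simp)
    · intro h
      refine ⟨_, (stackRun_iff hnd).2 ⟨rfl, fun α o β hτ => ?_⟩⟩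
      obtain ⟨A, B', rfl, rfl, hB⟩ := List.map_eq_append_iff.1 hτ
      obtain ⟨k, B, rfl, rfl, rfl⟩ := List.map_eq_cons_iff.1 hB
      exact h A k B rfl
  have hsplit : ∀ k, ∃ A B, L = A ++ k :: B := fun k => List.append_of_mem (hmem k)
  rw [hspec]
  constructor
  · intro h
    have htop : ∀ A k B v, L = A ++ k :: B → (op k = .pop v ∨ op k = .peek v) →
        ∃ s', stackAfter (A.map op) = s' ++ [v] := by
      intro A k B v hs hk
      have := h A k B hs
      rcases hk with hk | hk <;> rw [hk] at this <;> exact this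
    refine ⟨?_, ?_, ?_, ?_⟩
    · intro v j hj
      obtain ⟨A, B, hs⟩ := hsplit j
      obtain ⟨s', hs'⟩ := htop A j B v hs hj
      exact ((hmemA A j B hs v).1 (by simp [hs'])).1
    · intro v i j hi hj
      obtain ⟨A, B, hs⟩ := hsplit j
      obtain ⟨s', hs'⟩ := htop A j B v hs (.inr hj)
      have h1 := ((hmemA A j B hs v).1 (by simp [hs'])).2
      have h2 : i ≠ j := by
        rintro rfl
        simp [hi] at hj
      by_contra h3
      rcases lt_trichotomy (key i) (key j) with h4 | h4 | h4
      · exact h1 ⟨i, hi, h4⟩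
      -- Different operations cannot share a key: both occur in the list `L`, along which the key
      -- increases strictly.
      · obtain ⟨A', B', hs2⟩ := hsplit i
        have h5 := hmem j
        rw [hs2, List.mem_append, List.mem_cons] at h5
        rw [hs2, List.pairwise_append] at hL
        rcases h5 with h5 | h5 | h5
        · have := hL.2.2 j h5 i (by simp)
          simp [h4] at this
        · exact h2 h5.symm
        · have := (List.pairwise_cons.1 hL.2.1).1 j h5
          simp [h4] at this
      · exact h3 h4
    · intro v w i j k hi hj hk hij hjk
      obtain ⟨A, B, hs⟩ := hsplit k
      obtain ⟨s', hs'⟩ := htop A k B v hs hk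
      by_contra h1
      have hw := (hmemA A k B hs w).2 ⟨⟨j, hj, hjk⟩, h1⟩
      have hp := hord A k B hs
      rw [hs', List.mem_append, List.mem_singleton] at hw
      rcases hw with hw | rfl
      · rw [hs', List.pairwise_append] at hp
        obtain ⟨j', i', hj', hi', hlt⟩ := hp.2.2 w hw v (by simp)
        rw [hpush w j' j hj' hj, hpush v i' i hi' hi] at hlt
        exact hlt.asymm hij
      · rw [hpush w i j hi hj] at hij
        exact lt_irrefl _ hij
    · intro w j k hj hk hjk
      obtain ⟨A, B, hs⟩ := hsplit k
      have h0 : stackAfter (A.map op) = [] := by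
        have := h A k B hs
        rwa [hk] at this
      by_contra h1
      have hw := (hmemA A k B hs w).2 ⟨⟨j, hj, hjk⟩, h1⟩
      simp [h0] at hw
  · intro h A k B hs
    have htop : ∀ v, (op k = .pop v ∨ op k = .peek v) →
        ∃ s', stackAfter (A.map op) = s' ++ [v] := by
      intro v hk
      obtain ⟨i, hi, hik⟩ := h.push_before v k hk
      have hv : v ∈ stackAfter (A.map op) := by
        refine (hmemA A k B hs v).2 ⟨⟨i, hi, hik⟩, ?_⟩
        rintro ⟨l, hl, hlk⟩
        rcases hk with hk | hk
        · rw [hpop v l k hl hk] at hlk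
          exact lt_irrefl _ hlk
        · exact (h.peek_before v l k hl hk).asymm hlk
      -- If `v` is not the last entry, then the last entry `w` was pushed after `v` and is still
      -- present, against `lifo`.
      obtain ⟨s1, s2, hs12⟩ := List.append_of_mem hv
      rcases List.eq_nil_or_concat s2 with rfl | ⟨s3, w, rfl⟩
      · exact ⟨s1, hs12⟩
      · exfalso
        have hp := hord A k B hs
        rw [hs12, List.pairwise_append] at hp
        obtain ⟨i', j, hi', hj, hlt⟩ := (List.pairwise_cons.1 hp.2.1).1 w (by simp)
        obtain ⟨⟨j', hj', hjk⟩, hno⟩ := (hmemA A k B hs w).1 (by simp [hs12])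
        rw [hpush w j' j hj' hj] at hjk
        exact hno (h.lifo v w i' j k hi' hj hk hlt hjk)
    cases hk : op k with
    | push v => trivial
    | pop v => exact htop v (.inl hk)
    | peek v => exact htop v (.inr hk)
    | empty =>
      refine List.eq_nil_iff_forall_not_mem.2 fun w hw => ?_
      obtain ⟨⟨j, hj, hjk⟩, hno⟩ := (hmemA A k B hs w).1 hw
      exact hno (h.empty w j k hj hk hjk)

end Legal

/-! ### Linearizability as existence of a legal order extending the interval order. -/

section Linearizable

variable {P V : Type*} {H : History P V}

theorem History.abstractSeq_mem_iff (hU : H.Unambiguous) {l : Fin H.size → ℚ≥0}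
    (hl : Function.Injective l) :
    H.abstractSeq l ∈ stackSpec V ↔ Legal (fun i => (H.opr i).op) l := by
  have : H.abstractSeq l =
      ((List.finRange H.size).map (Tuple.sort l)).map fun i => (H.opr i).op := by
    simp [History.abstractSeq, List.ofFn_eq_map]
  rw [this]
  refine mem_stackSpec_iff_legal ?_ ?_ ?_ ?_
  · intro v i j hi hj
    exact ((hU v ⟨i, by simp [hi, StackOp.value]⟩).1).unique hi hj
  · intro v i j hi hj
    exact (hU v ⟨i, by simp [hi, StackOp.value]⟩).2 i j hi hj
  · rw [List.pairwise_map]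
    have : (List.finRange H.size).Pairwise (· < ·) := List.pairwise_lt_finRange _
    refine this.imp fun {i j} hij => ?_
    refine lt_of_le_of_ne (Tuple.monotone_sort l hij.le) fun h => ?_
    exact hij.ne ((Tuple.sort l).injective (hl h))
  · intro i
    rw [List.mem_map]
    exact ⟨(Tuple.sort l).symm i, List.mem_finRange _, by simp⟩

/-- An order that extends the interval order is realized by time points. -/
theorem History.exists_isLinearization {α : Type*} [LinearOrder α] {key : Fin H.size → α}
    (hinj : Function.Injective key)
    (hord : ∀ i j, (H.opr i).res ≤ (H.opr j).inv → key i < key j) :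
    ∃ l, H.IsLinearization l ∧ ∀ i j, l i < l j ↔ key i < key j := by
  classical
  -- The latest invocation among the operations up to `i` in the order. It lies strictly before the
  -- response of every operation from `i` on, so the points can be placed just after it.
  let lo : Fin H.size → ℚ≥0 := fun i =>
    (Finset.univ.filter fun j => key j ≤ key i).sup fun j => (H.opr j).inv
  have hlo : ∀ i j, key j ≤ key i → (H.opr j).inv ≤ lo i := fun i j h =>
    Finset.le_sup (f := fun j => (H.opr j).inv) (by simpa using h)
  have hlt : ∀ i k, key i ≤ key k → lo i < (H.opr k).res := by
    intro i k hik
    rw [Finset.sup_lt_iff]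
    · intro j hj
      by_contra h
      have := hord k j (not_lt.1 h)
      simp only [Finset.mem_filter, Finset.mem_univ, true_and] at hj
      exact absurd (hj.trans hik) (not_le.2 this)
    · exact lt_of_le_of_lt bot_le (H.opr k).inv_lt_res
  have hmono : ∀ i j, key i ≤ key j → lo i ≤ lo j := by
    intro i j hij
    refine Finset.sup_mono fun k hk => ?_
    simp only [Finset.mem_filter, Finset.mem_univ, true_and] at hk ⊢
    exact hk.trans hij
  -- The least slack between `lo i` and the response of `i`; any positive number serves if there are
  -- no operations.
  obtain ⟨ε, hε, hεle⟩ : ∃ ε : ℚ≥0, 0 < ε ∧ ∀ i, lo i + ε ≤ (H.opr i).res := by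
    by_cases hn : (Finset.univ : Finset (Fin H.size)).Nonempty
    · obtain ⟨i0, -, hi0⟩ := Finset.exists_min_image Finset.univ
        (fun i => (H.opr i).res - lo i) hn
      refine ⟨(H.opr i0).res - lo i0, tsub_pos_of_lt (hlt i0 i0 le_rfl), fun i => ?_⟩
      have := hi0 i (Finset.mem_univ i)
      calc lo i + ((H.opr i0).res - lo i0) ≤ lo i + ((H.opr i).res - lo i) := by gcongr
        _ = (H.opr i).res := add_tsub_cancel_of_le (hlt i i le_rfl).le
    · refine ⟨1, one_pos, fun i => absurd ⟨i, Finset.mem_univ i⟩ hn⟩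
  let rk : Fin H.size → ℕ := fun i => (Finset.univ.filter fun j => key j < key i).card
  have hrk : ∀ i j, key i < key j → rk i < rk j := by
    intro i j hij
    refine Finset.card_lt_card (Finset.ssubset_iff_of_subset ?_ |>.2 ⟨i, by simpa using hij, by simp⟩)
    intro k hk
    simp only [Finset.mem_filter, Finset.mem_univ, true_and] at hk ⊢
    exact hk.trans hij
  have hrkn : ∀ i, rk i < H.size := by
    intro i
    have : rk i < (Finset.univ : Finset (Fin H.size)).card :=
      Finset.card_lt_card (Finset.ssubset_iff_of_subset (Finset.subset_univ _) |>.2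
        ⟨i, Finset.mem_univ i, by simp⟩)
    simpa using this
  -- The rank separates operations with the same `lo`; the fraction lies strictly between 0 and 1,
  -- so the slack is not used up.
  let l : Fin H.size → ℚ≥0 := fun i => lo i + ε * ((rk i + 1 : ℕ) / (H.size + 1 : ℕ))
  have hpos : (0 : ℚ≥0) < (H.size + 1 : ℕ) := by positivity
  have hl : ∀ i j, key i < key j → l i < l j := by
    intro i j hij
    have h1 := hmono i j hij.le
    have h2 : ((rk i + 1 : ℕ) : ℚ≥0) < (rk j + 1 : ℕ) := by exact_mod_cast Nat.succ_lt_succ (hrk i j hij)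
    have h3 : ((rk i + 1 : ℕ) : ℚ≥0) / (H.size + 1 : ℕ) < (rk j + 1 : ℕ) / (H.size + 1 : ℕ) :=
      div_lt_div_of_pos_right h2 hpos
    have h4 := mul_lt_mul_of_pos_left h3 hε
    exact add_lt_add_of_le_of_lt h1 h4
  have hiff : ∀ i j, l i < l j ↔ key i < key j := by
    intro i j
    refine ⟨fun h => ?_, hl i j⟩
    rcases lt_trichotomy (key i) (key j) with h1 | h1 | h1
    · exact h1
    · rw [hinj h1] at h
      exact absurd h (lt_irrefl _)
    · exact absurd (hl j i h1) h.asymm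
  refine ⟨l, ⟨?_, fun i => ⟨?_, ?_⟩⟩, hiff⟩
  · intro i j hij
    by_contra hne
    rcases lt_or_gt_of_ne (fun h => hne (hinj h)) with h | h
    · exact (hl i j h).ne hij
    · exact (hl j i h).ne hij.symm
  · have h1 := hlo i i le_rfl
    have h2 : 0 < ε * (((rk i + 1 : ℕ) : ℚ≥0) / (H.size + 1 : ℕ)) := by positivity
    exact lt_of_le_of_lt h1 (lt_add_of_pos_right _ h2)
  · have h1 : ((rk i + 1 : ℕ) : ℚ≥0) / (H.size + 1 : ℕ) < 1 := by
      rw [div_lt_one hpos]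
      exact_mod_cast Nat.succ_lt_succ (hrkn i)
    calc l i < lo i + ε := by
          have := mul_lt_mul_of_pos_left h1 hε
          rw [mul_one] at this
          exact add_lt_add_of_le_of_lt le_rfl this
      _ ≤ _ := hεle i

theorem Legal.congr {n : ℕ} {α β : Type*} [LinearOrder α] [LinearOrder β] {op : Fin n → StackOp V}
    {key : Fin n → α} {key' : Fin n → β} (h : ∀ i j, key' i < key' j ↔ key i < key j)
    (hk : Legal op key) : Legal op key' := by
  refine ⟨?_, ?_, ?_, ?_⟩ <;> simp only [h]
  · exact hk.push_before
  · exact hk.peek_before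
  · exact hk.lifo
  · exact hk.empty

theorem History.linearizable_of_key (hU : H.Unambiguous) {α : Type*} [LinearOrder α]
    {key : Fin H.size → α} (hinj : Function.Injective key)
    (hord : ∀ i j, (H.opr i).res ≤ (H.opr j).inv → key i < key j)
    (hk : Legal (fun i => (H.opr i).op) key) : H.Linearizable := by
  obtain ⟨l, hl, h⟩ := History.exists_isLinearization hinj hord
  exact ⟨l, hl, (History.abstractSeq_mem_iff hU hl.1).2 (hk.congr h)⟩

theorem History.Linearizable.exists_key (hU : H.Unambiguous) (h : H.Linearizable) :
    ∃ key : Fin H.size → ℚ≥0, Function.Injective key ∧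
      (∀ i j, (H.opr i).res ≤ (H.opr j).inv → key i < key j) ∧
      Legal (fun i => (H.opr i).op) key := by
  obtain ⟨l, hl, h⟩ := h
  refine ⟨l, hl.1, fun i j hij => ?_, (History.abstractSeq_mem_iff hU hl.1).1 h⟩
  exact ((hl.2 i).2.trans_le hij).trans (hl.2 j).1

end Linearizable

/-! ### Elimination of values -/

/-- Discrete data of a history with operations `0, …, n - 1`: methods `kd`, the push operation
`own i` with the value of `i`, positions `pI`, `pR` of the invocations and responses among all
time points, and for the value pushed by `v` the earliest response `b v` and the latest
invocation `c v` of its operations (`2 * n` if it is never popped). -/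
structure Disc (n : ℕ) (kd own pI pR b c : ℕ → ℕ) : Prop where
  pI_lt : ∀ i < n, pI i < pR i
  pR_lt : ∀ i < n, pR i < 2 * n
  pI_inj : ∀ i < n, ∀ j < n, pI i = pI j → i = j
  pR_ne_pI : ∀ i < n, ∀ j < n, pR i ≠ pI j
  own_lt : ∀ i < n, kd i < 3 → own i < n
  kd_own : ∀ i < n, kd i < 3 → kd (own i) = 0
  own_push : ∀ i < n, kd i = 0 → own i = i
  pop_unique : ∀ i < n, ∀ j < n, kd i = 1 → kd j = 1 → own i = own j → i = j
  b_le : ∀ i < n, kd i < 3 → b (own i) ≤ pR i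
  b_mem : ∀ v < n, kd v = 0 → ∃ i < n, kd i < 3 ∧ own i = v ∧ b v = pR i
  c_le : ∀ i < n, kd i < 3 → pI i ≤ c (own i)
  c_mem : ∀ v < n, kd v = 0 → (∃ i < n, kd i = 1 ∧ own i = v) →
    ∃ i < n, kd i < 3 ∧ own i = v ∧ c v = pI i
  c_eq : ∀ v < n, kd v = 0 → (¬ ∃ i < n, kd i = 1 ∧ own i = v) → c v = 2 * n

/-- Legality in terms of methods and owners. -/
structure LegalD {α : Type*} [LinearOrder α] (n : ℕ) (kd own : ℕ → ℕ) (key : ℕ → α) : Prop where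
  push_before : ∀ j < n, (kd j = 1 ∨ kd j = 2) → key (own j) < key j
  peek_before : ∀ i < n, ∀ j < n, kd i = 1 → kd j = 2 → own i = own j → key j < key i
  lifo : ∀ j < n, ∀ k < n, kd j = 0 → (kd k = 1 ∨ kd k = 2) → key (own k) < key j → key j < key k →
    ∃ l < n, kd l = 1 ∧ own l = j ∧ key l < key k
  empty : ∀ j < n, ∀ k < n, kd j = 0 → kd k = 3 → key j < key k →
    ∃ l < n, kd l = 1 ∧ own l = j ∧ key l < key k

section Elimination

variable (kd own pI pR b c : ℕ → ℕ)

/-- First gap in which the operation `i` may take place if its value is at the bottom. -/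
def lowGap (i : ℕ) : ℕ := if kd i = 1 then c (own i) else pI i

/-- Upper bound for the gaps in which `i` may take place if its value is at the bottom. -/
def highGap (i : ℕ) : ℕ := if kd i = 0 then b (own i) else pR i

/-- In gap `g` the value `w` must be on the stack. -/
def Covers (w g : ℕ) : Prop := b w ≤ g ∧ g < c w

/-- In gap `g` no value of `S` other than `v` has to be on the stack. -/
def Visible (S : Finset ℕ) (v g : ℕ) : Prop := ∀ w ∈ S, w ≠ v → ¬ Covers b c w g

/-- The operation `o` can take place in a visible gap. -/
def Placeable (S : Finset ℕ) (v o : ℕ) : Prop :=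
  ∃ g, lowGap kd own pI c o ≤ g ∧ g < highGap kd own pR b o ∧ Visible b c S v g

/-- The values that have to be on the stack in some gap. -/
def solidValues (n : ℕ) : Finset ℕ := (Finset.range n).filter fun v => kd v = 0 ∧ b v < c v

/-- The values of `S` can be removed one by one. -/
inductive Eliminable (n : ℕ) : Finset ℕ → Prop
  | empty : Eliminable n ∅
  | erase {S : Finset ℕ} {v : ℕ} : v ∈ S →
      (∀ o < n, kd o < 3 → own o = v → Placeable kd own pI pR b c S v o) →
      Eliminable n (S.erase v) → Eliminable n S

variable {kd own pI pR b c} {n : ℕ}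

/-- The rank is the moment of removal. A value removed early lies deep in the stack, so only values
of larger rank can get in the way of its operations. -/
theorem Eliminable.exists_rank {S : Finset ℕ} (h : Eliminable kd own pI pR b c n S) :
    ∃ j : ℕ → ℕ, (∀ v ∈ S, j v < S.card) ∧ (∀ v ∈ S, ∀ w ∈ S, j v = j w → v = w) ∧
      ∀ v ∈ S, ∀ o < n, kd o < 3 → own o = v →
        ∃ g, lowGap kd own pI c o ≤ g ∧ g < highGap kd own pR b o ∧
          ∀ w ∈ S, j v < j w → ¬ Covers b c w g := by
  induction h with
  | empty => exact ⟨id, by simp⟩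
  | @erase S v hv hpl _ ih =>
    obtain ⟨j, h1, h2, h3⟩ := ih
    have hcard := Finset.card_erase_add_one hv
    refine ⟨fun x => if x = v then 0 else j x + 1, ?_, ?_, ?_⟩
    · intro w hw
      by_cases hwv : w = v
      · simp only [hwv, if_true]; omega
      · have := h1 w (Finset.mem_erase.2 ⟨hwv, hw⟩)
        simp only [hwv, if_false]; omega
    · intro x hx y hy hxy
      by_cases hxv : x = v <;> by_cases hyv : y = v <;> simp only [hxv, hyv, if_true, if_false] at hxy ⊢
      · omega
      · omega
      · exact h2 x (Finset.mem_erase.2 ⟨hxv, hx⟩) y (Finset.mem_erase.2 ⟨hyv, hy⟩) (by omega)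
    · intro x hx o ho hk hox
      by_cases hxv : x = v
      · obtain ⟨g, g1, g2, g3⟩ := hpl o ho hk (hox.trans hxv)
        refine ⟨g, g1, g2, fun w hw hlt => g3 w hw ?_⟩
        rintro rfl
        simp [hxv] at hlt
      · obtain ⟨g, g1, g2, g3⟩ := h3 x (Finset.mem_erase.2 ⟨hxv, hx⟩) o ho hk hox
        refine ⟨g, g1, g2, fun w hw hlt => ?_⟩
        by_cases hwv : w = v
        · simp [hwv] at hlt
        · simp only [hxv, hwv, if_false] at hlt
          exact g3 w (Finset.mem_erase.2 ⟨hwv, hw⟩) (by omega)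

theorem Disc.b_ne_c (D : Disc n kd own pI pR b c) {v : ℕ} (hv : v < n) (hk : kd v = 0) :
    b v ≠ c v := by
  obtain ⟨i, hi, -, -, hb⟩ := D.b_mem v hv hk
  by_cases hp : ∃ i < n, kd i = 1 ∧ own i = v
  · obtain ⟨j, hj, -, -, hc⟩ := D.c_mem v hv hk hp
    rw [hb, hc]
    exact D.pR_ne_pI i hi j hj
  · have := D.pR_lt i hi
    rw [hb, D.c_eq v hv hk hp]
    omega

/-- Necessity: in every legal order, empties see a gap without solid values, and in every set of
solid values some value can be removed. -/
theorem Disc.necessary (D : Disc n kd own pI pR b c) {α : Type*} [LinearOrder α] {key : ℕ → α}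
    (hinj : ∀ i < n, ∀ j < n, key i = key j → i = j)
    (hord : ∀ i < n, ∀ j < n, pR i < pI j → key i < key j) (hL : LegalD n kd own key) :
    (∀ e < n, kd e = 3 → ∃ g, pI e ≤ g ∧ g < pR e ∧
      ∀ w ∈ solidValues kd b c n, ¬ Covers b c w g) ∧
    ∀ S ⊆ solidValues kd b c n, S.Nonempty → ∃ v ∈ S, ∀ o < n, kd o < 3 → own o = v →
      Placeable kd own pI pR b c S v o := by
  classical
  -- The gap in which `o` happens: it starts with the last invocation among the operations up to
  -- `o`.
  let G : ℕ → ℕ := fun o => ((Finset.range n).filter fun i => key i ≤ key o).sup pI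
  have hG1 : ∀ o, ∀ i < n, key i ≤ key o → pI i ≤ G o := fun o i hi h =>
    Finset.le_sup (f := pI) (by simp [hi, h])
  have hG2 : ∀ o, ∀ k < n, key o ≤ key k → G o < pR k := by
    intro o k hk hok
    refine (Finset.sup_lt_iff (lt_of_le_of_lt (Nat.zero_le _) (D.pI_lt k hk))).2 fun i hi => ?_
    simp only [Finset.mem_filter, Finset.mem_range] at hi
    by_contra h
    have h1 : pR k ≠ pI i := D.pR_ne_pI k hk i hi.1
    have := hord k hk i hi.1 (by omega)
    exact absurd (hi.2.trans hok) (not_le.2 this)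
  have hown : ∀ i < n, kd i < 3 → key (own i) ≤ key i := by
    intro i hi hk
    by_cases h0 : kd i = 0
    · rw [D.own_push i hi h0]
    · exact (hL.push_before i hi (by omega)).le
  -- If `w` covers the gap of `o`, then an operation of `w` has already responded, so `w` has been
  -- pushed; and an operation of `w` has not yet been invoked, so, if `w` is popped at all, the pop
  -- is still to come.
  have hcov : ∀ w ∈ solidValues kd b c n, ∀ o < n, Covers b c w (G o) →
      key w < key o ∧ ∀ l < n, kd l = 1 → own l = w → ¬ key l < key o := by
    intro w hw o ho hc
    simp only [solidValues, Finset.mem_filter, Finset.mem_range] at hw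
    constructor
    · obtain ⟨i, hi, hki, hoi, hb⟩ := D.b_mem w hw.1 hw.2.1
      by_contra h
      have h1 := hown i hi hki
      rw [hoi] at h1
      have h2 := hG2 o i hi ((not_lt.1 h).trans h1)
      have := hc.1
      omega
    · intro l hl hkl hol hlt
      obtain ⟨i, hi, hki, hoi, hci⟩ := D.c_mem w hw.1 hw.2.1 ⟨l, hl, hkl, hol⟩
      have hil : key i ≤ key l := by
        have h3 : kd i = 0 ∨ kd i = 1 ∨ kd i = 2 := by omega
        rcases h3 with h3 | h3 | h3
        · have h4 := hown l hl (by omega)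
          rw [hol, ← hoi, D.own_push i hi h3] at h4
          exact h4
        · rw [D.pop_unique i hi l hl h3 hkl (by rw [hoi, hol])]
        · exact (hL.peek_before l hl i hi hkl h3 (by rw [hol, hoi])).le
      have h5 := hG1 o i hi (hil.trans hlt.le)
      have := hc.2
      omega
  constructor
  · intro e he hke
    refine ⟨G e, hG1 e e he le_rfl, hG2 e e he le_rfl, fun w hw hc => ?_⟩
    obtain ⟨h1, h2⟩ := hcov w hw e he hc
    simp only [solidValues, Finset.mem_filter, Finset.mem_range] at hw
    obtain ⟨l, hl, hkl, hol, hlt⟩ := hL.empty w hw.1 e he hw.2.1 hke h1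
    exact h2 l hl hkl hol hlt
  · intro S hS hne
    -- The value of `S` pushed first. By `lifo`, no other value of `S` is on the stack at any
    -- operation of `v`.
    obtain ⟨v, hvS, hmin⟩ := Finset.exists_min_image S key hne
    refine ⟨v, hvS, fun o ho hko hov => ⟨G o, ?_, ?_, ?_⟩⟩
    · unfold lowGap
      split_ifs with h1
      · have hv := hS hvS
        simp only [solidValues, Finset.mem_filter, Finset.mem_range] at hv
        obtain ⟨i, hi, hki, hoi, hci⟩ := D.c_mem v hv.1 hv.2.1 ⟨o, ho, h1, hov⟩
        rw [hov, hci]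
        refine hG1 o i hi ?_
        have h3 : kd i = 0 ∨ kd i = 1 ∨ kd i = 2 := by omega
        rcases h3 with h3 | h3 | h3
        · have h4 := hown o ho (by omega)
          rw [hov, ← hoi, D.own_push i hi h3] at h4
          exact h4
        · rw [D.pop_unique i hi o ho h3 h1 (by rw [hoi, hov])]
        · exact (hL.peek_before o ho i hi h1 h3 (by rw [hov, hoi])).le
      · exact hG1 o o ho le_rfl
    · unfold highGap
      split_ifs with h1
      · have hv := hS hvS
        simp only [solidValues, Finset.mem_filter, Finset.mem_range] at hv
        obtain ⟨i, hi, hki, hoi, hb⟩ := D.b_mem v hv.1 hv.2.1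
        rw [hov, hb]
        refine hG2 o i hi ?_
        have h4 := hown i hi hki
        rw [hoi, ← hov, D.own_push o ho h1] at h4
        exact h4
      · exact hG2 o o ho le_rfl
    · intro w hw hwv hc
      obtain ⟨h1, h2⟩ := hcov w (hS hw) o ho hc
      have hw' := hS hw
      have hv' := hS hvS
      simp only [solidValues, Finset.mem_filter, Finset.mem_range] at hw' hv'
      have hvw : key v < key w := lt_of_le_of_ne (hmin w hw) fun h =>
        hwv (hinj v hv'.1 w hw'.1 h).symm
      by_cases h0 : kd o = 0
      · have : o = v := by rw [← hov, D.own_push o ho h0]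
        rw [this] at h1
        exact hvw.asymm h1
      · obtain ⟨l, hl, hkl, hol, hlt⟩ :=
          hL.lifo w hw'.1 o ho hw'.2.1 (by omega) (by rwa [hov]) h1
        exact h2 l hl hkl hol hlt

/-- Gaps for all operations in which they can take place simultaneously. -/
theorem Disc.exists_gaps (D : Disc n kd own pI pR b c) {j : ℕ → ℕ}
    (hj : ∀ v ∈ solidValues kd b c n, ∀ o < n, kd o < 3 → own o = v →
        ∃ g, lowGap kd own pI c o ≤ g ∧ g < highGap kd own pR b o ∧
          ∀ w ∈ solidValues kd b c n, j v < j w → ¬ Covers b c w g)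
    (hE : ∀ e < n, kd e = 3 → ∃ g, pI e ≤ g ∧ g < pR e ∧
      ∀ w ∈ solidValues kd b c n, ¬ Covers b c w g) :
    ∃ P Q G : ℕ → ℕ,
      (∀ v ∈ solidValues kd b c n, P v < Q v) ∧
      (∀ o < n, pI o ≤ G o ∧ G o < pR o) ∧
      (∀ v ∈ solidValues kd b c n, ∀ o < n, kd o < 3 → own o = v → P v ≤ G o ∧ G o ≤ Q v ∧
        (kd o = 0 → G o = P v) ∧ (kd o = 1 → G o = Q v)) ∧
      (∀ v ∈ solidValues kd b c n, ∀ o < n, (kd o = 3 ∨ kd o < 3 ∧ own o ∈ solidValues kd b c n ∧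
        j (own o) < j v) → G o ≤ P v ∨ Q v ≤ G o ∧ ∃ l < n, kd l = 1 ∧ own l = v) ∧
      ∀ o < n, kd o < 3 → own o ∉ solidValues kd b c n → G o = c (own o) := by
  classical
  set L := solidValues kd b c n with hLdef
  -- The gap `g` is usable for `v`: no value lying above `v`, that is, of larger rank, is forced to
  -- be on the stack there.
  let U : ℕ → ℕ → Prop := fun v g => ∀ w ∈ L, j v < j w → ¬ Covers b c w g
  have hLmem : ∀ v ∈ L, v < n ∧ kd v = 0 ∧ b v < c v := by
    intro v hv
    simpa [hLdef, solidValues] using hv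
  -- Push as late as possible: the last usable gap before `b v`.
  have hP : ∀ v ∈ L, ∃ P, pI v ≤ P ∧ P < b v ∧ U v P ∧ ∀ g < b v, U v g → g ≤ P := by
    intro v hv
    obtain ⟨h1, h2, h3⟩ := hLmem v hv
    obtain ⟨g, g1, g2, g3⟩ := hj v hv v h1 (by omega) (D.own_push v h1 h2)
    simp only [lowGap, highGap, h2, if_true, D.own_push v h1 h2] at g1 g2
    have hne : ((Finset.range (b v)).filter fun g => U v g).Nonempty :=
      ⟨g, by simp only [Finset.mem_filter, Finset.mem_range]; exact ⟨g2, g3⟩⟩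
    obtain ⟨P, hP1, hP2⟩ := Finset.exists_max_image _ id hne
    simp only [Finset.mem_filter, Finset.mem_range, id] at hP1 hP2
    refine ⟨P, ?_, hP1.1, hP1.2, fun g' h h' => hP2 g' ⟨h, h'⟩⟩
    have := hP2 g ⟨g2, g3⟩
    simp at g1
    omega
  -- Pop as early as possible: the first usable gap from `c v` on. If there is no pop, `2 * n` lies
  -- beyond all gaps in which operations happen.
  have hQ : ∀ v ∈ L, ∃ Q, c v ≤ Q ∧ (∀ g, c v ≤ g → g < 2 * n → U v g → Q ≤ g) ∧
      (∀ o < n, kd o = 1 → own o = v → U v Q ∧ Q < pR o) ∧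
      ((¬ ∃ l < n, kd l = 1 ∧ own l = v) → Q = 2 * n) := by
    intro v hv
    obtain ⟨h1, h2, h3⟩ := hLmem v hv
    by_cases hp : ∃ l < n, kd l = 1 ∧ own l = v
    · obtain ⟨l, hl, hkl, hol⟩ := hp
      obtain ⟨g, g1, g2, g3⟩ := hj v hv l hl (by omega) hol
      simp only [lowGap, highGap, hkl, if_true, hol] at g1 g2
      have hex : ∃ g, c v ≤ g ∧ U v g := ⟨g, g1, g3⟩
      refine ⟨Nat.find hex, (Nat.find_spec hex).1, fun g h _ h' => Nat.find_min' hex ⟨h, h'⟩, ?_,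
        fun h => absurd ⟨l, hl, hkl, hol⟩ h⟩
      intro o ho hko hoo
      obtain rfl := D.pop_unique o ho l hl hko hkl (by rw [hoo, hol])
      refine ⟨(Nat.find_spec hex).2, lt_of_le_of_lt (Nat.find_min' hex ⟨g1, g3⟩) ?_⟩
      simpa using g2
    · have := D.c_eq v h1 h2 hp
      refine ⟨2 * n, by omega, fun g h1 h2 _ => by omega, fun o ho hk h => ?_, fun _ => rfl⟩
      exact absurd ⟨o, ho, hk, h⟩ hp
  choose! P hP1 hP2 hP3 hP4 using hP
  choose! Q hQ1 hQ2 hQ3 hQ4 using hQ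
  have hG : ∀ o < n, ∃ G, (pI o ≤ G ∧ G < pR o) ∧
      (kd o < 3 → own o ∈ L → P (own o) ≤ G ∧ G ≤ Q (own o) ∧
        (kd o = 0 → G = P (own o)) ∧ (kd o = 1 → G = Q (own o)) ∧ U (own o) G) ∧
      (kd o = 3 → ∀ w ∈ L, ¬ Covers b c w G) ∧ (kd o < 3 → own o ∉ L → G = c (own o)) ∧
      (3 < kd o → G = pI o) := by
    intro o ho
    rcases lt_trichotomy (kd o) 3 with hk | hk | hk
    · have hb := D.b_le o ho hk
      have hc := D.c_le o ho hk
      by_cases hL : own o ∈ L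
      · have hlt := (hLmem _ hL).2.2
        have q1 := hP2 _ hL
        have q2 := hQ1 _ hL
        have q3 := hP1 _ hL
        suffices h : ∃ G, (pI o ≤ G ∧ G < pR o) ∧ (P (own o) ≤ G ∧ G ≤ Q (own o) ∧
            (kd o = 0 → G = P (own o)) ∧ (kd o = 1 → G = Q (own o)) ∧ U (own o) G) by
          obtain ⟨G, h1, h2⟩ := h
          exact ⟨G, h1, fun _ _ => h2, by omega, fun _ h => absurd hL h, by omega⟩
        have h3 : kd o = 0 ∨ kd o = 1 ∨ kd o = 2 := by omega
        rcases h3 with h3 | h3 | h3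
        · rw [D.own_push o ho h3] at *
          exact ⟨P o, ⟨q3, by omega⟩, by omega, by omega, by omega, by omega, hP3 _ hL⟩
        · obtain ⟨q4, q5⟩ := hQ3 _ hL o ho h3 rfl
          exact ⟨Q (own o), ⟨by omega, by omega⟩, by omega, by omega, by omega, by omega, q4⟩
        -- A peek keeps its gap unless that lies outside the stay from `P` to `Q`, in which case it
        -- moves to the nearer end. It remains within its own interval because `P < b ≤ pR o` and
        -- `pI o ≤ c ≤ Q`.
        · obtain ⟨g, g1, g2, g3⟩ := hj _ hL o ho hk rfl
          simp only [lowGap, highGap, h3] at g1 g2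
          norm_num at g1 g2
          by_cases h4 : g < P (own o)
          · exact ⟨P (own o), ⟨by omega, by omega⟩, by omega, by omega, by omega, by omega,
              hP3 _ hL⟩
          by_cases h5 : Q (own o) < g
          · by_cases hp : ∃ l < n, kd l = 1 ∧ own l = own o
            · obtain ⟨l, hl, hkl, hol⟩ := hp
              exact ⟨Q (own o), ⟨by omega, by omega⟩, by omega, by omega, by omega, by omega,
                (hQ3 _ hL l hl hkl hol).1⟩
            · have := hQ4 _ hL hp
              have := D.pR_lt o ho
              omega
          · exact ⟨g, ⟨g1, g2⟩, by omega, by omega, by omega, by omega, g3⟩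
      · have h1 := D.own_lt o ho hk
        have h2 := D.kd_own o ho hk
        have h3 : ¬ b (own o) < c (own o) := fun h => hL (by simp [hLdef, solidValues, h1, h2, h])
        have h4 := D.b_ne_c h1 h2
        -- For a value that is not solid, `c < b`, so the gap `c` lies in the intervals of all its
        -- operations.
        exact ⟨c (own o), ⟨by omega, by omega⟩, fun _ h => absurd h hL, by omega, fun _ _ => rfl,
          by omega⟩
    · obtain ⟨g, g1, g2, g3⟩ := hE o ho hk
      exact ⟨g, ⟨g1, g2⟩, by omega, fun _ => g3, by omega, by omega⟩
    · exact ⟨pI o, ⟨le_rfl, D.pI_lt o ho⟩, by omega, by omega, by omega, fun _ => rfl⟩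
  choose! G hG1 hG2 hG3 hG4 hG5 using hG
  refine ⟨P, Q, G, ?_, hG1, ?_, ?_, fun o ho hk h => hG4 o ho hk h⟩
  · intro v hv
    have q1 := hP2 _ hv
    have q2 := hQ1 _ hv
    have := (hLmem _ hv).2.2
    omega
  · rintro v hv o ho hk rfl
    obtain ⟨h1, h2, h3, h4, -⟩ := hG2 o ho hk hv
    exact ⟨h1, h2, h3, h4⟩
  · intro v hv o ho h
    have hnc : ¬ Covers b c v (G o) := by
      rcases h with h | ⟨h1, h2, h3⟩
      · exact hG3 o ho h v hv
      · exact (hG2 o ho h1 h2).2.2.2.2 v hv h3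
    have hU : U v (G o) := by
      intro w hw hlt
      rcases h with h | ⟨h1, h2, h3⟩
      · exact hG3 o ho h w hw
      · exact (hG2 o ho h1 h2).2.2.2.2 w hw (h3.trans hlt)
    have hlt2 : G o < 2 * n := (hG1 o ho).2.trans (D.pR_lt o ho)
    -- The operation avoids the gaps covered by `v`, and its gap is usable for `v` as well. By the
    -- extremal choice of `P v` and `Q v` it is therefore not strictly inside the stay of `v`.
    by_cases h5 : G o < b v
    · exact .inl (hP4 v hv _ h5 hU)
    · have h6 : c v ≤ G o := by
        by_contra h7
        exact hnc ⟨by omega, by omega⟩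
      have h7 := hQ2 v hv _ h6 hlt2 hU
      refine .inr ⟨h7, ?_⟩
      by_contra hp
      have := hQ4 v hv hp
      omega

/-- Sufficiency: if all solid values can be eliminated and the empties see gaps without solid
values, then there is a legal order. -/
theorem Disc.sufficient (D : Disc n kd own pI pR b c)
    (hS : Eliminable kd own pI pR b c n (solidValues kd b c n))
    (hE : ∀ e < n, kd e = 3 → ∃ g, pI e ≤ g ∧ g < pR e ∧
      ∀ w ∈ solidValues kd b c n, ¬ Covers b c w g) :
    ∃ key : ℕ → ℕ ×ₗ ℕ ×ₗ ℕ ×ₗ ℕ ×ₗ ℕ, (∀ i j, key i = key j → i = j) ∧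
      (∀ i < n, ∀ j < n, pR i < pI j → key i < key j) ∧ LegalD n kd own key := by
  classical
  obtain ⟨j, hj1, hj2, hj3⟩ := hS.exists_rank
  obtain ⟨P, Q, G, h1, h2, h3, h4, h5⟩ := D.exists_gaps hj3 hE
  have hjn : ∀ v ∈ solidValues kd b c n, j v < n := by
    intro v hv
    refine (hj1 v hv).trans_le ?_
    have : (solidValues kd b c n).card ≤ (Finset.range n).card := Finset.card_filter_le _ _
    simpa using this
  let L := solidValues kd b c n
  -- Order inside one gap: operations of values whose stay ends here, then empties and values in the
  -- middle of their stay, then values whose stay begins here, then the values that are not solid.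
  let ph : ℕ → ℕ := fun o => if kd o = 3 then 1 else if own o ∉ L then 3 else
    if G o = Q (own o) then 0 else if G o = P (own o) then 2 else 1
  -- Stays end from the top of the stack down and begin from the bottom up, while each value that is
  -- not solid forms a block of its own.
  let k3 : ℕ → ℕ := fun o => if kd o = 3 then 0 else if own o ∉ L then own o else
    if G o = Q (own o) then n - j (own o) else if G o = P (own o) then j (own o) else 0
  let ty : ℕ → ℕ := fun o => if kd o = 0 then 0 else if kd o = 2 then 1 else 2
  let key : ℕ → ℕ ×ₗ ℕ ×ₗ ℕ ×ₗ ℕ ×ₗ ℕ := fun o =>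
    toLex (G o, toLex (ph o, toLex (k3 o, toLex (ty o, o))))
  have hlt : ∀ x y, key x < key y ↔ G x < G y ∨ G x = G y ∧ (ph x < ph y ∨ ph x = ph y ∧
      (k3 x < k3 y ∨ k3 x = k3 y ∧ (ty x < ty y ∨ ty x = ty y ∧ x < y))) := by
    intro x y
    simp only [key, Prod.Lex.toLex_lt_toLex]
  have e3 : ∀ o, kd o = 3 → ph o = 1 := by
    intro o h; simp [ph, h]
  have eS : ∀ o < n, kd o < 3 → own o ∉ L → G o = c (own o) ∧ ph o = 3 ∧ k3 o = own o := by
    intro o ho hk h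
    have : kd o ≠ 3 := by omega
    refine ⟨h5 o ho hk h, ?_, ?_⟩ <;> simp [ph, k3, h, this]
  have eL : ∀ o < n, kd o < 3 → own o ∈ L → P (own o) ≤ G o ∧ G o ≤ Q (own o) ∧
      (kd o = 0 → G o = P (own o)) ∧ (kd o = 1 → G o = Q (own o)) ∧
      P (own o) < Q (own o) ∧ j (own o) < n ∧
      (G o = Q (own o) ∧ ph o = 0 ∧ k3 o = n - j (own o) ∨
       G o = P (own o) ∧ ph o = 2 ∧ k3 o = j (own o) ∨
       P (own o) < G o ∧ G o < Q (own o) ∧ ph o = 1) := by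
    intro o ho hk h
    have hk3 : kd o ≠ 3 := by omega
    obtain ⟨a1, a2, a3, a4⟩ := h3 _ h o ho hk rfl
    have a5 := h1 _ h
    refine ⟨a1, a2, a3, a4, a5, hjn _ h, ?_⟩
    by_cases c1 : G o = Q (own o)
    · left; simp [ph, k3, hk3, h, c1]
    by_cases c2 : G o = P (own o)
    · right; left
      have : P (own o) ≠ Q (own o) := by omega
      simp [ph, k3, hk3, h, c2, this]
    · right; right
      refine ⟨by omega, by omega, ?_⟩
      simp [ph, hk3, h, c1, c2]
  have t0 : ∀ o, kd o = 0 → ty o = 0 := by intro o h; simp [ty, h]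
  have t1 : ∀ o, kd o = 1 → ty o = 2 := by intro o h; simp [ty, h]
  have t2 : ∀ o, kd o = 2 → ty o = 1 := by intro o h; simp [ty, h]
  -- A value without a pop has `c v = 2 * n > b v` and is solid, so blocks of other values do end
  -- with a pop.
  have hskip : ∀ v < n, kd v = 0 → v ∉ L → ∃ l < n, kd l = 1 ∧ own l = v := by
    intro v hv hk hL
    by_contra hp
    obtain ⟨i, hi, -, -, hb⟩ := D.b_mem v hv hk
    have h6 := D.pR_lt i hi
    have h7 := D.c_eq v hv hk hp
    exact hL (by simp only [L, solidValues, Finset.mem_filter, Finset.mem_range]; exact ⟨hv, hk, by omega⟩)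
  refine ⟨key, ?_, ?_, ⟨?_, ?_, ?_, ?_⟩⟩
  · intro x y hxy
    have l1 := hlt x y
    have l2 := hlt y x
    simp only [hxy, lt_irrefl, false_iff] at l1 l2
    omega
  · intro x hx y hy hxy
    rw [hlt]
    have := h2 x hx
    have := h2 y hy
    omega
  · intro o ho hk
    rw [hlt]
    have hk' : kd o < 3 := by omega
    have hv := D.own_lt o ho hk'
    have hkv := D.kd_own o ho hk'
    have hvv := D.own_push _ hv hkv
    have hty : ty (own o) < ty o := by
      rw [t0 _ hkv]
      rcases hk with hk | hk
      · rw [t1 _ hk]; omega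
      · rw [t2 _ hk]; omega
    by_cases hL : own o ∈ L
    · have a := eL o ho hk' hL
      have a' := eL (own o) hv (by omega) (by rwa [hvv])
      rw [hvv] at a'
      omega
    · have a := eS o ho hk' hL
      have a' := eS (own o) hv (by omega) (by rwa [hvv])
      rw [hvv] at a'
      omega
  · intro x hx y hy hkx hky hxy
    rw [hlt]
    have q1 := t1 _ hkx
    have q2 := t2 _ hky
    by_cases hL : own x ∈ L
    · have a := eL x hx (by omega) hL
      have a' := eL y hy (by omega) (by rwa [← hxy])
      rw [← hxy] at a'
      omega
    · have a := eS x hx (by omega) hL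
      have a' := eS y hy (by omega) (by rwa [← hxy])
      rw [← hxy] at a'
      omega
  · intro w hw k hk hkw hkk hvw hwk
    rw [hlt] at hvw hwk
    have hk' : kd k < 3 := by omega
    have hv := D.own_lt k hk hk'
    have hkv := D.kd_own k hk hk'
    have hvv := D.own_push _ hv hkv
    have hww := D.own_push _ hw hkw
    have tw := t0 _ hkw
    have tv := t0 _ hkv
    by_cases hwL : w ∈ L
    · have aw := eL w hw (by omega) (by rwa [hww])
      rw [hww] at aw
      by_cases hvL : own k ∈ L
      · have ak := eL k hk hk' hvL
        have av := eL (own k) hv (by omega) (by rwa [hvv])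
        rw [hvv] at av
        -- If `w` is the deeper value, its push cannot fall between the push of the other value and
        -- `k`. If `w` is the upper value, `k` lies outside its stay and after its push, hence after
        -- its pop.
        rcases lt_trichotomy (j w) (j (own k)) with hjj | hjj | hjj
        · have := h4 (own k) hvL w hw (.inr ⟨by omega, by rwa [hww], by rwa [hww]⟩)
          omega
        · have := hj2 w hwL _ hvL hjj
          rw [← this] at hvw
          omega
        · rcases h4 w hwL k hk (.inr ⟨hk', hvL, hjj⟩) with q | ⟨q, l, hl, hkl, hol⟩
          · omega
          · refine ⟨l, hl, hkl, hol, ?_⟩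
            rw [hlt]
            have al := eL l hl (by omega) (by rwa [hol])
            rw [hol] at al
            have := t1 _ hkl
            omega
      · have ak := eS k hk hk' hvL
        have av := eS (own k) hv (by omega) (by rwa [hvv])
        rw [hvv] at av
        omega
    · obtain ⟨l, hl, hkl, hol⟩ := hskip w hw hkw hwL
      refine ⟨l, hl, hkl, hol, ?_⟩
      rw [hlt]
      have aw := eS w hw (by omega) (by rwa [hww])
      have al := eS l hl (by omega) (by rwa [hol])
      rw [hww] at aw
      rw [hol] at al
      have q1 := t1 _ hkl
      have q2 : ty k ≤ 2 := by
        simp only [ty]; split_ifs <;> omega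
      by_cases hvL : own k ∈ L
      · have ak := eL k hk hk' hvL
        omega
      · have ak := eS k hk hk' hvL
        have av := eS (own k) hv (by omega) (by rwa [hvv])
        rw [hvv] at av
        omega
  · intro w hw k hk hkw hkk hwk
    rw [hlt] at hwk
    have hww := D.own_push _ hw hkw
    have ek := e3 k hkk
    by_cases hwL : w ∈ L
    · have aw := eL w hw (by omega) (by rwa [hww])
      rw [hww] at aw
      rcases h4 w hwL k hk (.inl hkk) with q | ⟨q, l, hl, hkl, hol⟩
      · omega
      · refine ⟨l, hl, hkl, hol, ?_⟩
        rw [hlt]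
        have al := eL l hl (by omega) (by rwa [hol])
        rw [hol] at al
        omega
    · obtain ⟨l, hl, hkl, hol⟩ := hskip w hw hkw hwL
      refine ⟨l, hl, hkl, hol, ?_⟩
      rw [hlt]
      have aw := eS w hw (by omega) (by rwa [hww])
      have al := eS l hl (by omega) (by rwa [hol])
      rw [hww] at aw
      rw [hol] at al
      omega

end Elimination

/-! ### Discretization of histories -/

theorem StackOp.code_eq_zero {V : Type*} {o : StackOp V} : o.code = 0 ↔ ∃ v, o = .push v := by
  cases o <;> simp [StackOp.code]

theorem StackOp.code_eq_one {V : Type*} {o : StackOp V} : o.code = 1 ↔ ∃ v, o = .pop v := by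
  cases o <;> simp [StackOp.code]

theorem StackOp.code_eq_two {V : Type*} {o : StackOp V} : o.code = 2 ↔ ∃ v, o = .peek v := by
  cases o <;> simp [StackOp.code]

theorem StackOp.code_eq_three {V : Type*} {o : StackOp V} : o.code = 3 ↔ o = .empty := by
  cases o <;> simp [StackOp.code]

section Discretization

variable {P V : Type*} [LinearOrder V] {H : History P V}

theorem History.method_eq (i : Fin H.size) : H.input.method i = (H.opr i).op.code := by
  simp [History.input]

/-- `own`, `pI`, `pR`, `b`, `c` are discrete data of the history `H`. -/
structure History.IsDisc (H : History P V) (own pI pR b c : ℕ → ℕ) : Prop where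
  disc : Disc H.size H.input.method own pI pR b c
  own_op : ∀ (i : Fin H.size) (v : V), (H.opr i).op.value = some v →
    ∃ h : own i < H.size, (H.opr ⟨own i, h⟩).op = .push v
  pos : ∀ i j : Fin H.size, (H.opr i).res ≤ (H.opr j).inv ↔ pR i < pI j

/-- Unambiguity makes the push a faithful name of the value, so equality of values turns into
equality of owners. -/
theorem History.IsDisc.legal_iff {own pI pR b c : ℕ → ℕ} (hD : H.IsDisc own pI pR b c)
    (hU : H.Unambiguous) {α : Type*} [LinearOrder α] (key : ℕ → α) :
    Legal (fun i => (H.opr i).op) (fun i : Fin H.size => key i) ↔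
      LegalD H.size H.input.method own key := by
  have hpush : ∀ v (i j : Fin H.size), (H.opr i).op = .push v → (H.opr j).op = .push v → i = j :=
    fun v i j hi hj => ((hU v ⟨i, by simp [hi, StackOp.value]⟩).1).unique hi hj
  have hown : ∀ (i : Fin H.size) v, (H.opr i).op.value = some v → ∀ j : Fin H.size,
      (H.opr j).op = .push v → own i = j := by
    intro i v hv j hj
    obtain ⟨h, h'⟩ := hD.own_op i v hv
    exact congrArg Fin.val (hpush v _ _ h' hj)
  have hsame : ∀ (i j : Fin H.size) v w, (H.opr i).op.value = some v →
      (H.opr j).op.value = some w → own i = own j → v = w := by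
    intro i j v w hv hw hij
    obtain ⟨h, h'⟩ := hD.own_op i v hv
    obtain ⟨h1, h1'⟩ := hD.own_op j w hw
    simp only [hij] at h'
    rw [h'] at h1'
    simpa using h1'
  constructor
  · intro hk
    refine ⟨?_, ?_, ?_, ?_⟩
    · intro j hj hkj
      lift j to Fin H.size using hj
      rw [History.method_eq, StackOp.code_eq_one, StackOp.code_eq_two] at hkj
      obtain ⟨v, hv⟩ | ⟨v, hv⟩ := hkj
      · obtain ⟨i, hi, hlt⟩ := hk.push_before v j (.inl hv)
        rwa [hown j v (by simp [hv, StackOp.value]) i hi]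
      · obtain ⟨i, hi, hlt⟩ := hk.push_before v j (.inr hv)
        rwa [hown j v (by simp [hv, StackOp.value]) i hi]
    · intro i hi j hj hki hkj hij
      lift j to Fin H.size using hj
      lift i to Fin H.size using hi
      rw [History.method_eq, StackOp.code_eq_one] at hki
      rw [History.method_eq, StackOp.code_eq_two] at hkj
      obtain ⟨v, hv⟩ := hki
      obtain ⟨w, hw⟩ := hkj
      obtain rfl := hsame i j v w (by simp [hv, StackOp.value]) (by simp [hw, StackOp.value]) hij
      exact hk.peek_before v i j hv hw
    · intro j hj k hk' hkj hkk h1 h2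
      lift j to Fin H.size using hj
      lift k to Fin H.size using hk'
      rw [History.method_eq, StackOp.code_eq_zero] at hkj
      rw [History.method_eq, StackOp.code_eq_one, StackOp.code_eq_two] at hkk
      obtain ⟨w, hw⟩ := hkj
      obtain ⟨v, hv, hv'⟩ : ∃ v, (H.opr k).op.value = some v ∧
          ((H.opr k).op = .pop v ∨ (H.opr k).op = .peek v) := by
        obtain ⟨v, hv⟩ | ⟨v, hv⟩ := hkk
        · exact ⟨v, by simp [hv, StackOp.value], .inl hv⟩
        · exact ⟨v, by simp [hv, StackOp.value], .inr hv⟩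
      obtain ⟨h, h'⟩ := hD.own_op k v hv
      obtain ⟨l, hl, hlt⟩ := hk.lifo v w ⟨own k, h⟩ j k h' hw hv' h1 h2
      refine ⟨l, l.2, ?_, hown l w (by simp [hl, StackOp.value]) j hw, hlt⟩
      rw [History.method_eq, StackOp.code_eq_one]
      exact ⟨w, hl⟩
    · intro j hj k hk' hkj hkk h1
      lift j to Fin H.size using hj
      lift k to Fin H.size using hk'
      rw [History.method_eq, StackOp.code_eq_zero] at hkj
      rw [History.method_eq, StackOp.code_eq_three] at hkk
      obtain ⟨w, hw⟩ := hkj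
      obtain ⟨l, hl, hlt⟩ := hk.empty w j k hw hkk h1
      refine ⟨l, l.2, ?_, hown l w (by simp [hl, StackOp.value]) j hw, hlt⟩
      rw [History.method_eq, StackOp.code_eq_one]
      exact ⟨w, hl⟩
  · intro hk
    have hpop : ∀ (l j : Fin H.size) w, H.input.method l = 1 → own l = j →
        (H.opr j).op = .push w → (H.opr l).op = .pop w := by
      intro l j w hl hlj hj
      rw [History.method_eq, StackOp.code_eq_one] at hl
      obtain ⟨v, hv⟩ := hl
      obtain ⟨h, h'⟩ := hD.own_op l v (by simp [hv, StackOp.value])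
      have : (⟨own l, h⟩ : Fin H.size) = j := Fin.ext hlj
      rw [this, hj] at h'
      rw [hv]
      simpa using h'.symm
    refine ⟨?_, ?_, ?_, ?_⟩
    · intro v j hj
      have hv : (H.opr j).op.value = some v := by rcases hj with hj | hj <;> simp [hj, StackOp.value]
      obtain ⟨h, h'⟩ := hD.own_op j v hv
      refine ⟨⟨own j, h⟩, h', hk.push_before j j.2 ?_⟩
      rw [History.method_eq]
      rcases hj with hj | hj <;> simp [hj, StackOp.code]
    · intro v i j hi hj
      refine hk.peek_before i i.2 j j.2 ?_ ?_ ?_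
      · simp [History.method_eq, hi, StackOp.code]
      · simp [History.method_eq, hj, StackOp.code]
      · obtain ⟨h, h'⟩ := hD.own_op j v (by simp [hj, StackOp.value])
        exact hown i v (by simp [hi, StackOp.value]) ⟨_, h⟩ h'
    · intro v w i j k hi hj hk' hij hjk
      have hv : (H.opr k).op.value = some v := by
        rcases hk' with hj | hj <;> simp [hj, StackOp.value]
      obtain ⟨l, hl, hkl, hol, hlt⟩ := hk.lifo j j.2 k k.2
        (by simp [History.method_eq, hj, StackOp.code])
        (by rw [History.method_eq]; rcases hk' with hj | hj <;> simp [hj, StackOp.code])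
        (by rwa [hown k v hv i hi]) hjk
      exact ⟨⟨l, hl⟩, hpop ⟨l, hl⟩ j w hkl hol hj, hlt⟩
    · intro w j k hj hk' hjk
      obtain ⟨l, hl, hkl, hol, hlt⟩ := hk.empty j j.2 k k.2
        (by simp [History.method_eq, hj, StackOp.code])
        (by simp [History.method_eq, hk', StackOp.code]) hjk
      exact ⟨⟨l, hl⟩, hpop ⟨l, hl⟩ j w hkl hol hj, hlt⟩

variable {own pI pR b c : ℕ → ℕ}

/-- Every empty operation sees a gap that is not covered by a solid value. -/
def EmptiesOK (kd pI pR b c : ℕ → ℕ) (n : ℕ) : Prop :=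
  ∀ e < n, kd e = 3 → ∃ g, pI e ≤ g ∧ g < pR e ∧ ∀ w ∈ solidValues kd b c n, ¬ Covers b c w g

theorem History.IsDisc.linearizable (hD : H.IsDisc own pI pR b c) (hU : H.Unambiguous)
    (hE : EmptiesOK H.input.method pI pR b c H.size)
    (hS : Eliminable H.input.method own pI pR b c H.size
      (solidValues H.input.method b c H.size)) : H.Linearizable := by
  obtain ⟨key, h1, h2, h3⟩ := hD.disc.sufficient hS hE
  refine History.linearizable_of_key hU (key := fun i => key i) (fun i j h => Fin.ext (h1 _ _ h))
    (fun i j h => h2 i i.2 j j.2 ((hD.pos i j).1 h)) ((hD.legal_iff hU key).2 h3)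

theorem History.IsDisc.of_linearizable (hD : H.IsDisc own pI pR b c) (hU : H.Unambiguous)
    (hl : H.Linearizable) : EmptiesOK H.input.method pI pR b c H.size ∧
      ∀ S ⊆ solidValues H.input.method b c H.size, S.Nonempty →
        ∃ v ∈ S, ∀ o < H.size, H.input.method o < 3 → own o = v →
          Placeable H.input.method own pI pR b c S v o := by
  obtain ⟨key, h1, h2, h3⟩ := hl.exists_key hU
  let key' : ℕ → ℚ≥0 := fun i => if h : i < H.size then key ⟨i, h⟩ else 0
  have hkey : ∀ i : Fin H.size, key' i = key i := fun i => by simp [key']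
  refine hD.disc.necessary (key := key') ?_ ?_ ?_
  · intro i hi j hj hij
    lift i to Fin H.size using hi
    lift j to Fin H.size using hj
    rw [hkey, hkey] at hij
    exact congrArg Fin.val (h1 hij)
  · intro i hi j hj hij
    lift i to Fin H.size using hi
    lift j to Fin H.size using hj
    rw [hkey, hkey]
    exact h2 i j ((hD.pos i j).2 hij)
  · rw [← hD.legal_iff hU]
    refine h3.congr fun i j => ?_
    rw [hkey, hkey]

end Discretization

/-! ### Sorting with a tournament tree -/

infixl:65 " +ₑ " => Expr.bin BinOp.add
infixl:65 " -ₑ " => Expr.bin BinOp.sub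
infixl:70 " *ₑ " => Expr.bin BinOp.mul
infixl:70 " /ₑ " => Expr.bin BinOp.div
infix:50 " <ₑ " => Expr.bin BinOp.lt
infix:50 " =ₑ " => Expr.bin BinOp.eq
notation "𝐯" => Expr.var
notation "𝐜" => Expr.const
infix:40 " ≔ " => Program.assign
infixr:35 " ;; " => Program.seq

theorem ite_one_zero_mod {W : ℕ} (hW : 1 < W) (p : Prop) [Decidable p] :
    (if p then 1 else 0) % W = if p then 1 else 0 := by
  split_ifs <;> simp [Nat.mod_eq_of_lt hW]

attribute [simp] Expr.eval BinOp.apply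

/-- Walk from node `𝐯 1` to the root and perform `R` at every proper ancestor. -/
def climb (R : Program) : Program := .loop (𝐜 1 <ₑ 𝐯 1) ((1 ≔ 𝐯 1 /ₑ 𝐜 2) ;; R)

/-- The invariant is indexed by the current node. In the applications it says that the parent of
this node is the only node that may be out of date, so nothing is left to repair at the root. -/
theorem Run.climb {W : ℕ} {I : Input} {Ls : List ℕ} {L : ℕ} {R : Program} {s : Store}
    (Inv : ℕ → Store → Prop) (hR : R.writesVar 1 = false) (hW : 2 < W) (hsW : s.var 1 < W)
    (hs : 1 ≤ s.var 1) (h0 : Inv (s.var 1) s) (hL : Nat.log 2 (s.var 1) ≤ L)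
    (hstep : ∀ s' x, Frame (climb R) s s' → 2 ≤ x → x ≤ s.var 1 → s'.var 1 = x → Inv x s' →
      Run W I Ls R (s'.setVar 1 (x / 2)) (fun s'' => Inv (x / 2) s'')) :
    Run W I (L :: Ls) (climb R) s (fun s' => Inv 1 s') := by
  refine (Run.loop (fun s' => 1 ≤ s'.var 1 ∧ s'.var 1 ≤ s.var 1 ∧ Inv (s'.var 1) s')
    (fun s' => Nat.log 2 (s'.var 1)) ⟨hs, le_rfl, h0⟩ hL ?_).mono ?_
  · rintro s' hf ⟨h1, h2, h3⟩ hb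
    have h4 : 2 ≤ s'.var 1 := by
      by_contra h
      have : ¬ 1 < s'.var 1 := by omega
      simp [this, Nat.mod_eq_of_lt (show 1 < W by omega)] at hb
    refine Run.assign_seq (s'.var 1 / 2) ?_ ?_
    · have : s'.var 1 / 2 < W := by omega
      simp [Nat.mod_eq_of_lt hW, Nat.mod_eq_of_lt this]
    · refine (hstep s' _ ⟨hf.var, hf.arr⟩ h4 h2 rfl h3).mono fun s'' hf' h => ?_
      have h5 : s''.var 1 = s'.var 1 / 2 := by
        rw [hf'.var 1 hR]; simp
      refine ⟨⟨by omega, by omega, by rwa [h5]⟩, ?_⟩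
      rw [h5, Nat.log_div_base]
      have := Nat.log_pos (b := 2) (by norm_num) h4
      omega
  · rintro s' - ⟨⟨h1, h2, h3⟩, hb⟩
    have : s'.var 1 = 1 := by
      by_contra h
      have : 1 < s'.var 1 := by omega
      simp [this, Nat.mod_eq_of_lt (show 1 < W by omega)] at hb
    rwa [this] at h3

section Tournament

variable {α : Type*} [LinearOrder α] (key : ℕ → α)

/-- Winner among two optional items, the item `x` being coded by `x + 1`. -/
def winner (a b : ℕ) : ℕ :=
  if a = 0 then b else if b = 0 then a else if key (b - 1) < key (a - 1) then b else a

/-- The leaves of the array `T` hold the items of `A`. -/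
def TournamentLeaves (T : ℕ → ℕ) (N : ℕ) (A : Finset ℕ) : Prop :=
  ∀ x < N, T (N + x) = if x ∈ A then x + 1 else 0

/-- `T` is a tournament tree for the items of `A`. -/
structure Tournament (T : ℕ → ℕ) (N : ℕ) (A : Finset ℕ) : Prop where
  leaf : TournamentLeaves T N A
  node : ∀ i, 1 ≤ i → i < N → T i = winner key (T (2 * i)) (T (2 * i + 1))

variable {key}

/-- Meant for a tree under repair: children have larger numbers than their parents, so the nodes
numbered above `y` hold genuine items even while smaller nodes are stale. -/
theorem TournamentLeaves.mem {T : ℕ → ℕ} {N : ℕ} {A : Finset ℕ} (h : TournamentLeaves T N A) {y : ℕ}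
    (hnode : ∀ i, y < i → i < N → T i = winner key (T (2 * i)) (T (2 * i + 1))) :
    ∀ i, y < i → i < 2 * N → T i ≠ 0 → T i - 1 ∈ A := by
  suffices H : ∀ d i, y < i → i < 2 * N → 2 * N - i ≤ d → T i ≠ 0 → T i - 1 ∈ A from
    fun i h1 h2 => H _ i h1 h2 le_rfl
  intro d
  induction d with
  | zero => intro i h1 h2 h3; omega
  | succ d ih =>
    intro i h1 h2 h3 h4
    by_cases hi : i < N
    · have e := hnode i h1 hi
      have i1 := ih (2 * i) (by omega) (by omega) (by omega)
      have i2 := ih (2 * i + 1) (by omega) (by omega) (by omega)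
      rw [e] at h4 ⊢
      unfold winner at h4 ⊢
      split_ifs at h4 ⊢ with c1 c2 c3
      · exact i2 h4
      · exact i1 c1
      · exact i2 c2
      · exact i1 c1
    · have e := h (i - N) (by omega)
      rw [show N + (i - N) = i by omega] at e
      rw [e] at h4 ⊢
      split_ifs at h4 ⊢ with c
      · simpa using c
      · simp at h4

/-- Along the path from the leaf of an item to the root, whose nodes are the numbers `(N + x) / 2 ^
d`, the key of the winner never exceeds the key of that item. -/
theorem Tournament.root {T : ℕ → ℕ} {N : ℕ} {A : Finset ℕ} (h : Tournament key T N A)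
    (hA : ∀ x ∈ A, x < N) (hne : A.Nonempty) :
    T 1 ≠ 0 ∧ T 1 - 1 ∈ A ∧ ∀ x ∈ A, ¬ key x < key (T 1 - 1) := by
  have hanc : ∀ x ∈ A, ∀ d, 1 ≤ (N + x) / 2 ^ d →
      T ((N + x) / 2 ^ d) ≠ 0 ∧ ¬ key x < key (T ((N + x) / 2 ^ d) - 1) := by
    intro x hx d
    have hxN := hA x hx
    induction d with
    | zero => intro _; simp [h.leaf x hxN, hx]
    | succ d ih =>
      intro h1
      rw [pow_succ, ← Nat.div_div_eq_div_mul] at h1 ⊢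
      set j := (N + x) / 2 ^ d with hj
      obtain ⟨i1, i2⟩ := ih (by omega)
      have hjle : j ≤ N + x := Nat.div_le_self _ _
      have e := h.node (j / 2) h1 (by omega)
      have hj2 : j = 2 * (j / 2) ∨ j = 2 * (j / 2) + 1 := by omega
      rw [e]
      unfold winner
      rcases hj2 with hj2 | hj2
      · rw [← hj2]
        split_ifs with c1 c2 c3
        · exact absurd c1 i1
        · exact ⟨i1, i2⟩
        · exact ⟨c2, fun hlt => i2 (hlt.trans c3)⟩
        · exact ⟨i1, i2⟩
      · rw [← hj2]
        split_ifs with c1 c2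
        · exact ⟨i1, i2⟩
        · exact ⟨i1, i2⟩
        · exact ⟨c1, fun hlt => i2 (hlt.trans_le (not_lt.1 c2))⟩
  have hroot : ∀ x ∈ A, T 1 ≠ 0 ∧ ¬ key x < key (T 1 - 1) := by
    intro x hx
    have hpos : N + x ≠ 0 := by have := hA x hx; omega
    have e : (N + x) / 2 ^ Nat.log 2 (N + x) = 1 := by
      have h1 := Nat.pow_log_le_self 2 hpos
      have h2 := Nat.lt_pow_succ_log_self (b := 2) (by norm_num) (N + x)
      rw [pow_succ] at h2
      exact Nat.div_eq_of_lt_le (by omega) (by omega)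
    have := hanc x hx (Nat.log 2 (N + x)) (by omega)
    rwa [e] at this
  obtain ⟨x, hx⟩ := hne
  have hN := hA x hx
  refine ⟨(hroot x hx).1, ?_, fun y hy => (hroot y hy).2⟩
  exact h.leaf.mem (y := 0) (fun i h1 h2 => h.node i h1 h2) 1 (by omega) (by omega) (hroot x hx).1

/-- Recompute node `𝐯 1`; `less` compares the items `𝐯 5 < 𝐯 4`. -/
def winStep (T : ℕ) (less : Expr) : Program :=
  (2 ≔ .get T (𝐜 2 *ₑ 𝐯 1)) ;;
  (3 ≔ .get T (𝐜 2 *ₑ 𝐯 1 +ₑ 𝐜 1)) ;;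
  .ite (𝐯 2 =ₑ 𝐜 0) (.put T (𝐯 1) (𝐯 3))
    (.ite (𝐯 3 =ₑ 𝐜 0) (.put T (𝐯 1) (𝐯 2))
      ((4 ≔ 𝐯 2 -ₑ 𝐜 1) ;; (5 ≔ 𝐯 3 -ₑ 𝐜 1) ;;
        .ite less (.put T (𝐯 1) (𝐯 3)) (.put T (𝐯 1) (𝐯 2))))

/-- Set the leaf of item `𝐯 6` to `e`. -/
def winSet (T : ℕ) (less e : Expr) : Program :=
  (1 ≔ 𝐯 22 +ₑ 𝐯 6) ;; .put T (𝐯 1) e ;; climb (winStep T less)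

variable {W : ℕ} {I : Input} {Ls : List ℕ}

/-- The expression `less` compares the keys of the items `𝐯 5` and `𝐯 4` of `U`. -/
def Compares (W : ℕ) (I : Input) (key : ℕ → α) (U : Finset ℕ) (less : Expr) : Prop :=
  ∀ s : Store, s.var 4 ∈ U → s.var 5 ∈ U →
    (less.eval W I s ≠ 0 ↔ key (s.var 5) < key (s.var 4))

theorem Run.winStep {T : ℕ} {less : Expr} {s : Store} {U : Finset ℕ} {y : ℕ}
    (hl : Compares W I key U less) (hU : ∀ x ∈ U, x + 1 < W) (hy : s.var 1 = y) (hyW : 2 * y + 1 < W)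
    (hW : 2 < W)
    (h1 : s.arr T (2 * y) ≠ 0 → s.arr T (2 * y) - 1 ∈ U)
    (h2 : s.arr T (2 * y + 1) ≠ 0 → s.arr T (2 * y + 1) - 1 ∈ U) :
    Run W I Ls (winStep T less) s (fun s' => s'.arr T =
      Function.update (s.arr T) y (winner key (s.arr T (2 * y)) (s.arr T (2 * y + 1)))) := by
  have hb1 : s.arr T (2 * y) < W := by
    by_contra h
    have := hU _ (h1 (by omega))
    omega
  have hb2 : s.arr T (2 * y + 1) < W := by
    by_contra h
    have := hU _ (h2 (by omega))
    omega
  unfold StackMonitoring.winStep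
  refine Run.assign_seq (s.arr T (2 * y)) ?_ ?_
  · simp (disch := omega) [Nat.mod_eq_of_lt, hy]
  refine Run.assign_seq (s.arr T (2 * y + 1)) ?_ ?_
  · simp (disch := omega) [Nat.mod_eq_of_lt, hy]
  refine Run.ite (fun c1 => ?_) (fun c1 => ?_)
  · refine Run.put (j := y) (v := s.arr T (2 * y + 1)) (by simp [hy]) (by simp) ?_
    have : s.arr T (2 * y) = 0 := by
      simpa [ite_one_zero_mod (show 1 < W by omega)] using c1
    simp [Store.setArr_arr, winner, this]
  have c1' : s.arr T (2 * y) ≠ 0 := by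
    intro h
    simp (disch := omega) [h, Nat.mod_eq_of_lt] at c1
  refine Run.ite (fun c2 => ?_) (fun c2 => ?_)
  · refine Run.put (j := y) (v := s.arr T (2 * y)) (by simp [hy]) (by simp) ?_
    have : s.arr T (2 * y + 1) = 0 := by
      simpa [ite_one_zero_mod (show 1 < W by omega)] using c2
    simp [Store.setArr_arr, winner, this, c1']
  have c2' : s.arr T (2 * y + 1) ≠ 0 := by
    intro h
    simp (disch := omega) [h, Nat.mod_eq_of_lt] at c2
  refine Run.assign_seq (s.arr T (2 * y) - 1) ?_ ?_
  · simp (disch := omega) [Nat.mod_eq_of_lt]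
  refine Run.assign_seq (s.arr T (2 * y + 1) - 1) ?_ ?_
  · simp (disch := omega) [Nat.mod_eq_of_lt]
  have hcmp := hl ((((s.setVar 2 (s.arr T (2 * y))).setVar 3 (s.arr T (2 * y + 1))).setVar 4
    (s.arr T (2 * y) - 1)).setVar 5 (s.arr T (2 * y + 1) - 1)) (by simpa using h1 c1')
    (by simpa using h2 c2')
  refine Run.ite (fun c3 => ?_) (fun c3 => ?_)
  · refine Run.put (j := y) (v := s.arr T (2 * y + 1)) (by simp [hy]) (by simp) ?_
    have c3' : key (s.arr T (2 * y + 1) - 1) < key (s.arr T (2 * y) - 1) := by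
      simpa using hcmp.1 c3
    simp [Store.setArr_arr, winner, c1', c2', c3']
  · refine Run.put (j := y) (v := s.arr T (2 * y)) (by simp [hy]) (by simp) ?_
    have c3' : ¬ key (s.arr T (2 * y + 1) - 1) < key (s.arr T (2 * y) - 1) := by
      intro h
      exact hcmp.2 (by simpa using h) c3
    rw [Store.setArr_arr, if_pos rfl]
    simp only [winner, if_neg c1', if_neg c2', if_neg c3', Store.setVar_arr]

theorem Run.winSet {T N L x : ℕ} {less e : Expr} {s : Store} {A A' U : Finset ℕ}
    (hl : Compares W I key U less) (hU : ∀ x ∈ U, x + 1 < W) (hAU : A' ⊆ U)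
    (hN : s.var 22 = N) (hNW : 4 * N + 2 < W) (hLN : Nat.log 2 (2 * N) ≤ L)
    (hT : Tournament key (s.arr T) N A) (hx : s.var 6 = x) (hxN : x < N)
    (he : e.eval W I (s.setVar 1 (N + x)) = if x ∈ A' then x + 1 else 0)
    (hAA : ∀ y, y ≠ x → (y ∈ A' ↔ y ∈ A)) :
    Run W I (L :: Ls) (winSet T less e) s (fun s' => Tournament key (s'.arr T) N A') := by
  unfold StackMonitoring.winSet
  refine Run.assign_seq (N + x) ?_ ?_
  · simp (disch := omega) [Nat.mod_eq_of_lt, hN, hx]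
  refine Run.put_seq (N + x) _ ?_ he ?_
  · simp
  -- The parent of the current node is the only node that may disagree with its children.
  refine (Run.climb (fun y s' => TournamentLeaves (s'.arr T) N A' ∧
      ∀ i, 1 ≤ i → i < N → i ≠ y / 2 → (s'.arr T) i =
        winner key ((s'.arr T) (2 * i)) ((s'.arr T) (2 * i + 1))) rfl (by omega)
    ?_ ?_ ?_ ?_ ?_).mono ?_
  · simp; omega
  · simp; omega
  · simp only [Store.setArr_var, Store.setVar_var, if_true]
    constructor
    · intro y hy
      rw [Store.setArr_arr_apply]
      by_cases hyx : y = x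
      · simp [hyx]
      · have h2 := hT.leaf y hy
        rw [if_neg (by omega)]
        simp only [Store.setVar_arr, h2, hAA y hyx]
    · intro i h1 h2 h3
      simp only [Store.setArr_arr_apply, Store.setVar_arr]
      rw [if_neg (by omega), if_neg (by omega), if_neg (by omega)]
      exact hT.node i h1 h2
  · simp only [Store.setArr_var, Store.setVar_var, if_true]
    exact (Nat.log_mono_right (by omega)).trans hLN
  · intro s' y hf h1 h2 h3 ⟨h4, h5⟩
    simp only [Store.setArr_var, Store.setVar_var, if_true] at h2
    have hmem : ∀ i, y / 2 < i → i < 2 * N → s'.arr T i ≠ 0 → s'.arr T i - 1 ∈ U :=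
      fun i hi1 hi2 hi3 => hAU (h4.mem (y := y / 2)
        (fun i h1 h2 => h5 i (by omega) h2 (by omega)) i hi1 hi2 hi3)
    refine (Run.winStep (y := y / 2) hl hU (by simp) (by omega) (by omega) ?_ ?_).mono ?_
    · exact hmem _ (by omega) (by omega)
    · exact hmem _ (by omega) (by omega)
    · intro s'' _ hs''
      simp only [Store.setVar_arr] at hs''
      rw [hs'']
      refine ⟨fun z hz => ?_, fun i h6 h7 h8 => ?_⟩
      · rw [Function.update_of_ne (by omega)]
        exact h4 z hz
      · by_cases hi : i = y / 2
        · subst hi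
          rw [Function.update_self, Function.update_of_ne (by omega), Function.update_of_ne (by omega)]
        · rw [Function.update_of_ne hi, Function.update_of_ne (by omega),
            Function.update_of_ne (by omega)]
          exact h5 i h6 h7 hi
  · rintro s' - ⟨h1, h2⟩
    exact ⟨h1, fun i h3 h4 => h2 i h3 h4 (by omega)⟩

/-- Sort the items `k < 𝐯 bnd` with `cond` by `less`: the order is stored in the array `O`, the
ranks in the array `R`, and the number of items in `𝐯 25`. -/
def sortProg (T O R bnd : ℕ) (cond less : Expr) : Program :=
  (25 ≔ 𝐜 0) ;; (30 ≔ 𝐜 0) ;;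
  .loop (𝐯 30 <ₑ 𝐯 bnd) (.ite cond
    ((6 ≔ 𝐯 30) ;; winSet T less (𝐯 6 +ₑ 𝐜 1) ;; (25 ≔ 𝐯 25 +ₑ 𝐜 1) ;; (30 ≔ 𝐯 30 +ₑ 𝐜 1))
    (30 ≔ 𝐯 30 +ₑ 𝐜 1)) ;;
  (30 ≔ 𝐜 0) ;;
  .loop (𝐯 30 <ₑ 𝐯 25) ((6 ≔ .get T (𝐜 1) -ₑ 𝐜 1) ;; winSet T less (𝐜 0) ;;
    .put O (𝐯 30) (𝐯 6) ;; .put R (𝐯 6) (𝐯 30) ;; (30 ≔ 𝐯 30 +ₑ 𝐜 1))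

/-- `ord` lists the items of `A` in the order of their keys, `rk` is the inverse of `ord`. -/
structure Sorted (key : ℕ → α) (A : Finset ℕ) (ord rk : ℕ → ℕ) : Prop where
  mem : ∀ k < A.card, ord k ∈ A ∧ rk (ord k) = k
  rank : ∀ x ∈ A, rk x < A.card ∧ ord (rk x) = x
  sorted : ∀ k l, k < l → l < A.card → key (ord k) ≤ key (ord l)

/-- Insert all items into the tournament tree, then extract the root repeatedly; each change repairs
one path. The restriction on `bnd` keeps the loop bound away from the variables that are
overwritten. -/
theorem Run.sortProg {T O R bnd N B L : ℕ} {cond less : Expr} {s : Store} {A : Finset ℕ}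
    (hTO : T ≠ O) (hTR : T ≠ R) (hOR : O ≠ R) (hbnd : 31 ≤ bnd ∨ bnd = 20 ∨ bnd = 21)
    (hl : Compares W I key A less) (hA : A ⊆ Finset.range (s.var bnd))
    (hcond : ∀ s', s'.var 30 < s.var bnd → (cond.eval W I s' ≠ 0 ↔ s'.var 30 ∈ A))
    (hN : s.var 22 = N) (hNW : 4 * N + 2 < W) (hLN : Nat.log 2 (2 * N) ≤ L) (hbN : s.var bnd ≤ N)
    (hB : s.var bnd ≤ B) (h0 : ∀ i, s.arr T i = 0) :
    Run W I (B :: L :: Ls) (sortProg T O R bnd cond less) s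
      (fun s' => s'.var 25 = A.card ∧ Sorted key A (s'.arr O) (s'.arr R)) := by
  have hfv : ∀ {s' : Store} {p : Program} {s0 : Store}, Frame p s0 s' → p.writesVar bnd = false →
      s'.var bnd = s0.var bnd := fun h h' => h.var _ h'
  set M := s.var bnd with hM
  have hb0 : bnd ≠ 0 ∧ bnd ≠ 1 ∧ bnd ≠ 2 ∧ bnd ≠ 3 ∧ bnd ≠ 4 ∧ bnd ≠ 5 ∧ bnd ≠ 6 ∧ bnd ≠ 25 ∧
    bnd ≠ 30 := by omega
  have hAlt : ∀ x ∈ A, x < M := fun x hx => by simpa using hA hx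
  have hU : ∀ x ∈ A, x + 1 < W := fun x hx => by have := hAlt x hx; omega
  unfold StackMonitoring.sortProg
  refine Run.assign_seq 0 (by simp) ?_
  refine Run.assign_seq 0 (by simp) ?_
  refine Run.seq (R := fun s' => s'.var 25 = A.card ∧ Tournament key (s'.arr T) N A ∧
    s'.var 22 = N ∧ s'.var bnd = M) ?_ ?_
  · refine (Run.forLoop (fun k s' => s'.var 25 = (A.filter (· < k)).card ∧
      Tournament key (s'.arr T) N (A.filter (· < k))) M 30 (by simp) ?_ hB ?_ ?_).mono ?_
    · simp only [Store.setVar_var, Store.setVar_arr]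
      simp only [if_true, Nat.not_lt_zero, Finset.filter_false, Finset.card_empty]
      refine ⟨by simp, fun x hx => by simp [h0], fun i _ _ => by simp [h0, winner]⟩
    · intro s' hf
      have e1 : s'.var bnd = M := by
        rw [hf.var _ (by simp [Program.writesVar, StackMonitoring.winSet, StackMonitoring.climb,
          StackMonitoring.winStep, hb0])]
        simp [hb0, hM]
      simp [e1, ite_one_zero_mod (show 1 < W by omega)]
    · intro s' hf hlt ⟨h1, h2⟩
      have e1 : s'.var 22 = N := by
        rw [hf.var 22 rfl]; simp [hN]
      have hc := hcond s' hlt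
      have hcard : (A.filter (· < s'.var 30)).card ≤ M := by
        calc _ ≤ A.card := Finset.card_filter_le _ _
          _ ≤ (Finset.range M).card := Finset.card_le_card hA
          _ = M := Finset.card_range M
      refine Run.ite (fun c => ?_) (fun c => ?_)
      · have hmem := hc.1 c
        have hfil : A.filter (· < s'.var 30 + 1) = insert (s'.var 30) (A.filter (· < s'.var 30)) := by
          ext y
          simp only [Finset.mem_filter, Finset.mem_insert]
          constructor
          · rintro ⟨q1, q2⟩
            by_cases q : y = s'.var 30
            · exact .inl q
            · exact .inr ⟨q1, by omega⟩
          · rintro (rfl | ⟨q1, q2⟩)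
            · exact ⟨hmem, by omega⟩
            · exact ⟨q1, by omega⟩
        refine Run.assign_seq (s'.var 30) (by simp) ?_
        refine Run.seq (Run.winSet (x := s'.var 30) (A := A.filter (· < s'.var 30))
          (A' := A.filter (· < s'.var 30 + 1)) hl hU (Finset.filter_subset _ _)
          (by simpa using e1) hNW hLN (by simpa using h2) (by simp) (by omega) ?_ ?_) ?_
        · simp (disch := omega) [Nat.mod_eq_of_lt, hmem]
        · intro y hy
          simp only [Finset.mem_filter]
          have : y < s'.var 30 + 1 ↔ y < s'.var 30 := by omega
          rw [this]
        · intro s1 hf1 hs1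
          have e30 : s1.var 30 = s'.var 30 := by rw [hf1.var 30 rfl]; simp
          have e25 : s1.var 25 = s'.var 25 := by rw [hf1.var 25 rfl]; simp
          refine Run.assign_seq (s'.var 25 + 1) ?_ ?_
          · simp (disch := omega) [Nat.mod_eq_of_lt, e25]
          refine Run.assign (v := s'.var 30 + 1) ?_ ?_
          · simp (disch := omega) [Nat.mod_eq_of_lt, e30]
          simp only [Store.setVar_var, Store.setVar_arr]
          refine ⟨by simp, ?_, hs1⟩
          rw [hfil, Finset.card_insert_of_notMem (by simp)]
          simp [h1]
      · have hmem : s'.var 30 ∉ A := fun h => hc.2 h c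
        have hfil : A.filter (· < s'.var 30 + 1) = A.filter (· < s'.var 30) := by
          ext y
          simp only [Finset.mem_filter]
          constructor
          · rintro ⟨q1, q2⟩
            have : y ≠ s'.var 30 := by rintro rfl; exact hmem q1
            exact ⟨q1, by omega⟩
          · rintro ⟨q1, q2⟩
            exact ⟨q1, by omega⟩
        refine Run.assign (v := s'.var 30 + 1) ?_ ?_
        · simp (disch := omega) [Nat.mod_eq_of_lt]
        rw [hfil]
        simpa using ⟨h1, h2⟩
    · intro s' hf ⟨h1, h2⟩
      have hfil : A.filter (· < M) = A := Finset.filter_true_of_mem hAlt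
      rw [hfil] at h1 h2
      refine ⟨h1, h2, ?_, ?_⟩
      · rw [hf.var 22 rfl]; simp [hN]
      · rw [hf.var _ (by simp [Program.writesVar, StackMonitoring.winSet, StackMonitoring.climb,
          StackMonitoring.winStep, hb0])]
        simp [hb0, hM]
  · rintro s1 hf1 ⟨h25, hT, h22, -⟩
    have hcardM : A.card ≤ M := (Finset.card_le_card hA).trans (Finset.card_range M).le
    refine Run.assign_seq 0 (by simp) ?_
    -- `A'` is the set of items still in the tree. The first `k` entries of `O` list the others in
    -- order, and none of them has a key above one in `A'`.
    refine (Run.forLoop (fun k s' => ∃ A' ⊆ A, A'.card = A.card - k ∧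
      Tournament key (s'.arr T) N A' ∧
      (∀ i < k, s'.arr O i ∈ A ∧ s'.arr O i ∉ A' ∧ s'.arr R (s'.arr O i) = i) ∧
      (∀ x ∈ A, x ∉ A' → s'.arr R x < k ∧ s'.arr O (s'.arr R x) = x) ∧
      (∀ i l, i < l → l < k → key (s'.arr O i) ≤ key (s'.arr O l)) ∧
      (∀ i < k, ∀ y ∈ A', key (s'.arr O i) ≤ key y)) A.card 30 (by simp) ?_ (by omega) ?_ ?_).mono ?_
    · refine ⟨A, subset_rfl, by simp, by simpa using hT, ?_, fun x hx hx' => absurd hx hx', ?_, ?_⟩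
      all_goals simp
    · intro s' hf
      have e1 : s'.var 25 = A.card := by rw [hf.var 25 rfl]; simp [h25]
      simp [e1, ite_one_zero_mod (show 1 < W by omega)]
    · rintro s' hf hlt ⟨A', hA', hcard, hT', g1, g2, g3, g4⟩
      have e1 : s'.var 22 = N := by rw [hf.var 22 rfl]; simp [h22]
      obtain ⟨r1, r2, r3⟩ := hT'.root (fun x hx => (hAlt x (hA' hx)).trans_le hbN)
        (Finset.card_pos.1 (by omega))
      generalize hw : s'.arr T 1 - 1 = w at r2 r3
      have hwA := hA' r2
      have hwM := hAlt w hwA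
      refine Run.assign_seq w ?_ ?_
      · simp (disch := omega) [Nat.mod_eq_of_lt, hw]
      refine Run.seq (Run.winSet (x := w) (A := A') (A' := A'.erase w) hl hU
          ((Finset.erase_subset _ _).trans hA')
          (by simpa using e1) hNW hLN (by simpa using hT') (by simp) (by omega) (by simp) ?_) ?_
      · intro y hy
        simp [hy]
      · intro s2 hf2 hT2
        have e30 : s2.var 30 = s'.var 30 := by rw [hf2.var 30 rfl]; simp
        have e6 : s2.var 6 = w := by rw [hf2.var 6 rfl]; simp
        have eO : s2.arr O = s'.arr O := by
          rw [hf2.arr O (by simp [Program.writesArr, StackMonitoring.winSet, StackMonitoring.climb,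
            StackMonitoring.winStep, hTO.symm])]
          rfl
        have eR : s2.arr R = s'.arr R := by
          rw [hf2.arr R (by simp [Program.writesArr, StackMonitoring.winSet, StackMonitoring.climb,
            StackMonitoring.winStep, hTR.symm])]
          rfl
        refine Run.put_seq (s'.var 30) w (by simp [e30]) (by simp [e6]) ?_
        refine Run.put_seq w (s'.var 30) (by simp [e6]) (by simp [e30]) ?_
        refine Run.assign (v := s'.var 30 + 1) ?_ ?_
        · simp (disch := omega) [Nat.mod_eq_of_lt, e30]
        have fO : ∀ i, (((s2.setArr O (s'.var 30) w).setArr R w (s'.var 30)).setVar 30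
            (s'.var 30 + 1)).arr O i = if i = s'.var 30 then w else s'.arr O i := by
          intro i
          simp [Store.setArr_arr_apply, hOR, eO]
        have fR : ∀ i, (((s2.setArr O (s'.var 30) w).setArr R w (s'.var 30)).setVar 30
            (s'.var 30 + 1)).arr R i = if i = w then s'.var 30 else s'.arr R i := by
          intro i
          simp [Store.setArr_arr_apply, hOR.symm, eR]
        have fT : (((s2.setArr O (s'.var 30) w).setArr R w (s'.var 30)).setVar 30
            (s'.var 30 + 1)).arr T = s2.arr T := by
          simp [Store.setArr_arr, hTO, hTR]
        refine ⟨by simp, A'.erase w, (Finset.erase_subset _ _).trans hA', ?_, by rwa [fT], ?_, ?_, ?_, ?_⟩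
        · rw [Finset.card_erase_of_mem r2]
          omega
        · intro i hi
          rw [fO]
          by_cases hik : i = s'.var 30
          · rw [if_pos hik, fR, if_pos rfl]
            exact ⟨hwA, by simp, hik.symm⟩
          · rw [if_neg hik, fR]
            obtain ⟨q1, q2, q3⟩ := g1 i (by omega)
            have : s'.arr O i ≠ w := by
              intro h; exact q2 (h ▸ r2)
            rw [if_neg this]
            exact ⟨q1, fun h => q2 (Finset.mem_of_mem_erase h), q3⟩
        · intro x hx hx'
          rw [fR]
          by_cases hxw : x = w
          · rw [if_pos hxw, fO, if_pos rfl]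
            exact ⟨by omega, hxw.symm⟩
          · rw [if_neg hxw, fO]
            obtain ⟨q1, q2⟩ := g2 x hx (fun h => hx' (Finset.mem_erase.2 ⟨hxw, h⟩))
            rw [if_neg (by omega)]
            exact ⟨by omega, q2⟩
        · intro i l hil hlk
          rw [fO, fO, if_neg (by omega)]
          by_cases hl' : l = s'.var 30
          · rw [if_pos hl']
            exact g4 i (by omega) w r2
          · rw [if_neg hl']
            exact g3 i l hil (by omega)
        · intro i hi y hy
          rw [fO]
          have hy' := Finset.mem_of_mem_erase hy
          by_cases hik : i = s'.var 30
          · rw [if_pos hik]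
            exact not_lt.1 (r3 y hy')
          · rw [if_neg hik]
            exact g4 i (by omega) y hy'
    · rintro s' hf ⟨A', hA', hcard, -, g1, g2, g3, -⟩
      have : A' = ∅ := Finset.card_eq_zero.1 (by omega)
      subst this
      refine ⟨?_, ⟨fun k hk => ⟨(g1 k hk).1, (g1 k hk).2.2⟩, fun x hx => g2 x hx (by simp), g3⟩⟩
      rw [hf.var 25 rfl]; simp [h25]

end Tournament

/-! ### A segment tree for minimal prefix sums -/

section MinTree

/-- The fields of node `i` are computed from its children. `P` and `Q` are sums, and `M - Q` is the
least value of the leaves relative to the prefix sum before the node. -/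
def MinNode (P Q M : ℕ → ℕ) (i : ℕ) : Prop :=
  P i = P (2 * i) + P (2 * i + 1) ∧ Q i = Q (2 * i) + Q (2 * i + 1) ∧
    M i = min (M (2 * i) + Q (2 * i + 1)) (P (2 * i) + M (2 * i + 1))

/-- The arrays `P`, `Q`, `M` form a tree with `N` leaves `p`, `q`, `μ`. -/
structure MinTree (P Q M : ℕ → ℕ) (N : ℕ) (p q μ : ℕ → ℕ) : Prop where
  leafP : ∀ g < N, P (N + g) = p g
  leafQ : ∀ g < N, Q (N + g) = q g
  leafM : ∀ g < N, M (N + g) = μ g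
  node : ∀ i, 1 ≤ i → i < N → MinNode P Q M i

/-- The value of leaf `x` is below `t`. -/
def Below (P Q M : ℕ → ℕ) (N x t : ℕ) : Prop :=
  ∑ i ∈ Finset.Ico N x, P i + M x < t + ∑ i ∈ Finset.Ico N x, Q i + Q x

variable {P Q M : ℕ → ℕ} {N : ℕ}

/-- The descendants of `y` at depth `h` are the numbers from `y * 2 ^ h` to before `(y + 1) * 2 ^
h`. Natural numbers do not allow negative differences, so sums of `Q` stand on the other side of the
inequality. Quantifying over `A` and `t` lets the sums of the left child be absorbed when passing to
the right child. -/
theorem minNode_block (h y : ℕ) (hy : 1 ≤ y) (h1 : N ≤ y * 2 ^ h) (h2 : (y + 1) * 2 ^ h ≤ 2 * N)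
    (hnode : ∀ i, y ≤ i → i < N → MinNode P Q M i) :
    P y = ∑ i ∈ Finset.Ico (y * 2 ^ h) ((y + 1) * 2 ^ h), P i ∧
    Q y = ∑ i ∈ Finset.Ico (y * 2 ^ h) ((y + 1) * 2 ^ h), Q i ∧
    ∀ A t, A + M y < t + Q y ↔ ∃ x, y * 2 ^ h ≤ x ∧ x < (y + 1) * 2 ^ h ∧
      A + ∑ i ∈ Finset.Ico (y * 2 ^ h) x, P i + M x < t + ∑ i ∈ Finset.Ico (y * 2 ^ h) x, Q i + Q x := by
  induction h generalizing y with
  | zero =>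
    simp only [pow_zero, mul_one]
    refine ⟨by simp, by simp, fun A t => ?_⟩
    constructor
    · intro h
      exact ⟨y, le_rfl, by omega, by simpa using h⟩
    · rintro ⟨x, hx1, hx2, hx⟩
      obtain rfl : x = y := by omega
      simpa using hx
  | succ h ih =>
    have hpos : 0 < 2 ^ h := by positivity
    have e1 : y * 2 ^ (h + 1) = 2 * y * 2 ^ h := by rw [pow_succ]; ring
    have e2 : (y + 1) * 2 ^ (h + 1) = (2 * y + 1 + 1) * 2 ^ h := by rw [pow_succ]; ring
    have e3 : (2 * y + 1) * 2 ^ h = 2 * y * 2 ^ h + 2 ^ h := by ring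
    have e4 : (2 * y + 1 + 1) * 2 ^ h = 2 * y * 2 ^ h + 2 ^ h + 2 ^ h := by ring
    have hyN : y < N := by
      have h3 : (y + 1) * 2 ≤ (y + 1) * 2 ^ (h + 1) := by
        refine Nat.mul_le_mul_left _ ?_
        rw [pow_succ]
        omega
      omega
    rw [e1] at h1
    rw [e2] at h2
    obtain ⟨l1, l2, l3⟩ := ih (2 * y) (by omega) (by omega) (by omega)
      (fun i hi => hnode i (by omega))
    obtain ⟨r1, r2, r3⟩ := ih (2 * y + 1) (by omega) (by omega) (by omega)
      (fun i hi => hnode i (by omega))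
    obtain ⟨n1, n2, n3⟩ := hnode y le_rfl hyN
    rw [e1, e2]
    refine ⟨?_, ?_, fun A t => ?_⟩
    · rw [n1, l1, r1, Finset.sum_Ico_consecutive _ (by omega) (by omega)]
    · rw [n2, l2, r2, Finset.sum_Ico_consecutive _ (by omega) (by omega)]
    · have hsplit : A + M y < t + Q y ↔ (A + M (2 * y) < t + Q (2 * y)) ∨
          (A + P (2 * y) + M (2 * y + 1) < t + Q (2 * y) + Q (2 * y + 1)) := by
        rw [n2, n3]
        omega
      have hl := l3 A t
      have hr := r3 (A + P (2 * y)) (t + Q (2 * y))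
      rw [hsplit, hl, hr]
      constructor
      · rintro (⟨x, hx1, hx2, hx⟩ | ⟨x, hx1, hx2, hx⟩)
        · exact ⟨x, hx1, by omega, hx⟩
        · refine ⟨x, by omega, by omega, ?_⟩
          rw [← Finset.sum_Ico_consecutive P (n := (2 * y + 1) * 2 ^ h) (by omega) hx1,
            ← Finset.sum_Ico_consecutive Q (n := (2 * y + 1) * 2 ^ h) (by omega) hx1, ← l1, ← l2]
          omega
      · rintro ⟨x, hx1, hx2, hx⟩
        by_cases hxl : x < (2 * y + 1) * 2 ^ h
        · exact .inl ⟨x, hx1, hxl, hx⟩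
        · refine .inr ⟨x, by omega, by omega, ?_⟩
          rw [← Finset.sum_Ico_consecutive P (n := (2 * y + 1) * 2 ^ h) (by omega) (by omega),
            ← Finset.sum_Ico_consecutive Q (n := (2 * y + 1) * 2 ^ h) (by omega) (by omega),
            ← l1, ← l2] at hx
          omega

/-- Bounds for the fields of the nodes. -/
theorem minNode_le {B c : ℕ} (hP : ∑ i ∈ Finset.Ico N (2 * N), P i ≤ B)
    (hQ : ∑ i ∈ Finset.Ico N (2 * N), Q i ≤ B) (hM : ∀ x, N ≤ x → x < 2 * N → M x ≤ B) {H : ℕ}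
    (hN : N = 2 ^ H) (hnode : ∀ i, c ≤ i → i < N → MinNode P Q M i) (y : ℕ) (hy : 1 ≤ y)
    (hcy : c ≤ y) (hyN : y < 2 * N) : P y ≤ B ∧ Q y ≤ B ∧ M y ≤ B + Q y ∧ M y ≤ 2 * B := by
  have hPQ : ∀ y, 1 ≤ y → c ≤ y → y < 2 * N → P y ≤ B ∧ Q y ≤ B := by
    intro y hy hcy hyN
    have hl := Nat.pow_log_le_self 2 (show y ≠ 0 by omega)
    have hl2 := Nat.lt_pow_succ_log_self (b := 2) (by norm_num) y
    have hle : Nat.log 2 y ≤ H := by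
      by_contra h
      have h3 : 2 ^ (H + 1) ≤ 2 ^ Nat.log 2 y := Nat.pow_le_pow_right (by norm_num) (by omega)
      rw [pow_succ] at h3
      omega
    have e : N = 2 ^ Nat.log 2 y * 2 ^ (H - Nat.log 2 y) := by
      rw [← pow_add, hN]; congr 1; omega
    have b1 : N ≤ y * 2 ^ (H - Nat.log 2 y) := by
      rw [e]; exact Nat.mul_le_mul_right _ hl
    have b2 : (y + 1) * 2 ^ (H - Nat.log 2 y) ≤ 2 * N := by
      calc (y + 1) * 2 ^ (H - Nat.log 2 y) ≤ 2 ^ (Nat.log 2 y + 1) * 2 ^ (H - Nat.log 2 y) :=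
            Nat.mul_le_mul_right _ (by simpa using hl2)
        _ = 2 * N := by rw [pow_succ]; conv_rhs => rw [e]
                        ring
    obtain ⟨q1, q2, -⟩ := minNode_block _ y hy b1 b2 (fun i hi => hnode i (by omega))
    have hsub : Finset.Ico (y * 2 ^ (H - Nat.log 2 y)) ((y + 1) * 2 ^ (H - Nat.log 2 y)) ⊆
        Finset.Ico N (2 * N) := Finset.Ico_subset_Ico b1 b2
    exact ⟨q1.trans_le ((Finset.sum_le_sum_of_subset hsub).trans hP),
      q2.trans_le ((Finset.sum_le_sum_of_subset hsub).trans hQ)⟩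
  have hMy : ∀ d y, 1 ≤ y → c ≤ y → y < 2 * N → 2 * N - y ≤ d → M y ≤ B + Q y := by
    intro d
    induction d with
    | zero => intros; omega
    | succ d ih =>
      intro y hy hcy hyN hd
      by_cases hlt : y < N
      · obtain ⟨n1, n2, n3⟩ := hnode y hcy hlt
        have := ih (2 * y) (by omega) (by omega) (by omega) (by omega)
        rw [n3, n2]
        omega
      · have := hM y (by omega) hyN
        omega
  have a1 := hPQ y hy hcy hyN
  have a2 := hMy _ y hy hcy hyN le_rfl
  exact ⟨a1.1, a1.2, a2, by omega⟩

/-- Recompute node `𝐯 1` of the tree in the arrays `p`, `q`, `m`. -/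
def minStep (p q m : ℕ) : Program :=
  .put p (𝐯 1) (.get p (𝐜 2 *ₑ 𝐯 1) +ₑ .get p (𝐜 2 *ₑ 𝐯 1 +ₑ 𝐜 1)) ;;
  .put q (𝐯 1) (.get q (𝐜 2 *ₑ 𝐯 1) +ₑ .get q (𝐜 2 *ₑ 𝐯 1 +ₑ 𝐜 1)) ;;
  (2 ≔ .get m (𝐜 2 *ₑ 𝐯 1) +ₑ .get q (𝐜 2 *ₑ 𝐯 1 +ₑ 𝐜 1)) ;;
  (3 ≔ .get p (𝐜 2 *ₑ 𝐯 1) +ₑ .get m (𝐜 2 *ₑ 𝐯 1 +ₑ 𝐜 1)) ;;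
  .ite (𝐯 2 <ₑ 𝐯 3) (.put m (𝐯 1) (𝐯 2)) (.put m (𝐯 1) (𝐯 3))

variable {W : ℕ} {I : Input} {Ls : List ℕ}

theorem Run.minStep {p q m : ℕ} {s : Store} {y : ℕ} (hpq : p ≠ q) (hpm : p ≠ m) (hqm : q ≠ m)
    (hy : s.var 1 = y) (hyW : 2 * y + 1 < W) (hW : 2 < W) (hy1 : 1 ≤ y)
    (h1 : s.arr p (2 * y) + s.arr p (2 * y + 1) < W)
    (h2 : s.arr q (2 * y) + s.arr q (2 * y + 1) < W)
    (h3 : s.arr m (2 * y) + s.arr q (2 * y + 1) < W)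
    (h4 : s.arr p (2 * y) + s.arr m (2 * y + 1) < W) :
    Run W I Ls (minStep p q m) s (fun s' => MinNode (s'.arr p) (s'.arr q) (s'.arr m) y ∧
      ∀ i, i ≠ y → s'.arr p i = s.arr p i ∧ s'.arr q i = s.arr q i ∧ s'.arr m i = s.arr m i) := by
  have n1 : 2 * y ≠ y := by omega
  have n2 : 2 * y + 1 ≠ y := by omega
  unfold StackMonitoring.minStep
  refine Run.put_seq y (s.arr p (2 * y) + s.arr p (2 * y + 1)) (by simp [hy]) ?_ ?_
  · simp (disch := omega) [Nat.mod_eq_of_lt, hy]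
  refine Run.put_seq y (s.arr q (2 * y) + s.arr q (2 * y + 1)) (by simp [hy]) ?_ ?_
  · simp (disch := omega) [Nat.mod_eq_of_lt, hy, Store.setArr_arr, hpq.symm]
  refine Run.assign_seq (s.arr m (2 * y) + s.arr q (2 * y + 1)) ?_ ?_
  · simp (disch := omega) [Nat.mod_eq_of_lt, hy, Store.setArr_arr_apply, hpq.symm, hpm.symm,
      hqm.symm, n2]
  refine Run.assign_seq (s.arr p (2 * y) + s.arr m (2 * y + 1)) ?_ ?_
  · simp (disch := omega) [Nat.mod_eq_of_lt, hy, Store.setArr_arr_apply, hpq, hpm.symm,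
      hqm.symm, n1]
  refine Run.ite (fun c => ?_) (fun c => ?_)
  · have c' : s.arr m (2 * y) + s.arr q (2 * y + 1) < s.arr p (2 * y) + s.arr m (2 * y + 1) := by
      simpa [ite_one_zero_mod (show 1 < W by omega)] using c
    refine Run.put (j := y) (v := s.arr m (2 * y) + s.arr q (2 * y + 1)) (by simp [hy]) (by simp) ?_
    refine ⟨⟨?_, ?_, ?_⟩, fun i hi => ?_⟩
    all_goals simp [Store.setArr_arr_apply, *, hpq.symm, hpm.symm, hqm.symm]
    exact c'.le
  · have c' : ¬ s.arr m (2 * y) + s.arr q (2 * y + 1) < s.arr p (2 * y) + s.arr m (2 * y + 1) := by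
      simpa [ite_one_zero_mod (show 1 < W by omega)] using c
    refine Run.put (j := y) (v := s.arr p (2 * y) + s.arr m (2 * y + 1)) (by simp [hy]) (by simp) ?_
    refine ⟨⟨?_, ?_, ?_⟩, fun i hi => ?_⟩
    all_goals simp [Store.setArr_arr_apply, *, hpq.symm, hpm.symm, hqm.symm]
    exact not_lt.1 c'

theorem sum_leaves {F : ℕ → ℕ} {f : ℕ → ℕ} (h : ∀ g < N, F (N + g) = f g) {g : ℕ} (hg : g ≤ N) :
    ∑ i ∈ Finset.Ico N (N + g), F i = ∑ i ∈ Finset.range g, f i := by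
  rw [Finset.sum_Ico_eq_sum_range]
  simp only [Nat.add_sub_cancel_left]
  exact Finset.sum_congr rfl fun i hi => h i ((Finset.mem_range.1 hi).trans_le hg)

/-- Restore the tree after a change of leaf `x`. -/
theorem Run.minClimb {p q m H L B x : ℕ} {s : Store} {f g μ : ℕ → ℕ} (hpq : p ≠ q) (hpm : p ≠ m)
    (hqm : q ≠ m) (hN : N = 2 ^ H) (hNW : 4 * N + 2 < W) (hLN : Nat.log 2 (2 * N) ≤ L)
    (hBW : 4 * B < W) (hx : x < N) (hs : s.var 1 = N + x)
    (hf : ∑ i ∈ Finset.range N, f i ≤ B) (hg : ∑ i ∈ Finset.range N, g i ≤ B)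
    (hμ : ∀ i < N, μ i ≤ B)
    (hlP : ∀ i < N, s.arr p (N + i) = f i) (hlQ : ∀ i < N, s.arr q (N + i) = g i)
    (hlM : ∀ i < N, s.arr m (N + i) = μ i)
    (hnode : ∀ i, 1 ≤ i → i < N → i ≠ (N + x) / 2 → MinNode (s.arr p) (s.arr q) (s.arr m) i) :
    Run W I (L :: Ls) (StackMonitoring.climb (StackMonitoring.minStep p q m)) s
      (fun s' => MinTree (s'.arr p) (s'.arr q) (s'.arr m) N f g μ) := by
  refine (Run.climb (fun y s' => (∀ i < N, s'.arr p (N + i) = f i) ∧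
      (∀ i < N, s'.arr q (N + i) = g i) ∧ (∀ i < N, s'.arr m (N + i) = μ i) ∧
      ∀ i, 1 ≤ i → i < N → i ≠ y / 2 → MinNode (s'.arr p) (s'.arr q) (s'.arr m) i) rfl (by omega)
      (by omega) (by omega) ⟨hlP, hlQ, hlM, by rwa [hs]⟩ ?_ ?_).mono ?_
  · rw [hs]
    exact (Nat.log_mono_right (by omega)).trans hLN
  · rintro s' y hf' h1 h2 h3 ⟨i1, i2, i3, i4⟩
    rw [hs] at h2
    -- The nodes below the one being recomputed are consistent already, so their fields are bounded
    -- and the additions do not overflow.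
    have hb := minNode_le (P := s'.arr p) (Q := s'.arr q) (M := s'.arr m) (N := N) (B := B)
      (c := y / 2 + 1) (H := H)
      (by rw [two_mul, sum_leaves i1 le_rfl]; exact hf)
      (by rw [two_mul, sum_leaves i2 le_rfl]; exact hg)
      (by
        intro x hx1 hx2
        have := i3 (x - N) (by omega)
        rw [show N + (x - N) = x by omega] at this
        rw [this]
        exact hμ _ (by omega)) hN (fun i hi hi' => i4 i (by omega) hi' (by omega))
    have hb1 := hb (2 * (y / 2)) (by omega) (by omega) (by omega)
    have hb2 := hb (2 * (y / 2) + 1) (by omega) (by omega) (by omega)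
    refine (Run.minStep (y := y / 2) hpq hpm hqm (by simp) (by omega) (by omega) (by omega) ?_ ?_ ?_ ?_).mono ?_
    all_goals try (simp only [Store.setVar_arr]; omega)
    rintro s'' - ⟨j1, j2⟩
    simp only [Store.setVar_arr] at j2
    refine ⟨?_, ?_, ?_, ?_⟩
    · intro i hi
      rw [(j2 _ (by omega)).1, i1 i hi]
    · intro i hi
      rw [(j2 _ (by omega)).2.1, i2 i hi]
    · intro i hi
      rw [(j2 _ (by omega)).2.2, i3 i hi]
    · intro i k1 k2 k3
      by_cases hi : i = y / 2
      · rwa [hi]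
      · have a0 := j2 i hi
        have a1 := j2 (2 * i) (by omega)
        have a2 := j2 (2 * i + 1) (by omega)
        have := i4 i k1 k2 hi
        unfold MinNode at this ⊢
        rw [a0.1, a0.2.1, a0.2.2, a1.1, a1.2.1, a1.2.2, a2.1, a2.2.1, a2.2.2]
        exact this
  · rintro s' - ⟨i1, i2, i3, i4⟩
    exact ⟨i1, i2, i3, fun i k1 k2 => i4 i k1 k2 (by omega)⟩

end MinTree

/-! ### Searching for the next small prefix sum -/

section Find

/-- Walk from the root to leaf `𝐯 7`, remembering the last right sibling with a value below `𝐯 8`. -/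
def findDown (p q m : ℕ) : Program :=
  (11 ≔ 𝐯 11 /ₑ 𝐜 2) ;; (12 ≔ (𝐯 22 +ₑ 𝐯 7) /ₑ 𝐯 11) ;;
  .ite (𝐯 12 =ₑ 𝐜 2 *ₑ (𝐯 12 /ₑ 𝐜 2))
    (.ite (𝐯 13 +ₑ .get p (𝐯 12) +ₑ .get m (𝐯 12 +ₑ 𝐜 1) <ₑ
        𝐯 8 +ₑ 𝐯 14 +ₑ .get q (𝐯 12) +ₑ .get q (𝐯 12 +ₑ 𝐜 1))
      ((15 ≔ 𝐯 12 +ₑ 𝐜 1) ;; (16 ≔ 𝐯 13 +ₑ .get p (𝐯 12)) ;; (17 ≔ 𝐯 14 +ₑ .get q (𝐯 12)))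
      .skip)
    ((13 ≔ 𝐯 13 +ₑ .get p (𝐯 12 -ₑ 𝐜 1)) ;; (14 ≔ 𝐯 14 +ₑ .get q (𝐯 12 -ₑ 𝐜 1)))

/-- One step of the descent to the leftmost leaf with a value below `𝐯 8`. -/
def findLeft (p q m : ℕ) : Program :=
  (15 ≔ 𝐜 2 *ₑ 𝐯 15) ;;
  .ite (𝐯 16 +ₑ .get m (𝐯 15) <ₑ 𝐯 8 +ₑ 𝐯 17 +ₑ .get q (𝐯 15)) .skip
    ((16 ≔ 𝐯 16 +ₑ .get p (𝐯 15)) ;; (17 ≔ 𝐯 17 +ₑ .get q (𝐯 15)) ;; (15 ≔ 𝐯 15 +ₑ 𝐜 1))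

/-- Find the first leaf `g ≥ 𝐯 7` with a value below `𝐯 8`; the result is `𝐯 9` (`N` if there is
none) and its value is `𝐯 10`. -/
def findFrom (p q m : ℕ) : Program :=
  (11 ≔ 𝐯 22) ;; (13 ≔ 𝐜 0) ;; (14 ≔ 𝐜 0) ;; (15 ≔ 𝐜 0) ;;
  .loop (𝐜 1 <ₑ 𝐯 11) (findDown p q m) ;;
  (12 ≔ 𝐯 22 +ₑ 𝐯 7) ;;
  .ite (𝐯 13 +ₑ .get m (𝐯 12) <ₑ 𝐯 8 +ₑ 𝐯 14 +ₑ .get q (𝐯 12))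
    ((15 ≔ 𝐯 12) ;; (16 ≔ 𝐯 13) ;; (17 ≔ 𝐯 14)) .skip ;;
  .ite (𝐯 15 =ₑ 𝐜 0) (9 ≔ 𝐯 22)
    (.loop (𝐯 15 <ₑ 𝐯 22) (findLeft p q m) ;;
      (9 ≔ 𝐯 15 -ₑ 𝐯 22) ;; (10 ≔ 𝐯 16 +ₑ .get m (𝐯 15) -ₑ (𝐯 17 +ₑ .get q (𝐯 15))))

/-- `c` is a node whose block contains the first leaf from `lo` on with a value below `t`. -/
structure FirstBlock (P Q M : ℕ → ℕ) (N lo t c cP cQ h : ℕ) : Prop where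
  left : N ≤ c * 2 ^ h
  right : (c + 1) * 2 ^ h ≤ 2 * N
  lo_le : lo ≤ c * 2 ^ h
  sumP : cP = ∑ i ∈ Finset.Ico N (c * 2 ^ h), P i
  sumQ : cQ = ∑ i ∈ Finset.Ico N (c * 2 ^ h), Q i
  before : ∀ x, lo ≤ x → x < c * 2 ^ h → ¬ Below P Q M N x t
  mem : ∃ x, c * 2 ^ h ≤ x ∧ x < (c + 1) * 2 ^ h ∧ Below P Q M N x t

/-- The node `c` (0 for none) is a candidate for the first leaf from `lo` on. -/
def Candidate (P Q M : ℕ → ℕ) (N lo t c cP cQ : ℕ) : Prop :=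
  (c = 0 ∧ ∀ x, lo ≤ x → x < 2 * N → ¬ Below P Q M N x t) ∨
    c ≠ 0 ∧ ∃ h, FirstBlock P Q M N lo t c cP cQ h

/-- A tree in the arrays `p`, `q`, `m` with bounded sums. -/
structure GoodTree (P Q M : ℕ → ℕ) (N B : ℕ) : Prop where
  node : ∀ i, 1 ≤ i → i < N → MinNode P Q M i
  sumP : ∑ i ∈ Finset.Ico N (2 * N), P i ≤ B
  sumQ : ∑ i ∈ Finset.Ico N (2 * N), Q i ≤ B
  leafM : ∀ x, N ≤ x → x < 2 * N → M x ≤ B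

variable {P Q M : ℕ → ℕ} {N B : ℕ}

/-- The block statement in absolute form: with the sums before the block put in, the test at a node
tells whether some leaf below it is small. The search programs perform exactly this test. -/
theorem GoodTree.block (hT : GoodTree P Q M N B) (h y : ℕ) (hy : 1 ≤ y) (h1 : N ≤ y * 2 ^ h)
    (h2 : (y + 1) * 2 ^ h ≤ 2 * N) :
    ∑ i ∈ Finset.Ico N (y * 2 ^ h), P i + P y = ∑ i ∈ Finset.Ico N ((y + 1) * 2 ^ h), P i ∧
    ∑ i ∈ Finset.Ico N (y * 2 ^ h), Q i + Q y = ∑ i ∈ Finset.Ico N ((y + 1) * 2 ^ h), Q i ∧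
    ∀ t, ∑ i ∈ Finset.Ico N (y * 2 ^ h), P i + M y <
        t + ∑ i ∈ Finset.Ico N (y * 2 ^ h), Q i + Q y ↔
      ∃ x, y * 2 ^ h ≤ x ∧ x < (y + 1) * 2 ^ h ∧ Below P Q M N x t := by
  obtain ⟨b1, b2, b3⟩ := minNode_block h y hy h1 h2 (fun i hi hi' => hT.node i (by omega) hi')
  have hle : y * 2 ^ h ≤ (y + 1) * 2 ^ h := Nat.mul_le_mul_right _ (by omega)
  refine ⟨?_, ?_, fun t => ?_⟩
  · rw [b1, Finset.sum_Ico_consecutive _ h1 hle]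
  · rw [b2, Finset.sum_Ico_consecutive _ h1 hle]
  · rw [b3]
    refine exists_congr fun x => ?_
    constructor
    · rintro ⟨hx1, hx2, hx⟩
      refine ⟨hx1, hx2, ?_⟩
      unfold Below
      rw [← Finset.sum_Ico_consecutive P h1 hx1, ← Finset.sum_Ico_consecutive Q h1 hx1]
      omega
    · rintro ⟨hx1, hx2, hx⟩
      refine ⟨hx1, hx2, ?_⟩
      unfold Below at hx
      rw [← Finset.sum_Ico_consecutive P h1 hx1, ← Finset.sum_Ico_consecutive Q h1 hx1] at hx
      omega

theorem GoodTree.prefix_le (hT : GoodTree P Q M N B) {x : ℕ} (hx : x ≤ 2 * N) :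
    ∑ i ∈ Finset.Ico N x, P i ≤ B ∧ ∑ i ∈ Finset.Ico N x, Q i ≤ B :=
  ⟨(Finset.sum_le_sum_of_subset (Finset.Ico_subset_Ico le_rfl hx)).trans hT.sumP,
    (Finset.sum_le_sum_of_subset (Finset.Ico_subset_Ico le_rfl hx)).trans hT.sumQ⟩

theorem GoodTree.node_le (hT : GoodTree P Q M N B) {H : ℕ} (hN : N = 2 ^ H) (y : ℕ) (hy : 1 ≤ y)
    (hyN : y < 2 * N) : P y ≤ B ∧ Q y ≤ B ∧ M y ≤ 2 * B := by
  have := minNode_le hT.sumP hT.sumQ hT.leafM hN hT.node y hy hy hyN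
  exact ⟨this.1, this.2.1, this.2.2.2⟩

variable {W : ℕ} {I : Input} {Ls : List ℕ}

/-- The node `(N + i) / 2 ^ h` is the ancestor of leaf `i` at height `h`. When the path turns left,
the leaves of the right sibling come before all leaves to the right found earlier, so this sibling
replaces the candidate if it contains a small leaf. -/
theorem Run.findDown {p q m : ℕ} {s : Store} {H i t h : ℕ}
    (hT : GoodTree (s.arr p) (s.arr q) (s.arr m) N B) (hN : N = 2 ^ H) (hNW : 4 * N + 2 < W)
    (hW : 2 < W)
    (hBW : 8 * B < W) (ht : t ≤ B) (hi : i < N) (h22 : s.var 22 = N) (h7 : s.var 7 = i)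
    (h8 : s.var 8 = t) (h11 : s.var 11 = 2 ^ (h + 1)) (hh : h + 1 ≤ H)
    (h13 : s.var 13 = ∑ j ∈ Finset.Ico N ((N + i) / 2 ^ (h + 1) * 2 ^ (h + 1)), s.arr p j)
    (h14 : s.var 14 = ∑ j ∈ Finset.Ico N ((N + i) / 2 ^ (h + 1) * 2 ^ (h + 1)), s.arr q j)
    (hc : Candidate (s.arr p) (s.arr q) (s.arr m) N (((N + i) / 2 ^ (h + 1) + 1) * 2 ^ (h + 1)) t
      (s.var 15) (s.var 16) (s.var 17)) :
    Run W I Ls (findDown p q m) s (fun s' => s'.var 11 = 2 ^ h ∧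
      s'.var 13 = ∑ j ∈ Finset.Ico N ((N + i) / 2 ^ h * 2 ^ h), s.arr p j ∧
      s'.var 14 = ∑ j ∈ Finset.Ico N ((N + i) / 2 ^ h * 2 ^ h), s.arr q j ∧
      Candidate (s.arr p) (s.arr q) (s.arr m) N (((N + i) / 2 ^ h + 1) * 2 ^ h) t
      (s'.var 15) (s'.var 16) (s'.var 17)) := by
  have hpos : 0 < 2 ^ h := by positivity
  have hNh : N = 2 ^ (H - (h + 1)) * 2 ^ (h + 1) := by rw [← pow_add, hN]; congr 1; omega
  generalize hx0 : (N + i) / 2 ^ (h + 1) = x0 at h13 h14 hc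
  generalize hx : (N + i) / 2 ^ h = x
  have hxx0 : x / 2 = x0 := by rw [← hx, ← hx0, pow_succ, Nat.div_div_eq_div_mul]
  have e1 : x0 * 2 ^ (h + 1) = 2 * x0 * 2 ^ h := by rw [pow_succ]; ring
  have e2 : (x0 + 1) * 2 ^ (h + 1) = (2 * x0 + 1 + 1) * 2 ^ h := by rw [pow_succ]; ring
  have e3 : (2 * x0 + 1) * 2 ^ h = 2 * x0 * 2 ^ h + 2 ^ h := by ring
  have e4 : (2 * x0 + 1 + 1) * 2 ^ h = 2 * x0 * 2 ^ h + 2 ^ h + 2 ^ h := by ring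
  have hlo : N ≤ x0 * 2 ^ (h + 1) := by
    have : 2 ^ (H - (h + 1)) ≤ x0 := by
      rw [← hx0, Nat.le_div_iff_mul_le (by positivity), ← hNh]
      omega
    calc N = 2 ^ (H - (h + 1)) * 2 ^ (h + 1) := hNh
      _ ≤ _ := Nat.mul_le_mul_right _ this
  have hhi : (x0 + 1) * 2 ^ (h + 1) ≤ 2 * N := by
    have : x0 < 2 * 2 ^ (H - (h + 1)) := by
      rw [← hx0, Nat.div_lt_iff_lt_mul (by positivity), mul_assoc, ← hNh]
      omega
    calc (x0 + 1) * 2 ^ (h + 1) ≤ 2 * 2 ^ (H - (h + 1)) * 2 ^ (h + 1) := Nat.mul_le_mul_right _ this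
      _ = 2 * N := by rw [mul_assoc, ← hNh]
  have hhN : 2 ^ h ≤ N := by rw [hN]; exact Nat.pow_le_pow_right (by norm_num) (by omega)
  have hx1 : 1 ≤ x0 := by
    by_contra hx1
    obtain rfl : x0 = 0 := by omega
    simp at hlo
    omega
  have hxN : 2 * x0 + 1 < 2 * N := by
    have h5 : 2 * x0 + 1 + 1 ≤ (2 * x0 + 1 + 1) * 2 ^ h := Nat.le_mul_of_pos_right _ hpos
    omega
  have hbl := hT.node_le hN (2 * x0) (by omega) (by omega)
  have hbr := hT.node_le hN (2 * x0 + 1) (by omega) (by omega)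
  have hpre := hT.prefix_le (x := x0 * 2 ^ (h + 1)) (by omega)
  rw [← h13, ← h14] at hpre
  obtain ⟨bl1, bl2, bl3⟩ := hT.block h (2 * x0) (by omega) (by omega) (by omega)
  obtain ⟨br1, br2, br3⟩ := hT.block h (2 * x0 + 1) (by omega) (by omega) (by omega)
  rw [e1] at h13 h14
  unfold StackMonitoring.findDown
  refine Run.assign_seq (2 ^ h) ?_ ?_
  · have : 2 ^ (h + 1) / 2 = 2 ^ h := by rw [pow_succ]; omega
    simp (disch := omega) [Nat.mod_eq_of_lt, h11, this]
  refine Run.assign_seq x ?_ ?_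
  · have : x < W := by omega
    simp (disch := omega) [Nat.mod_eq_of_lt, h22, h7, hx]
  refine Run.ite (fun c => ?_) (fun c => ?_)
  · have hxe : x = 2 * x0 := by
      have h5 : x = 2 * (x / 2) := by
        by_contra h5
        simp (disch := omega) [Nat.mod_eq_of_lt, h5] at c
      omega
    rw [hxe]
    refine Run.ite (fun c2 => ?_) (fun c2 => ?_)
    · have c2' : s.var 13 + s.arr p (2 * x0) + s.arr m (2 * x0 + 1) <
          t + s.var 14 + s.arr q (2 * x0) + s.arr q (2 * x0 + 1) := by
        simp (disch := omega) [Nat.mod_eq_of_lt, h8, ite_one_zero_mod] at c2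
        exact c2
      refine Run.assign_seq (2 * x0 + 1) (by simp (disch := omega) [Nat.mod_eq_of_lt]) ?_
      refine Run.assign_seq (s.var 13 + s.arr p (2 * x0)) (by simp (disch := omega) [Nat.mod_eq_of_lt]) ?_
      refine Run.assign (v := s.var 14 + s.arr q (2 * x0)) (by simp (disch := omega) [Nat.mod_eq_of_lt]) ?_
      refine ⟨by simp, by simpa using h13, by simpa using h14, .inr ⟨by simp, h, ?_⟩⟩
      simp only [Store.setVar_var]
      norm_num
      refine ⟨by omega, by omega, le_rfl, by rw [h13, bl1], by rw [h14, bl2], fun x h5 h6 => by omega, ?_⟩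
      refine (br3 t).1 ?_
      rw [← bl1, ← bl2]
      omega
    · have c2' : ¬ s.var 13 + s.arr p (2 * x0) + s.arr m (2 * x0 + 1) <
          t + s.var 14 + s.arr q (2 * x0) + s.arr q (2 * x0 + 1) := by
        simp (disch := omega) [Nat.mod_eq_of_lt, h8, ite_one_zero_mod] at c2
        omega
      have hno : ∀ y, (2 * x0 + 1) * 2 ^ h ≤ y → y < (2 * x0 + 1 + 1) * 2 ^ h →
          ¬ Below (s.arr p) (s.arr q) (s.arr m) N y t := by
        intro y h5 h6 h7
        have := (br3 t).2 ⟨y, h5, h6, h7⟩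
        rw [← bl1, ← bl2] at this
        omega
      refine Run.skip ⟨by simp, by simpa using h13, by simpa using h14, ?_⟩
      simp only [Store.setVar_var]
      norm_num
      rw [e2] at hc
      rcases hc with ⟨k1, k2⟩ | ⟨k1, h', k2⟩
      · refine .inl ⟨k1, fun y h5 h6 => ?_⟩
        by_cases h7 : y < (2 * x0 + 1 + 1) * 2 ^ h
        · exact hno y h5 h7
        · exact k2 y (by omega) h6
      · have := k2.lo_le
        refine .inr ⟨k1, h', k2.left, k2.right, by omega, k2.sumP, k2.sumQ, fun y h5 h6 => ?_, k2.mem⟩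
        by_cases h7 : y < (2 * x0 + 1 + 1) * 2 ^ h
        · exact hno y h5 h7
        · exact k2.before y (by omega) h6
  · have hxe : x = 2 * x0 + 1 := by
      have h5 : x ≠ 2 * (x / 2) := by
        intro h5
        have h6 : 2 * (x / 2) < W := by omega
        simp (disch := omega) [Nat.mod_eq_of_lt, ← h5] at c
      omega
    rw [hxe]
    refine Run.assign_seq (s.var 13 + s.arr p (2 * x0)) (by simp (disch := omega) [Nat.mod_eq_of_lt]) ?_
    refine Run.assign (v := s.var 14 + s.arr q (2 * x0)) (by simp (disch := omega) [Nat.mod_eq_of_lt]) ?_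
    rw [← bl1, ← bl2, ← h13, ← h14]
    refine ⟨by simp, by simp, by simp, ?_⟩
    rw [e2] at hc
    simpa using hc

/-- The first small leaf of a block is in the left child if the minimum there is small. Otherwise
the left child has no small leaf and its sums join the prefix. -/
theorem Run.findLeft {p q m : ℕ} {s : Store} {H t lo : ℕ}
    (hT : GoodTree (s.arr p) (s.arr q) (s.arr m) N B) (hN : N = 2 ^ H) (hNW : 4 * N + 2 < W)
    (hBW : 8 * B < W) (ht : t ≤ B) (h8 : s.var 8 = t) (hcN : s.var 15 < N) {h : ℕ}
    (hc : FirstBlock (s.arr p) (s.arr q) (s.arr m) N lo t (s.var 15) (s.var 16) (s.var 17) h) :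
    Run W I Ls (findLeft p q m) s (fun s' =>
      (∃ h, FirstBlock (s.arr p) (s.arr q) (s.arr m) N lo t (s'.var 15) (s'.var 16) (s'.var 17) h) ∧
      s'.var 15 / 2 = s.var 15) := by
  generalize hx0 : s.var 15 = x0 at hc hcN
  obtain ⟨k1, k2, k3, k4, k5, k6, k7⟩ := hc
  obtain ⟨h, rfl⟩ : ∃ h', h = h' + 1 := by
    rcases h with - | h
    · simp at k1
      omega
    · exact ⟨h, rfl⟩
  have hpos : 0 < 2 ^ h := by positivity
  have e1 : x0 * 2 ^ (h + 1) = 2 * x0 * 2 ^ h := by rw [pow_succ]; ring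
  have e2 : (x0 + 1) * 2 ^ (h + 1) = (2 * x0 + 1 + 1) * 2 ^ h := by rw [pow_succ]; ring
  have e3 : (2 * x0 + 1) * 2 ^ h = 2 * x0 * 2 ^ h + 2 ^ h := by ring
  have e4 : (2 * x0 + 1 + 1) * 2 ^ h = 2 * x0 * 2 ^ h + 2 ^ h + 2 ^ h := by ring
  rw [e1] at k1 k3 k4 k5 k6 k7
  rw [e2] at k2 k7
  have hNpos : 1 ≤ N := by rw [hN]; exact Nat.one_le_two_pow
  have hx1 : 1 ≤ x0 := by
    by_contra hx1
    obtain rfl : x0 = 0 := by omega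
    simp at k1
    omega
  have hxN : 2 * x0 + 1 < 2 * N := by omega
  have hbl := hT.node_le hN (2 * x0) (by omega) (by omega)
  have hpre := hT.prefix_le (x := 2 * x0 * 2 ^ h) (by omega)
  rw [← k4, ← k5] at hpre
  obtain ⟨bl1, bl2, bl3⟩ := hT.block h (2 * x0) (by omega) (by omega) (by omega)
  have bl3 := bl3 t
  rw [← k4, ← k5] at bl3
  rw [← k4] at bl1
  rw [← k5] at bl2
  unfold StackMonitoring.findLeft
  refine Run.assign_seq (2 * x0) (by simp (disch := omega) [Nat.mod_eq_of_lt, hx0]) ?_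
  refine Run.ite (fun c => ?_) (fun c => ?_)
  · have c' : s.var 16 + s.arr m (2 * x0) < t + s.var 17 + s.arr q (2 * x0) := by
      simp (disch := omega) [Nat.mod_eq_of_lt, h8, ite_one_zero_mod] at c
      exact c
    refine Run.skip ⟨⟨h, ?_⟩, by simp⟩
    simp only [Store.setVar_var]
    norm_num
    exact ⟨k1, by omega, k3, k4, k5, k6, bl3.1 c'⟩
  · have c' : ¬ s.var 16 + s.arr m (2 * x0) < t + s.var 17 + s.arr q (2 * x0) := by
      simp (disch := omega) [Nat.mod_eq_of_lt, h8, ite_one_zero_mod] at c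
      omega
    refine Run.assign_seq (s.var 16 + s.arr p (2 * x0)) (by simp (disch := omega) [Nat.mod_eq_of_lt]) ?_
    refine Run.assign_seq (s.var 17 + s.arr q (2 * x0)) (by simp (disch := omega) [Nat.mod_eq_of_lt]) ?_
    refine Run.assign (v := 2 * x0 + 1) (by simp (disch := omega) [Nat.mod_eq_of_lt]) ?_
    have hno : ∀ y, 2 * x0 * 2 ^ h ≤ y → y < (2 * x0 + 1) * 2 ^ h →
        ¬ Below (s.arr p) (s.arr q) (s.arr m) N y t :=
      fun y h5 h6 h7 => c' (bl3.2 ⟨y, h5, h6, h7⟩)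
    refine ⟨⟨h, ?_⟩, by simp; omega⟩
    simp only [Store.setVar_var]
    norm_num
    refine ⟨by omega, k2, by omega, bl1, bl2, fun y h5 h6 => ?_, ?_⟩
    · by_cases h7 : y < 2 * x0 * 2 ^ h
      · exact k6 y h5 h7
      · exact hno y (by omega) h6
    · obtain ⟨y, h5, h6, h7⟩ := k7
      refine ⟨y, ?_, h6, h7⟩
      by_contra h8
      exact hno y h5 (by omega) h7

/-- The leaves from `i` on are leaf `i` together with the blocks of the right siblings along its
path. So the lowest sibling with a small leaf is the right place to descend, unless leaf `i` is
itself small. -/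
theorem Run.findFrom_good {p q m L : ℕ} {s : Store} {H i t : ℕ}
    (hT : GoodTree (s.arr p) (s.arr q) (s.arr m) N B) (hN : N = 2 ^ H) (hNW : 4 * N + 2 < W)
    (hBW : 8 * B < W) (ht : t ≤ B) (hi : i < N) (hLN : Nat.log 2 (2 * N) ≤ L)
    (h22 : s.var 22 = N) (h7 : s.var 7 = i) (h8 : s.var 8 = t) :
    Run W I (L :: Ls) (findFrom p q m) s (fun s' => s'.var 9 ≤ N ∧
      (s'.var 9 < N → i ≤ s'.var 9 ∧ Below (s.arr p) (s.arr q) (s.arr m) N (N + s'.var 9) t ∧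
        s'.var 10 = ∑ j ∈ Finset.Ico N (N + s'.var 9), s.arr p j + s.arr m (N + s'.var 9) -
          (∑ j ∈ Finset.Ico N (N + s'.var 9), s.arr q j + s.arr q (N + s'.var 9))) ∧
      ∀ g, i ≤ g → g < s'.var 9 → ¬ Below (s.arr p) (s.arr q) (s.arr m) N (N + g) t) := by
  have hNpos : 1 ≤ N := by rw [hN]; exact Nat.one_le_two_pow
  unfold StackMonitoring.findFrom
  refine Run.assign_seq N (by simp [h22]) ?_
  refine Run.assign_seq 0 (by simp) ?_
  refine Run.assign_seq 0 (by simp) ?_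
  refine Run.assign_seq 0 (by simp) ?_
  have hdN : (N + i) / 2 ^ H = 1 := by
    rw [← hN]
    exact Nat.div_eq_of_lt_le (by omega) (by omega)
  refine Run.seq (R := fun s1 => s1.var 13 = ∑ j ∈ Finset.Ico N (N + i), s.arr p j ∧
      s1.var 14 = ∑ j ∈ Finset.Ico N (N + i), s.arr q j ∧
      Candidate (s.arr p) (s.arr q) (s.arr m) N (N + i + 1) t (s1.var 15) (s1.var 16) (s1.var 17))
    ?_ ?_
  · refine (Run.loop (fun s1 => ∃ h ≤ H, s1.var 11 = 2 ^ h ∧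
      s1.var 13 = ∑ j ∈ Finset.Ico N ((N + i) / 2 ^ h * 2 ^ h), s.arr p j ∧
      s1.var 14 = ∑ j ∈ Finset.Ico N ((N + i) / 2 ^ h * 2 ^ h), s.arr q j ∧
      Candidate (s.arr p) (s.arr q) (s.arr m) N (((N + i) / 2 ^ h + 1) * 2 ^ h) t
      (s1.var 15) (s1.var 16) (s1.var 17)) (fun s1 => Nat.log 2 (s1.var 11)) ?_ ?_ ?_).mono ?_
    · refine ⟨H, le_rfl, by simp [hN], ?_, ?_, .inl ?_⟩
      · rw [hdN, one_mul, ← hN]; simp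
      · rw [hdN, one_mul, ← hN]; simp
      · rw [hdN, ← hN]
        exact ⟨by simp, fun x h1 h2 => by omega⟩
    · simp only [Store.setVar_var]
      norm_num
      exact (Nat.log_mono_right (by omega)).trans hLN
    · rintro s1 hf ⟨h, hh, j1, j2, j3, j4⟩ hb
      have hhpos : h ≠ 0 := by
        rintro rfl
        simp [j1, show W ≠ 1 by omega] at hb
      obtain ⟨h, rfl⟩ := Nat.exists_eq_succ_of_ne_zero hhpos
      have fp : s1.arr p = s.arr p := by rw [hf.arr p rfl]; rfl
      have fq : s1.arr q = s.arr q := by rw [hf.arr q rfl]; rfl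
      have fm : s1.arr m = s.arr m := by rw [hf.arr m rfl]; rfl
      have f22 : s1.var 22 = N := by rw [hf.var 22 rfl]; simp [h22]
      have f7 : s1.var 7 = i := by rw [hf.var 7 rfl]; simp [h7]
      have f8 : s1.var 8 = t := by rw [hf.var 8 rfl]; simp [h8]
      refine (Run.findDown (H := H) (i := i) (t := t) (h := h) (by rwa [fp, fq, fm]) hN hNW (by omega) hBW
        ht hi f22 f7 f8 j1 hh (by rwa [fp]) (by rwa [fq]) (by rwa [fp, fq, fm])).mono ?_
      rintro s2 - ⟨l1, l2, l3, l4⟩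
      rw [fp] at l2
      rw [fq] at l3
      rw [fp, fq, fm] at l4
      refine ⟨⟨h, by omega, l1, l2, l3, l4⟩, ?_⟩
      rw [l1, j1, Nat.log_pow (by norm_num), Nat.log_pow (by norm_num)]
      omega
    · rintro s1 hf ⟨⟨h, hh, j1, j2, j3, j4⟩, hb⟩
      have hh0 : h = 0 := by
        by_contra hne
        obtain ⟨h, rfl⟩ := Nat.exists_eq_succ_of_ne_zero hne
        have : 1 < 2 ^ (h + 1) := Nat.one_lt_two_pow (by omega)
        simp (disch := omega) [j1, Nat.mod_eq_of_lt, this] at hb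
      subst hh0
      simp only [pow_zero, Nat.div_one, mul_one] at j2 j3 j4
      exact ⟨j2, j3, j4⟩
  rintro s1 hf1 ⟨a13, a14, hcand⟩
  have fp : s1.arr p = s.arr p := by rw [hf1.arr p rfl]; rfl
  have fq : s1.arr q = s.arr q := by rw [hf1.arr q rfl]; rfl
  have fm : s1.arr m = s.arr m := by rw [hf1.arr m rfl]; rfl
  have f22 : s1.var 22 = N := by rw [hf1.var 22 rfl]; simp [h22]
  have f7 : s1.var 7 = i := by rw [hf1.var 7 rfl]; simp [h7]
  have f8 : s1.var 8 = t := by rw [hf1.var 8 rfl]; simp [h8]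
  have hpre := hT.prefix_le (x := N + i) (by omega)
  rw [← a13, ← a14] at hpre
  have hbi := hT.node_le hN (N + i) (by omega) (by omega)
  have hbelow : Below (s.arr p) (s.arr q) (s.arr m) N (N + i) t ↔
      s1.var 13 + s.arr m (N + i) < t + s1.var 14 + s.arr q (N + i) := by
    unfold Below; rw [a13, a14]
  refine Run.assign_seq (N + i) (by simp (disch := omega) [Nat.mod_eq_of_lt, f22, f7]) ?_
  refine Run.seq (R := fun s2 => Candidate (s.arr p) (s.arr q) (s.arr m) N (N + i) t (s2.var 15)
    (s2.var 16) (s2.var 17)) ?_ ?_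
  · refine Run.ite (fun c => ?_) (fun c => ?_)
    · have c' : s1.var 13 + s.arr m (N + i) < t + s1.var 14 + s.arr q (N + i) := by
        simp (disch := omega) [Nat.mod_eq_of_lt, f8, fm, fq, ite_one_zero_mod] at c
        exact c
      refine Run.assign_seq (N + i) (by simp) ?_
      refine Run.assign_seq (s1.var 13) (by simp) ?_
      refine Run.assign (v := s1.var 14) (by simp) ?_
      refine .inr ⟨by simp; omega, 0, ?_⟩
      simp only [Store.setVar_var]
      norm_num
      refine ⟨by omega, by omega, by omega, by simpa using a13, by simpa using a14,
        fun x h1 h2 => by omega, ⟨N + i, by omega, by omega, hbelow.2 c'⟩⟩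
    · have c' : ¬ Below (s.arr p) (s.arr q) (s.arr m) N (N + i) t := by
        rw [hbelow]
        simp (disch := omega) [Nat.mod_eq_of_lt, f8, fm, fq, ite_one_zero_mod] at c
        omega
      refine Run.skip ?_
      simp only [Store.setVar_var]
      norm_num
      rcases hcand with ⟨k1, k2⟩ | ⟨k1, h', k2⟩
      · refine .inl ⟨k1, fun x h5 h6 => ?_⟩
        by_cases h7 : x = N + i
        · rwa [h7]
        · exact k2 x (by omega) h6
      · have := k2.lo_le
        refine .inr ⟨k1, h', k2.left, k2.right, by omega, k2.sumP, k2.sumQ, fun x h5 h6 => ?_, k2.mem⟩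
        by_cases h7 : x = N + i
        · rwa [h7]
        · exact k2.before x (by omega) h6
  · intro s2 hf2 hc2
    have g22 : s2.var 22 = N := by rw [hf2.var 22 rfl]; simp [f22]
    have g8 : s2.var 8 = t := by rw [hf2.var 8 rfl]; simp [f8]
    have gp : s2.arr p = s.arr p := by rw [hf2.arr p rfl, Store.setVar_arr, fp]
    have gq : s2.arr q = s.arr q := by rw [hf2.arr q rfl, Store.setVar_arr, fq]
    have gm : s2.arr m = s.arr m := by rw [hf2.arr m rfl, Store.setVar_arr, fm]
    refine Run.ite (fun c => ?_) (fun c => ?_)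
    · have c' : s2.var 15 = 0 := by
        by_contra h
        simp [h] at c
      refine Run.assign (v := N) (by simp [g22]) ?_
      simp only [Store.setVar_var]
      norm_num
      rcases hc2 with ⟨-, k2⟩ | ⟨k1, -⟩
      · exact fun g h1 h2 => k2 _ (by omega) (by omega)
      · exact absurd c' k1
    · have c' : s2.var 15 ≠ 0 := by
        intro h
        simp [h, show W ≠ 1 by omega] at c
      rcases hc2 with ⟨k1, -⟩ | ⟨-, k2⟩
      · exact absurd k1 c'
      have hcN : s2.var 15 < 2 * N := by
        obtain ⟨h, k2⟩ := k2
        have h1 := k2.right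
        have h2 : s2.var 15 + 1 ≤ (s2.var 15 + 1) * 2 ^ h := Nat.le_mul_of_pos_right _ (by positivity)
        omega
      refine Run.seq (Run.loop (fun s3 => 1 ≤ s3.var 15 ∧ s3.var 15 < 2 * N ∧
        ∃ h, FirstBlock (s.arr p) (s.arr q) (s.arr m) N (N + i) t
        (s3.var 15) (s3.var 16) (s3.var 17) h)
        (fun s3 => Nat.log 2 (2 * N) - Nat.log 2 (s3.var 15)) ⟨by omega, hcN, k2⟩ (by omega) ?_) ?_
      · rintro s3 hf3 ⟨p1, p2, h, p3⟩ hb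
        have u22 : s3.var 22 = N := by rw [hf3.var 22 rfl, g22]
        have u8 : s3.var 8 = t := by rw [hf3.var 8 rfl, g8]
        have up : s3.arr p = s.arr p := by rw [hf3.arr p rfl, gp]
        have uq : s3.arr q = s.arr q := by rw [hf3.arr q rfl, gq]
        have um : s3.arr m = s.arr m := by rw [hf3.arr m rfl, gm]
        have hb' : s3.var 15 < N := by
          by_contra h
          simp [u22, h] at hb
        refine (Run.findLeft (H := H) (t := t) (lo := N + i) (by rwa [up, uq, um]) hN hNW hBW ht u8 hb'
          (by rw [up, uq, um]; exact p3)).mono ?_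
        rintro s4 - ⟨q1, q2⟩
        rw [up, uq, um] at q1
        have hlt : s4.var 15 < 2 * N := by omega
        refine ⟨⟨by omega, hlt, q1⟩, ?_⟩
        have l1 : Nat.log 2 (s3.var 15) < Nat.log 2 (s4.var 15) := by
          have h1 := Nat.log_div_base 2 (s4.var 15)
          rw [q2] at h1
          have := Nat.log_pos (by norm_num : 1 < 2) (show 2 ≤ s4.var 15 by omega)
          omega
        have l2 : Nat.log 2 (s4.var 15) ≤ Nat.log 2 (2 * N) := Nat.log_mono_right hlt.le
        omega
      · rintro s3 hf3 ⟨⟨p1, p2, h, p3⟩, hb⟩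
        have u22 : s3.var 22 = N := by rw [hf3.var 22 rfl, g22]
        have up : s3.arr p = s.arr p := by rw [hf3.arr p rfl, gp]
        have uq : s3.arr q = s.arr q := by rw [hf3.arr q rfl, gq]
        have um : s3.arr m = s.arr m := by rw [hf3.arr m rfl, gm]
        have hb' : N ≤ s3.var 15 := by
          by_contra h
          simp [u22, not_le.1 h, show W ≠ 1 by omega] at hb
        have hh0 : h = 0 := by
          by_contra hne
          obtain ⟨h, rfl⟩ := Nat.exists_eq_succ_of_ne_zero hne
          have h1 := p3.right
          have h2 : (s3.var 15 + 1) * 2 ≤ (s3.var 15 + 1) * 2 ^ (h + 1) := by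
            refine Nat.mul_le_mul_left _ ?_
            rw [pow_succ]
            have : 0 < 2 ^ h := by positivity
            omega
          simp only [Nat.succ_eq_add_one] at h1
          omega
        subst hh0
        obtain ⟨g, hg⟩ : ∃ g, s3.var 15 = N + g := ⟨s3.var 15 - N, by omega⟩
        obtain ⟨r1, r2, r3, r4, r5, r6, x, r7, r8, r9⟩ := p3
        rw [hg] at r1 r2 r3 r4 r5 r6 r7 r8 p1 p2
        simp only [pow_zero, mul_one] at r1 r2 r3 r4 r5 r6 r7 r8
        obtain rfl : x = N + g := by omega
        have hpre := hT.prefix_le (x := N + g) (by omega)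
        rw [← r4, ← r5] at hpre
        have hbg := hT.node_le hN (N + g) (by omega) (by omega)
        refine Run.assign_seq g ?_ ?_
        · have : g < W := by omega
          simp (disch := omega) [u22, hg, Nat.mod_eq_of_lt]
        refine Run.assign (v := s3.var 16 + s.arr m (N + g) - (s3.var 17 + s.arr q (N + g))) ?_ ?_
        · simp (disch := omega) [hg, um, uq, Nat.mod_eq_of_lt]
        · simp only [Store.setVar_var]
          norm_num
          refine ⟨by omega, fun _ => ⟨by omega, r9, by rw [r4, r5]⟩, fun g' h1 h2 => r6 _ (by omega) (by omega)⟩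

end Find

/-! ### The tree of covering values and the tree of waiting operations -/

section Trees

variable {W : ℕ} {I : Input} {Ls : List ℕ} {N B : ℕ}

theorem MinTree.good {P Q M f g μ : ℕ → ℕ} (h : MinTree P Q M N f g μ)
    (hf : ∑ i ∈ Finset.range N, f i ≤ B) (hg : ∑ i ∈ Finset.range N, g i ≤ B)
    (hμ : ∀ i < N, μ i ≤ B) : GoodTree P Q M N B := by
  refine ⟨h.node, ?_, ?_, fun x h1 h2 => ?_⟩
  · rwa [two_mul, sum_leaves h.leafP le_rfl]
  · rwa [two_mul, sum_leaves h.leafQ le_rfl]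
  · have := h.leafM (x - N) (by omega)
    rw [show N + (x - N) = x by omega] at this
    rw [this]
    exact hμ _ (by omega)

theorem MinTree.below_iff {P Q M f g μ : ℕ → ℕ} (h : MinTree P Q M N f g μ) {x t : ℕ} (hx : x < N) :
    Below P Q M N (N + x) t ↔
      ∑ i ∈ Finset.range x, f i + μ x < t + ∑ i ∈ Finset.range (x + 1), g i := by
  unfold Below
  rw [sum_leaves h.leafP hx.le, sum_leaves h.leafQ hx.le, h.leafM x hx, h.leafQ x hx,
    Finset.sum_range_succ, add_assoc]

theorem Run.findFrom {p q m L : ℕ} {s : Store} {H i t : ℕ} {f g μ : ℕ → ℕ}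
    (hT : MinTree (s.arr p) (s.arr q) (s.arr m) N f g μ)
    (hf : ∑ i ∈ Finset.range N, f i ≤ B) (hg : ∑ i ∈ Finset.range N, g i ≤ B)
    (hμ : ∀ i < N, μ i ≤ B) (hN : N = 2 ^ H) (hNW : 4 * N + 2 < W)
    (hBW : 8 * B < W) (ht : t ≤ B) (hLN : Nat.log 2 (2 * N) ≤ L)
    (h22 : s.var 22 = N) (h7 : s.var 7 = i) (h8 : s.var 8 = t) (hiN : i < N) :
    Run W I (L :: Ls) (findFrom p q m) s (fun s' => s'.var 9 ≤ N ∧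
      (s'.var 9 < N → i ≤ s'.var 9 ∧ ∑ j ∈ Finset.range (s'.var 9), f j + μ (s'.var 9) <
          t + ∑ j ∈ Finset.range (s'.var 9 + 1), g j ∧
        s'.var 10 = ∑ j ∈ Finset.range (s'.var 9), f j + μ (s'.var 9) -
          ∑ j ∈ Finset.range (s'.var 9 + 1), g j) ∧
      ∀ x, i ≤ x → x < s'.var 9 →
        t + ∑ j ∈ Finset.range (x + 1), g j ≤ ∑ j ∈ Finset.range x, f j + μ x) := by
  refine (Run.findFrom_good (hT.good hf hg hμ) hN hNW hBW ht hiN hLN h22 h7 h8).mono ?_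
  rintro s' - ⟨h1, h2, h3⟩
  refine ⟨h1, fun h => ?_, fun x hx hx' => ?_⟩
  · obtain ⟨a1, a2, a3⟩ := h2 h
    rw [hT.below_iff h] at a2
    refine ⟨a1, a2, ?_⟩
    rw [a3, sum_leaves hT.leafP h.le, sum_leaves hT.leafQ h.le, hT.leafM _ h, hT.leafQ _ h,
      Finset.sum_range_succ]
  · have := h3 x hx hx'
    rw [hT.below_iff (by omega)] at this
    omega

variable (w b c : ℕ → ℕ)

/-- Total weight of the values of `S` covering the gap `g`. -/
def load (S : Finset ℕ) (g : ℕ) : ℕ := ∑ v ∈ S with b v ≤ g ∧ g < c v, w v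

/-- Total weight of the values `v ∈ S` with `e v = g`. -/
def weightAt (e : ℕ → ℕ) (S : Finset ℕ) (g : ℕ) : ℕ := ∑ v ∈ S with e v = g, w v

/-- The tree in the arrays 10, 11, 12 represents the covering values `S`. -/
def CoverTree (N : ℕ) (S : Finset ℕ) (s : Store) : Prop :=
  MinTree (s.arr 10) (s.arr 11) (s.arr 12) N (weightAt w b S) (weightAt w c S) (weightAt w b S)

variable {w b c}

theorem sum_weightAt (e : ℕ → ℕ) (S : Finset ℕ) (x : ℕ) :
    ∑ g ∈ Finset.range x, weightAt w e S g = ∑ v ∈ S with e v < x, w v := by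
  unfold weightAt
  have := Finset.sum_fiberwise_of_maps_to (s := S.filter fun v => e v < x) (t := Finset.range x)
    (g := e) (f := w) (fun v hv => by simpa using (Finset.mem_filter.1 hv).2)
  rw [← this]
  refine Finset.sum_congr rfl fun g hg => Finset.sum_congr ?_ fun _ _ => rfl
  ext v
  simp only [Finset.mem_filter]
  have := Finset.mem_range.1 hg
  constructor
  · rintro ⟨h1, h2⟩
    exact ⟨⟨h1, by omega⟩, h2⟩
  · rintro ⟨⟨h1, -⟩, h2⟩
    exact ⟨h1, h2⟩

theorem sum_weightAt_le (e : ℕ → ℕ) {S : Finset ℕ} (x : ℕ) (h : ∑ v ∈ S, w v ≤ B) :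
    ∑ g ∈ Finset.range x, weightAt w e S g ≤ B := by
  rw [sum_weightAt]
  exact (Finset.sum_le_sum_of_subset (Finset.filter_subset _ _)).trans h

theorem weightAt_le (e : ℕ → ℕ) {S : Finset ℕ} (x : ℕ) (h : ∑ v ∈ S, w v ≤ B) :
    weightAt w e S x ≤ B :=
  (Finset.sum_le_sum_of_subset (Finset.filter_subset _ _)).trans h

/-- A value covers `g` if it has started but not ended by `g`. As `b v < c v`, every value that has
ended has also started, so starts equal covers plus ends. -/
theorem load_add {S : Finset ℕ} (hS : ∀ v ∈ S, b v < c v) (g : ℕ) :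
    load w b c S g + ∑ i ∈ Finset.range (g + 1), weightAt w c S i =
      ∑ i ∈ Finset.range g, weightAt w b S i + weightAt w b S g := by
  rw [← Finset.sum_range_succ, sum_weightAt, sum_weightAt]
  unfold load
  rw [← Finset.sum_union]
  · refine Finset.sum_congr ?_ fun _ _ => rfl
    ext v
    simp only [Finset.mem_union, Finset.mem_filter]
    constructor
    · rintro (⟨h1, h2⟩ | ⟨h1, h2⟩)
      · exact ⟨h1, by omega⟩
      · have := hS v h1
        exact ⟨h1, by omega⟩
    · rintro ⟨h1, h2⟩
      by_cases h3 : g < c v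
      · exact .inl ⟨h1, by omega, h3⟩
      · exact .inr ⟨h1, by omega⟩
  · rw [Finset.disjoint_left]
    intro v h1 h2
    simp only [Finset.mem_filter] at h1 h2
    omega

/-- Find the first gap `𝐯 9 ≥ 𝐯 7` with a load below `𝐯 8`; the load is `𝐯 10`. -/
theorem Run.findCover {L : ℕ} {s : Store} {H i t : ℕ} {S : Finset ℕ} (hT : CoverTree w b c N S s)
    (hS : ∀ v ∈ S, b v < c v) (hSB : ∑ v ∈ S, w v ≤ B) (hN : N = 2 ^ H) (hNW : 4 * N + 2 < W)
    (hBW : 8 * B < W) (ht : t ≤ B) (hi : i < N) (hLN : Nat.log 2 (2 * N) ≤ L)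
    (h22 : s.var 22 = N) (h7 : s.var 7 = i) (h8 : s.var 8 = t) :
    Run W I (L :: Ls) (StackMonitoring.findFrom 10 11 12) s (fun s' => s'.var 9 ≤ N ∧
      (s'.var 9 < N → i ≤ s'.var 9 ∧ load w b c S (s'.var 9) < t ∧
        s'.var 10 = load w b c S (s'.var 9)) ∧
      ∀ x, i ≤ x → x < s'.var 9 → t ≤ load w b c S x) := by
  refine (Run.findFrom hT (sum_weightAt_le b N hSB) (sum_weightAt_le c N hSB)
    (fun i _ => weightAt_le b i hSB) hN hNW hBW ht hLN h22 h7 h8 hi).mono ?_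
  rintro s' - ⟨h1, h2, h3⟩
  refine ⟨h1, fun h => ?_, fun x hx hx' => ?_⟩
  · obtain ⟨a1, a2, a3⟩ := h2 h
    have := load_add (w := w) hS (s'.var 9)
    exact ⟨a1, by omega, by omega⟩
  · have := load_add (w := w) hS x
    have := h3 x hx hx'
    omega

/-- Add (or subtract) the weight `𝐯 9` at the leaf `𝐯 7` for the start and `𝐯 8` for the end. -/
def coverUpd (o : BinOp) : Program :=
  (1 ≔ 𝐯 22 +ₑ 𝐯 7) ;;
  .put 10 (𝐯 1) (.bin o (.get 10 (𝐯 1)) (𝐯 9)) ;;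
  .put 12 (𝐯 1) (.bin o (.get 12 (𝐯 1)) (𝐯 9)) ;;
  climb (minStep 10 11 12) ;;
  (1 ≔ 𝐯 22 +ₑ 𝐯 8) ;;
  .put 11 (𝐯 1) (.bin o (.get 11 (𝐯 1)) (𝐯 9)) ;;
  climb (minStep 10 11 12)

theorem MinNode.congr {P Q M P' Q' M' : ℕ → ℕ} {i x : ℕ} (h : MinNode P Q M i)
    (hP : ∀ j, j ≠ x → P' j = P j) (hQ : ∀ j, j ≠ x → Q' j = Q j) (hM : ∀ j, j ≠ x → M' j = M j)
    (h1 : i ≠ x) (h2 : 2 * i ≠ x) (h3 : 2 * i + 1 ≠ x) : MinNode P' Q' M' i := by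
  unfold MinNode at *
  rw [hP _ h1, hQ _ h1, hM _ h1, hP _ h2, hQ _ h2, hM _ h2, hP _ h3, hQ _ h3, hM _ h3]
  exact h

/-- Serves insertion and deletion alike. The leaves for the start and for the end are repaired one
after the other, so in between the tree has the starts of `S'` and the ends of `S`. -/
theorem Run.coverUpd {L : ℕ} {s : Store} {H v : ℕ} {S S' : Finset ℕ} {o : BinOp}
    (hT : CoverTree w b c N S s)
    (ho : ∀ e : ℕ → ℕ, o.apply (weightAt w e S (e v)) (w v) = weightAt w e S' (e v))
    (ho' : ∀ (e : ℕ → ℕ) (x : ℕ), x ≠ e v → weightAt w e S' x = weightAt w e S x)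
    (hSB : ∑ v ∈ S, w v ≤ B) (hSB' : ∑ v ∈ S', w v ≤ B) (hN : N = 2 ^ H) (hNW : 4 * N + 2 < W)
    (hBW : 8 * B < W) (hLN : Nat.log 2 (2 * N) ≤ L) (hb : b v < N) (hc : c v < N)
    (h22 : s.var 22 = N) (h7 : s.var 7 = b v) (h8 : s.var 8 = c v) (h9 : s.var 9 = w v) :
    Run W I (L :: Ls) (coverUpd o) s (fun s' => CoverTree w b c N S' s') := by
  have hlt : ∀ (e : ℕ → ℕ) x, weightAt w e S' x % W = weightAt w e S' x := fun e x =>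
    Nat.mod_eq_of_lt (by have := weightAt_le (w := w) e x hSB'; omega)
  obtain ⟨hP, hQ, hM, hnode⟩ := hT
  unfold StackMonitoring.coverUpd
  refine Run.assign_seq (N + b v) (by simp (disch := omega) [Nat.mod_eq_of_lt, h22, h7]) ?_
  refine Run.put_seq (N + b v) (weightAt w b S' (b v)) (by simp) ?_ ?_
  · simp only [Expr.eval, Store.setVar_var, Store.setVar_arr]
    norm_num [-BinOp.apply]
    rw [hP _ hb, h9, ho, hlt]
  refine Run.put_seq (N + b v) (weightAt w b S' (b v)) (by simp) ?_ ?_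
  · simp only [Expr.eval, Store.setVar_var, Store.setVar_arr, Store.setArr_arr, Store.setArr_var]
    norm_num [-BinOp.apply]
    rw [hM _ hb, h9, ho, hlt]
  have key : ∀ e : ℕ → ℕ, ∀ i, (if i = e v then weightAt w e S' (e v) else weightAt w e S i) =
      weightAt w e S' i := by
    intro e i
    split_ifs with h
    · rw [h]
    · exact (ho' e i h).symm
  refine Run.seq (Run.minClimb (x := b v) (H := H) (N := N) (B := B) (f := weightAt w b S')
    (g := weightAt w c S) (μ := weightAt w b S') (by norm_num) (by norm_num) (by norm_num) hN hNW hLN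
    (by omega) hb (by simp) (sum_weightAt_le _ _ hSB') (sum_weightAt_le _ _ hSB)
    (fun i _ => weightAt_le _ _ hSB') ?_ ?_ ?_ ?_) ?_
  · intro i hi
    simp only [Store.setArr_arr_apply, Store.setVar_arr]
    norm_num [-BinOp.apply]
    rw [hP i hi, key]
  · intro i hi
    simp only [Store.setArr_arr_apply, Store.setVar_arr]
    norm_num [-BinOp.apply]
    rw [hQ i hi]
  · intro i hi
    simp only [Store.setArr_arr_apply, Store.setVar_arr]
    norm_num [-BinOp.apply]
    rw [hM i hi, key]
  · intro i h1 h2 h3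
    refine (hnode i h1 h2).congr (x := N + b v) ?_ ?_ ?_ (by omega) (by omega) (by omega)
    all_goals
      intro j hj
      simp [Store.setArr_arr_apply, hj]
  intro s1 hf1 hT1
  obtain ⟨hP, hQ, hM, hnode⟩ := hT1
  have g22 : s1.var 22 = N := by rw [hf1.var 22 rfl]; simp [h22]
  have g8 : s1.var 8 = c v := by rw [hf1.var 8 rfl]; simp [h8]
  have g9 : s1.var 9 = w v := by rw [hf1.var 9 rfl]; simp [h9]
  refine Run.assign_seq (N + c v) (by simp (disch := omega) [Nat.mod_eq_of_lt, g22, g8]) ?_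
  refine Run.put_seq (N + c v) (weightAt w c S' (c v)) (by simp) ?_ ?_
  · simp only [Expr.eval, Store.setVar_var, Store.setVar_arr]
    norm_num [-BinOp.apply]
    rw [hQ _ hc, g9, ho, hlt]
  refine Run.minClimb (x := c v) (H := H) (N := N) (B := B)
    (by norm_num) (by norm_num) (by norm_num) hN hNW hLN
    (by omega) hc (by simp) (sum_weightAt_le _ _ hSB') (sum_weightAt_le _ _ hSB')
    (fun i _ => weightAt_le _ _ hSB') ?_ ?_ ?_ ?_
  · intro i hi
    simp only [Store.setArr_arr_apply, Store.setVar_arr]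
    norm_num [-BinOp.apply]
    rw [hP i hi]
  · intro i hi
    simp only [Store.setArr_arr_apply, Store.setVar_arr]
    norm_num [-BinOp.apply]
    rw [hQ i hi, key]
  · intro i hi
    simp only [Store.setArr_arr_apply, Store.setVar_arr]
    norm_num [-BinOp.apply]
    rw [hM i hi]
  · intro i h1 h2 h3
    refine (hnode i h1 h2).congr (x := N + c v) ?_ ?_ ?_ (by omega) (by omega) (by omega)
    all_goals
      intro j hj
      simp [Store.setArr_arr_apply, hj]

theorem weightAt_insert (e : ℕ → ℕ) {S : Finset ℕ} {v : ℕ} (hv : v ∉ S) (x : ℕ) :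
    weightAt w e (insert v S) x = weightAt w e S x + if x = e v then w v else 0 := by
  unfold weightAt
  rw [Finset.filter_insert]
  by_cases h : e v = x
  · rw [if_pos h, if_pos h.symm, Finset.sum_insert (by simp [hv]), add_comm]
  · rw [if_neg h, if_neg fun h' => h h'.symm, add_zero]

theorem Run.coverInsert {L : ℕ} {s : Store} {H v : ℕ} {S : Finset ℕ}
    (hT : CoverTree w b c N S s) (hv : v ∉ S) (hSB' : ∑ v ∈ insert v S, w v ≤ B) (hN : N = 2 ^ H)
    (hNW : 4 * N + 2 < W) (hBW : 8 * B < W) (hLN : Nat.log 2 (2 * N) ≤ L) (hb : b v < N)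
    (hc : c v < N) (h22 : s.var 22 = N) (h7 : s.var 7 = b v) (h8 : s.var 8 = c v)
    (h9 : s.var 9 = w v) :
    Run W I (L :: Ls) (StackMonitoring.coverUpd .add) s
      (fun s' => CoverTree w b c N (insert v S) s') := by
  refine Run.coverUpd hT ?_ ?_ ?_ hSB' hN hNW hBW hLN hb hc h22 h7 h8 h9
  · intro e
    simp [weightAt_insert e hv]
  · intro e x hx
    simp [weightAt_insert e hv, hx]
  · rw [Finset.sum_insert hv] at hSB'
    omega

theorem Run.coverErase {L : ℕ} {s : Store} {H v : ℕ} {S : Finset ℕ}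
    (hT : CoverTree w b c N S s) (hv : v ∈ S) (hSB : ∑ v ∈ S, w v ≤ B) (hN : N = 2 ^ H)
    (hNW : 4 * N + 2 < W) (hBW : 8 * B < W) (hLN : Nat.log 2 (2 * N) ≤ L) (hb : b v < N)
    (hc : c v < N) (h22 : s.var 22 = N) (h7 : s.var 7 = b v) (h8 : s.var 8 = c v)
    (h9 : s.var 9 = w v) :
    Run W I (L :: Ls) (StackMonitoring.coverUpd .sub) s
      (fun s' => CoverTree w b c N (S.erase v) s') := by
  have e1 : insert v (S.erase v) = S := Finset.insert_erase hv
  have e2 := fun e x => weightAt_insert (w := w) e (Finset.notMem_erase v S) x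
  rw [e1] at e2
  refine Run.coverUpd hT ?_ ?_ hSB ?_ hN hNW hBW hLN hb hc h22 h7 h8 h9
  · intro e
    simp [e2]
  · intro e x hx
    simp [e2, hx]
  · exact (Finset.sum_le_sum_of_subset (Finset.erase_subset _ _)).trans hSB

/-- The tree in the arrays 13, 14, 15 holds the values `μ` at its leaves. -/
def StabTree (N : ℕ) (μ : ℕ → ℕ) (s : Store) : Prop :=
  MinTree (s.arr 13) (s.arr 14) (s.arr 15) N (fun _ => 0) (fun _ => 0) μ

/-- Set the leaf `𝐯 7` of the second tree to `𝐯 8`. -/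
def stabSet : Program :=
  (1 ≔ 𝐯 22 +ₑ 𝐯 7) ;; .put 15 (𝐯 1) (𝐯 8) ;; climb (minStep 13 14 15)

theorem Run.stabSet {L : ℕ} {s : Store} {H x t : ℕ} {μ : ℕ → ℕ} (hT : StabTree N μ s)
    (hμ : ∀ i < N, μ i ≤ B) (ht : t ≤ B) (hN : N = 2 ^ H) (hNW : 4 * N + 2 < W) (hBW : 8 * B < W)
    (hLN : Nat.log 2 (2 * N) ≤ L) (hx : x < N) (h22 : s.var 22 = N) (h7 : s.var 7 = x)
    (h8 : s.var 8 = t) :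
    Run W I (L :: Ls) StackMonitoring.stabSet s
      (fun s' => StabTree N (Function.update μ x t) s') := by
  obtain ⟨hP, hQ, hM, hnode⟩ := hT
  unfold StackMonitoring.stabSet
  refine Run.assign_seq (N + x) (by simp (disch := omega) [Nat.mod_eq_of_lt, h22, h7]) ?_
  refine Run.put_seq (N + x) t (by simp) (by simp [h8]) ?_
  refine Run.minClimb (x := x) (H := H) (N := N) (B := B)
    (by norm_num) (by norm_num) (by norm_num) hN hNW hLN
    (by omega) hx (by simp) (by simp) (by simp) ?_ ?_ ?_ ?_ ?_
  · intro i hi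
    rw [Function.update_apply]
    split_ifs
    · exact ht
    · exact hμ i hi
  · intro i hi
    simp [Store.setArr_arr_apply, hP i hi]
  · intro i hi
    simp [Store.setArr_arr_apply, hQ i hi]
  · intro i hi
    simp [Store.setArr_arr_apply, hM i hi, Function.update_apply]
  · intro i h1 h2 h3
    refine (hnode i h1 h2).congr (x := N + x) ?_ ?_ ?_ (by omega) (by omega) (by omega)
    all_goals
      intro j hj
      simp [Store.setArr_arr_apply, hj]

theorem Run.findStab {L : ℕ} {s : Store} {H i t : ℕ} {μ : ℕ → ℕ} (hT : StabTree N μ s)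
    (hμ : ∀ i < N, μ i ≤ B) (hN : N = 2 ^ H) (hNW : 4 * N + 2 < W)
    (hBW : 8 * B < W) (ht : t ≤ B) (hi : i < N) (hLN : Nat.log 2 (2 * N) ≤ L)
    (h22 : s.var 22 = N) (h7 : s.var 7 = i) (h8 : s.var 8 = t) :
    Run W I (L :: Ls) (StackMonitoring.findFrom 13 14 15) s (fun s' => s'.var 9 ≤ N ∧
      (s'.var 9 < N → i ≤ s'.var 9 ∧ μ (s'.var 9) < t) ∧
      ∀ x, i ≤ x → x < s'.var 9 → t ≤ μ x) := by
  refine (Run.findFrom (B := B) hT (by simp) (by simp) hμ hN hNW hBW ht hLN h22 h7 h8 hi).mono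
    ?_
  rintro s' - ⟨h1, h2, h3⟩
  refine ⟨h1, fun h => ?_, fun x hx hx' => ?_⟩
  · have := h2 h
    simp at this
    exact ⟨this.1, this.2.1⟩
  · simpa using h3 x hx hx'

end Trees

/-! ### Initialization and sorting of the input -/

/-- The variables 20, ..., 23 hold the numbers of operations and of time points, the number of
leaves of the trees, and the offset of the weights. -/
structure Sizes (n N : ℕ) (s : Store) : Prop where
  v20 : s.var 20 = n
  v21 : s.var 21 = 2 * n
  v22 : s.var 22 = N
  v23 : s.var 23 = n + 1

theorem Sizes.frame {n N : ℕ} {p : Program} {s s' : Store} (h : Sizes n N s) (hf : Frame p s s')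
    (h20 : p.writesVar 20 = false := by rfl) (h21 : p.writesVar 21 = false := by rfl)
    (h22 : p.writesVar 22 = false := by rfl) (h23 : p.writesVar 23 = false := by rfl) :
    Sizes n N s' :=
  ⟨(hf.var _ h20).trans h.v20, (hf.var _ h21).trans h.v21, (hf.var _ h22).trans h.v22,
    (hf.var _ h23).trans h.v23⟩

theorem Sizes.setVar {n N x v : ℕ} {s : Store} (h : Sizes n N s) (hx : x < 20 ∨ 23 < x) :
    Sizes n N (s.setVar x v) := by
  constructor
  · rw [Store.setVar_var, if_neg (by omega), h.v20]
  · rw [Store.setVar_var, if_neg (by omega), h.v21]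
  · rw [Store.setVar_var, if_neg (by omega), h.v22]
  · rw [Store.setVar_var, if_neg (by omega), h.v23]

theorem Sizes.setArr {n N a i v : ℕ} {s : Store} (h : Sizes n N s) :
    Sizes n N (s.setArr a i v) :=
  ⟨h.v20, h.v21, h.v22, h.v23⟩

def initProg : Program :=
  (20 ≔ 𝐯 0) ;; (21 ≔ 𝐯 0 +ₑ 𝐯 0) ;; (23 ≔ 𝐯 0 +ₑ 𝐜 1) ;; (22 ≔ 𝐜 1) ;;
    .loop (𝐯 22 <ₑ 𝐯 21 +ₑ 𝐜 1) (22 ≔ 𝐯 22 +ₑ 𝐯 22)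

/-- `N` is an admissible number of leaves for `n` operations. -/
structure LeafCount (n N : ℕ) : Prop where
  pow : ∃ H, N = 2 ^ H
  lt : 2 * n < N
  le : N ≤ 4 * n + 1

section Init

variable {W : ℕ} {I : Input} {Ls : List ℕ} {n B L : ℕ}

theorem Run.initProg (hW : 64 * (n + 2) ^ 2 ≤ W) (hB : 4 * n + 2 ≤ B) :
    Run W I (B :: Ls) initProg (initStore n)
      (fun s => (∃ N, LeafCount n N ∧ Sizes n N s) ∧ ∀ a, s.arr a = fun _ => 0) := by
  have hW' : 64 * n + 64 ≤ W := by nlinarith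
  refine Run.assign_seq n (by simp [initStore]) ?_
  refine Run.assign_seq (2 * n) ?_ ?_
  · have : n + n < W := by omega
    simp [initStore, two_mul, Nat.mod_eq_of_lt this]
  refine Run.assign_seq (n + 1) ?_ ?_
  · simp (disch := omega) [initStore, Nat.mod_eq_of_lt]
  refine Run.assign_seq 1 ?_ ?_
  · simp (disch := omega) [Nat.mod_eq_of_lt]
  -- Only numbers up to `2 * n` are doubled, so the result is at most `4 * n`, except for the
  -- initial value 1 when `n = 0`.
  refine (Run.loop (fun s => (∃ H, s.var 22 = 2 ^ H) ∧ s.var 22 ≤ 4 * n + 1)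
    (fun s => 4 * n + 2 - s.var 22) ⟨⟨0, by simp⟩, by simp⟩ (by simp; omega) ?_).mono ?_
  · rintro s' hf ⟨⟨H, h1⟩, h2⟩ hb
    have e21 : s'.var 21 = 2 * n := by rw [hf.var 21 rfl]; simp
    have h3 : s'.var 22 < 2 * n + 1 := by
      by_contra h
      simp (disch := omega) [Nat.mod_eq_of_lt, e21, h] at hb
    have h4 : 0 < s'.var 22 := by rw [h1]; positivity
    refine Run.assign (v := 2 * s'.var 22) ?_ ?_
    · have : s'.var 22 + s'.var 22 < W := by omega
      simp [Nat.mod_eq_of_lt this, two_mul]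
    · simp only [Store.setVar_var, if_true]
      refine ⟨⟨⟨H + 1, by rw [h1, pow_succ']⟩, by omega⟩, by omega⟩
  · rintro s' hf ⟨⟨h1, h2⟩, hb⟩
    have e21 : s'.var 21 = 2 * n := by rw [hf.var 21 rfl]; simp
    refine ⟨⟨s'.var 22, ⟨h1, ?_, h2⟩, ?_, e21, rfl, ?_⟩, fun a => ?_⟩
    · by_contra h
      have h3 : s'.var 22 < 2 * n + 1 := by omega
      simp (disch := omega) [Nat.mod_eq_of_lt, e21, h3] at hb
    · rw [hf.var 20 rfl]; simp
    · rw [hf.var 23 rfl]; simp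
    · rw [hf.arr a rfl]; rfl

end Init

/-! ### The sort keys of time points and operations, and the comparisons that implement them. -/

section Keys

theorem History.time_eq {P V : Type*} {H : History P V} {e : ℕ} (he : e < 2 * H.size) :
    ∃ t : ℚ≥0, H.time e = some t := by
  have : e / 2 < H.size := by omega
  simp [History.time, this]


variable {P V : Type*} [LinearOrder V] (H : History P V)

/-- Time points are sorted by time, responses before invocations. -/
def History.timeKey (e : ℕ) : WithBot ℚ≥0 ×ₗ ℕ := toLex (H.time e, 1 - e % 2)

/-- Operations are sorted by value, pushes first. -/
def History.valKey (i : ℕ) : WithBot V ×ₗ ℕ :=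
  toLex (H.val i, if H.input.method i = 0 then 0 else 1)

/-- The product handles ties: `𝐯 5` is not later, has an odd number and so is a response, and `𝐯 4`
has an even number and so is an invocation. -/
def timeLess : Expr :=
  .timeLt (𝐯 5) (𝐯 4) +ₑ (.timeLt (𝐯 4) (𝐯 5) =ₑ 𝐜 0) *ₑ (𝐯 5 -ₑ 𝐜 2 *ₑ (𝐯 5 /ₑ 𝐜 2)) *ₑ
    (𝐯 4 -ₑ 𝐜 2 *ₑ (𝐯 4 /ₑ 𝐜 2) =ₑ 𝐜 0)

/-- The product handles ties: the value of `𝐯 5` is not larger, `𝐯 5` is a push and `𝐯 4` is not. -/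
def valLess : Expr :=
  .valLt (𝐯 5) (𝐯 4) +ₑ (.valLt (𝐯 4) (𝐯 5) =ₑ 𝐜 0) *ₑ (.method (𝐯 5) =ₑ 𝐜 0) *ₑ
    (𝐜 0 <ₑ .method (𝐯 4))

variable {H}

theorem History.val_eq {i : ℕ} (hi : i < H.size) (hk : H.input.method i < 3) :
    ∃ v, H.val i = some v := by
  rw [show H.input.method i = (H.opr ⟨i, hi⟩).op.code from H.method_eq ⟨i, hi⟩] at hk
  unfold History.val
  rw [dif_pos hi]
  revert hk
  cases (H.opr ⟨i, hi⟩).op <;> simp [StackOp.code, StackOp.value]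

theorem compares_timeLess {W : ℕ} (hW : 8 * H.size + 8 < W) :
    Compares W H.input H.timeKey (Finset.range (2 * H.size)) timeLess := by
  intro s h4 h5
  have h4' := Finset.mem_range.1 h4
  have h5' := Finset.mem_range.1 h5
  obtain ⟨t4, e4⟩ := History.time_eq h4'
  obtain ⟨t5, e5⟩ := History.time_eq h5'
  have o1 : optLt (H.time (s.var 5)) (H.time (s.var 4)) = decide (t5 < t4) := by
    rw [e4, e5]; rfl
  have o2 : optLt (H.time (s.var 4)) (H.time (s.var 5)) = decide (t4 < t5) := by
    rw [e4, e5]; rfl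
  have k4 : H.timeKey (s.var 4) = toLex ((t4 : WithBot ℚ≥0), 1 - s.var 4 % 2) := by
    unfold History.timeKey; rw [e4]; rfl
  have k5 : H.timeKey (s.var 5) = toLex ((t5 : WithBot ℚ≥0), 1 - s.var 5 % 2) := by
    unfold History.timeKey; rw [e5]; rfl
  rw [k4, k5, Prod.Lex.toLex_lt_toLex]
  have p4 : (s.var 4 - 2 * (s.var 4 / 2)) = s.var 4 % 2 := by omega
  have p5 : (s.var 5 - 2 * (s.var 5 / 2)) = s.var 5 % 2 := by omega
  have q4 : (2 * (s.var 4 / 2)) % W = 2 * (s.var 4 / 2) := Nat.mod_eq_of_lt (by omega)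
  have q5 : (2 * (s.var 5 / 2)) % W = 2 * (s.var 5 / 2) := Nat.mod_eq_of_lt (by omega)
  have r4 : (s.var 4 / 2) % W = s.var 4 / 2 := Nat.mod_eq_of_lt (by omega)
  have r5 : (s.var 5 / 2) % W = s.var 5 / 2 := Nat.mod_eq_of_lt (by omega)
  simp only [timeLess, Expr.eval, History.input, o1, o2, BinOp.apply,
    Nat.mod_eq_of_lt (show 2 < W by omega), Nat.mod_eq_of_lt (show 0 < W by omega), r4, r5, q4, q5,
    p4, p5, WithBot.coe_lt_coe, WithBot.coe_inj]
  have w1 : 1 % W = 1 := Nat.mod_eq_of_lt (by omega)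
  have w2 : 2 % W = 2 := Nat.mod_eq_of_lt (by omega)
  rcases Nat.mod_two_eq_zero_or_one (s.var 4) with a4 | a4 <;>
  rcases Nat.mod_two_eq_zero_or_one (s.var 5) with a5 | a5 <;>
  rcases lt_trichotomy t4 t5 with h | rfl | h
  all_goals first
    | simp [a4, a5, w1]; done
    | simp [a4, a5, w1, w2, h, h.ne', h.not_gt]

theorem compares_valLess {W : ℕ} (hW : 8 * H.size + 8 < W) :
    Compares W H.input H.valKey ((Finset.range H.size).filter fun i => H.input.method i < 3)
      valLess := by
  intro s h4 h5
  simp only [Finset.mem_filter, Finset.mem_range] at h4 h5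
  obtain ⟨t4, e4⟩ := History.val_eq h4.1 h4.2
  obtain ⟨t5, e5⟩ := History.val_eq h5.1 h5.2
  have o1 : H.input.valLt (s.var 5) (s.var 4) = decide (t5 < t4) := by
    show optLt _ _ = _
    rw [e4, e5]; rfl
  have o2 : H.input.valLt (s.var 4) (s.var 5) = decide (t4 < t5) := by
    show optLt _ _ = _
    rw [e4, e5]; rfl
  have k4 : H.valKey (s.var 4) =
      toLex ((t4 : WithBot V), if H.input.method (s.var 4) = 0 then 0 else 1) := by
    unfold History.valKey; rw [e4]; rfl
  have k5 : H.valKey (s.var 5) =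
      toLex ((t5 : WithBot V), if H.input.method (s.var 5) = 0 then 0 else 1) := by
    unfold History.valKey; rw [e5]; rfl
  rw [k4, k5, Prod.Lex.toLex_lt_toLex]
  have m4 : H.input.method (s.var 4) % W = H.input.method (s.var 4) := Nat.mod_eq_of_lt (by omega)
  have m5 : H.input.method (s.var 5) % W = H.input.method (s.var 5) := Nat.mod_eq_of_lt (by omega)
  simp only [valLess, Expr.eval, o1, o2, BinOp.apply,
    Nat.mod_eq_of_lt (show 0 < W by omega), m4, m5, WithBot.coe_lt_coe, WithBot.coe_inj]
  have w4 : 0 < H.input.method (s.var 4) ↔ H.input.method (s.var 4) ≠ 0 := Nat.pos_iff_ne_zero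
  have w1 : 1 % W = 1 := Nat.mod_eq_of_lt (by omega)
  have w2 : 2 % W = 2 := Nat.mod_eq_of_lt (by omega)
  by_cases a4 : H.input.method (s.var 4) = 0 <;>
  by_cases a5 : H.input.method (s.var 5) = 0 <;>
  rcases lt_trichotomy t4 t5 with h | rfl | h
  all_goals first
    | simp [a4, a5, w4, w1]; done
    | simp [a4, a5, w4, w1, w2, h, h.ne', h.not_gt]

end Keys

/-! ### Positions of the time points and owners of the operations -/

section Order

variable {P V : Type*} [LinearOrder V] {H : History P V}

/-- `own i` is the push of the value of `i`. -/
def History.Owner (H : History P V) (own : ℕ → ℕ) : Prop :=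
  ∀ i < H.size, H.input.method i < 3 → own i < H.size ∧ H.input.method (own i) = 0 ∧
    H.val (own i) = H.val i ∧
    ∀ j < H.size, H.input.method j = 0 → H.val j = H.val i → j = own i

theorem History.Unambiguous.exists_owner (hU : H.Unambiguous) : ∃ own, H.Owner own := by
  have key : ∀ i, ∃ p, i < H.size → H.input.method i < 3 → p < H.size ∧ H.input.method p = 0 ∧
      H.val p = H.val i ∧ ∀ j < H.size, H.input.method j = 0 → H.val j = H.val i → j = p := by
    intro i
    by_cases h : i < H.size ∧ H.input.method i < 3
    · obtain ⟨v, hv⟩ := H.val_eq h.1 h.2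
      have hv' := hv
      unfold History.val at hv'
      rw [dif_pos h.1] at hv'
      obtain ⟨p, hp, hpu⟩ := (hU v ⟨_, hv'⟩).1
      have hval : ∀ (j : ℕ) (hj : j < H.size), H.input.method j = 0 → H.val j = some v →
          (H.opr ⟨j, hj⟩).op = .push v := by
        intro j hj hk hjv
        rw [show H.input.method j = _ from H.method_eq ⟨j, hj⟩, StackOp.code_eq_zero] at hk
        obtain ⟨w, hw⟩ := hk
        unfold History.val at hjv
        rw [dif_pos hj, hw] at hjv
        rw [hw]
        simpa [StackOp.value] using hjv
      refine ⟨p, fun _ _ => ⟨p.2, ?_, ?_, fun j hj hk hjv => ?_⟩⟩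
      · rw [H.method_eq p, StackOp.code_eq_zero]
        exact ⟨v, hp⟩
      · rw [hv]
        simp [History.val, hp, StackOp.value]
      · exact congrArg Fin.val (hpu ⟨j, hj⟩ (hval j hj hk (hjv.trans hv)))
    · exact ⟨0, fun h1 h2 => absurd ⟨h1, h2⟩ h⟩
  choose own h using key
  exact ⟨own, h⟩

/-- Positions of invocations and responses. -/
structure History.TimePos (H : History P V) (pI pR : ℕ → ℕ) : Prop where
  pI_lt : ∀ i < H.size, pI i < pR i
  pR_lt : ∀ i < H.size, pR i < 2 * H.size
  pI_inj : ∀ i < H.size, ∀ j < H.size, pI i = pI j → i = j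
  pR_ne_pI : ∀ i < H.size, ∀ j < H.size, pR i ≠ pI j
  pos : ∀ i j : Fin H.size, (H.opr i).res ≤ (H.opr j).inv ↔ pR i < pI j

theorem Sorted.lt_of_key_lt {α : Type*} [LinearOrder α] {key : ℕ → α} {A : Finset ℕ}
    {ord rk : ℕ → ℕ} (h : Sorted key A ord rk) {x y : ℕ} (hx : x ∈ A) (hy : y ∈ A)
    (hxy : key x < key y) : rk x < rk y := by
  by_contra hle
  have hne : rk x ≠ rk y := by
    intro he
    have : x = y := by rw [← (h.rank x hx).2, ← (h.rank y hy).2, he]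
    exact absurd hxy (this ▸ lt_irrefl _)
  have := h.sorted (rk y) (rk x) (by omega) (h.rank x hx).1
  rw [(h.rank x hx).2, (h.rank y hy).2] at this
  exact absurd hxy (not_lt.2 this)

/-- Linearization points lie strictly inside the intervals, so a response simultaneous with an
invocation already forces the order. Ranking responses first among equal times turns `res ≤ inv`
into a strict inequality of ranks. -/
theorem Sorted.timePos {P V : Type*} {H : History P V} {ord rk : ℕ → ℕ}
    (h : Sorted H.timeKey (Finset.range (2 * H.size)) ord rk) :
    H.TimePos (fun i => rk (2 * i)) (fun i => rk (2 * i + 1)) := by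
  have hmem : ∀ x < 2 * H.size, x ∈ Finset.range (2 * H.size) := fun x hx => by simpa using hx
  have hinj : ∀ x < 2 * H.size, ∀ y < 2 * H.size, rk x = rk y → x = y := by
    intro x hx y hy he
    rw [← (h.rank x (hmem x hx)).2, ← (h.rank y (hmem y hy)).2, he]
  have hI : ∀ i : Fin H.size, H.timeKey (2 * i) = toLex (((H.opr i).inv : WithBot ℚ≥0), 1) := by
    intro i
    have h1 : 2 * (i : ℕ) / 2 = i := by omega
    unfold History.timeKey History.time
    simp only [h1, i.2, dif_pos, Nat.mul_mod_right, if_true]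
    rfl
  have hR : ∀ i : Fin H.size, H.timeKey (2 * i + 1) =
      toLex (((H.opr i).res : WithBot ℚ≥0), 0) := by
    intro i
    have h1 : (2 * (i : ℕ) + 1) / 2 = i := by omega
    have h2 : (2 * (i : ℕ) + 1) % 2 = 1 := by omega
    unfold History.timeKey History.time
    simp only [h1, h2, i.2, dif_pos]
    rfl
  refine ⟨fun i hi => ?_, fun i hi => ?_, fun i hi j hj he => ?_, fun i hi j hj he => ?_,
    fun i j => ?_⟩
  · refine h.lt_of_key_lt (hmem _ (by omega)) (hmem _ (by omega)) ?_
    have h1 := hI ⟨i, hi⟩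
    have h2 := hR ⟨i, hi⟩
    simp only at h1 h2
    rw [h1, h2, Prod.Lex.toLex_lt_toLex]
    exact .inl (WithBot.coe_lt_coe.2 (H.opr ⟨i, hi⟩).inv_lt_res)
  · have := (h.rank (2 * i + 1) (hmem _ (by omega))).1
    simpa using this
  · have := hinj _ (by omega) _ (by omega) he
    omega
  · have := hinj _ (by omega) _ (by omega) he
    omega
  · have hi := i.2
    have hj := j.2
    constructor
    · intro hle
      refine h.lt_of_key_lt (hmem _ (by omega)) (hmem _ (by omega)) ?_
      rw [hI, hR, Prod.Lex.toLex_lt_toLex]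
      rcases hle.lt_or_eq with hlt | he
      · exact .inl (WithBot.coe_lt_coe.2 hlt)
      · exact .inr ⟨congrArg (fun x : ℚ≥0 => (x : WithBot ℚ≥0)) he, Nat.zero_lt_one⟩
    · intro hlt
      by_contra hgt
      have := h.lt_of_key_lt (hmem (2 * j) (by omega)) (hmem (2 * i + 1) (by omega)) (by
        rw [hI, hR, Prod.Lex.toLex_lt_toLex]
        exact .inl (WithBot.coe_lt_coe.2 (not_le.1 hgt)))
      omega

/-- The list `ord` consists of groups of operations of the same value, the push coming first. -/
structure Grouped (kd own ord : ℕ → ℕ) (m : ℕ) : Prop where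
  push : ∀ j < m, kd (ord j) = 0 → own (ord j) = ord j ∧ ∀ i < j, own (ord i) ≠ ord j
  step : ∀ j < m, kd (ord j) ≠ 0 → 0 < j ∧ own (ord (j - 1)) = own (ord j)

/-- Equal values are adjacent in the sorted list and the unique push leads its group, so a single
scan that remembers the last push knows the owner of each operation. -/
theorem Sorted.grouped {own ord rk : ℕ → ℕ} {A : Finset ℕ}
    (hA : A = (Finset.range H.size).filter fun i => H.input.method i < 3)
    (h : Sorted H.valKey A ord rk) (hown : H.Owner own) :
    Grouped H.input.method own ord A.card := by
  have hmem : ∀ k < A.card, ord k < H.size ∧ H.input.method (ord k) < 3 := by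
    intro k hk
    have := (h.mem k hk).1
    rw [hA] at this
    simpa using this
  refine ⟨fun j hj h0 => ⟨?_, fun i hij he => ?_⟩, fun j hj h0 => ?_⟩
  · exact ((hown _ (hmem j hj).1 (hmem j hj).2).2.2.2 _ (hmem j hj).1 h0 rfl).symm
  · obtain ⟨o1, o2, o3, o4⟩ := hown _ (hmem i (hij.trans hj)).1 (hmem i (hij.trans hj)).2
    have hle := h.sorted i j hij hj
    rw [he] at o3
    unfold History.valKey at hle
    rw [Prod.Lex.toLex_le_toLex, o3, if_pos h0] at hle
    have hki : H.input.method (ord i) = 0 := by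
      by_contra hne
      simp [hne] at hle
      exact lt_irrefl (α := WithBot V) _ hle
    have := o4 (ord i) (hmem i (hij.trans hj)).1 hki rfl
    have h1 := (h.mem i (hij.trans hj)).2
    have h2 := (h.mem j hj).2
    rw [this, he, h2] at h1
    omega
  · obtain ⟨o1, o2, o3, o4⟩ := hown _ (hmem j hj).1 (hmem j hj).2
    have hp : own (ord j) ∈ A := by
      rw [hA]
      simp [o1, o2]
    have hlt : rk (own (ord j)) < rk (ord j) := by
      refine h.lt_of_key_lt hp (h.mem j hj).1 ?_
      unfold History.valKey
      rw [Prod.Lex.toLex_lt_toLex, o3, if_pos o2, if_neg h0]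
      exact .inr ⟨rfl, Nat.zero_lt_one⟩
    rw [(h.mem j hj).2] at hlt
    refine ⟨by omega, ?_⟩
    obtain ⟨q1, q2, q3, q4⟩ := hown _ (hmem (j - 1) (by omega)).1 (hmem (j - 1) (by omega)).2
    -- The entry before `ord j` is squeezed between the push of the value of `ord j` and `ord j`
    -- itself, so it has the same value.
    have hle1 : H.valKey (own (ord j)) ≤ H.valKey (ord (j - 1)) := by
      rcases Nat.lt_or_ge (rk (own (ord j))) (j - 1) with hl | hl
      · have := h.sorted _ _ hl (by omega)
        rwa [(h.rank _ hp).2] at this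
      · rw [show j - 1 = rk (own (ord j)) by omega, (h.rank _ hp).2]
    have hle2 := h.sorted (j - 1) j (by omega) hj
    have hv : H.val (ord (j - 1)) = H.val (ord j) := by
      have m1 := Prod.Lex.monotone_fst _ _ hle1
      have m2 := Prod.Lex.monotone_fst _ _ hle2
      exact le_antisymm (α := WithBot V) m2 (o3 ▸ m1)
    exact o4 _ q1 q2 (q3.trans hv)

end Order

/-! ### Collecting the operations of a value -/

/-- Data of the values of the first `k` operations in the list `ord`: the values occupy the
segments from `st` to `en`, `b` is the first response, `c` the last invocation, and `hp` tells
whether there is a pop. -/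
structure Collected (kd own pI pR ord : ℕ → ℕ) (k : ℕ) (st en b c hp : ℕ → ℕ) : Prop where
  seg : ∀ j < k, st (own (ord j)) ≤ j ∧ j < en (own (ord j)) ∧ en (own (ord j)) ≤ k
  own_eq : ∀ j < k, ∀ i, st (own (ord j)) ≤ i → i < en (own (ord j)) → own (ord i) = own (ord j)
  b_le : ∀ j < k, b (own (ord j)) ≤ pR (ord j)
  b_mem : ∀ j < k, ∃ i < k, own (ord i) = own (ord j) ∧ b (own (ord j)) = pR (ord i)
  c_le : ∀ j < k, pI (ord j) ≤ c (own (ord j))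
  c_mem : ∀ j < k, ∃ i < k, own (ord i) = own (ord j) ∧ c (own (ord j)) = pI (ord i)
  hp_iff : ∀ v, hp v ≠ 0 ↔ ∃ j < k, kd (ord j) = 1 ∧ own (ord j) = v
  hp_le : ∀ v, hp v ≤ k

section Collect

variable {kd own pI pR ord : ℕ → ℕ} {k : ℕ} {st en b c hp : ℕ → ℕ}

theorem Collected.push (h : Collected kd own pI pR ord k st en b c hp) {o : ℕ} (ho : ord k = o)
    (hk : kd o = 0) (hown : own o = o) (hf : ∀ i < k, own (ord i) ≠ o) :
    Collected kd own pI pR ord (k + 1) (Function.update st o k) (Function.update en o (k + 1))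
      (Function.update b o (pR o)) (Function.update c o (pI o)) hp := by
  constructor
  case hp_iff =>
    intro v
    rw [h.hp_iff]
    constructor
    · rintro ⟨j, h1, h2⟩
      exact ⟨j, by omega, h2⟩
    · rintro ⟨j, h1, h2, h3⟩
      refine ⟨j, ?_, h2, h3⟩
      have : j ≠ k := by rintro rfl; rw [ho] at h2; omega
      omega
  case hp_le => exact fun v => (h.hp_le v).trans (by omega)
  all_goals
    intro j hj
    rcases Nat.lt_succ_iff_lt_or_eq.1 hj with hj' | rfl
    · simp only [Function.update_of_ne (hf j hj')]
      first
        | exact h.own_eq j hj'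
        | exact h.b_le j hj'
        | exact h.c_le j hj'
        | (obtain ⟨i, h1, h2⟩ := h.b_mem j hj'; exact ⟨i, by omega, h2⟩)
        | (obtain ⟨i, h1, h2⟩ := h.c_mem j hj'; exact ⟨i, by omega, h2⟩)
        | (obtain ⟨h1, h2, h3⟩ := h.seg j hj'; exact ⟨h1, h2, by omega⟩)
    · simp only [ho, hown, Function.update_self]
      first
        | exact le_rfl
        | exact ⟨j, by omega, by rw [ho, hown], by rw [ho]⟩
        | omega
        | (intro i h1 h2; rw [show i = j by omega, ho, hown])

/-- With truncated subtraction, `b - (b - x)` is the minimum and `c + (x - c)` the maximum, which is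
how the program updates the earliest response and the latest invocation. -/
theorem Collected.same (h : Collected kd own pI pR ord k st en b c hp) {o v : ℕ} (ho : ord k = o)
    (hown : own o = v) (hk0 : 0 < k) (hprev : own (ord (k - 1)) = v) (hen : en v = k) :
    Collected kd own pI pR ord (k + 1) st (Function.update en v (k + 1))
      (Function.update b v (b v - (b v - pR o))) (Function.update c v (c v + (pI o - c v)))
      (Function.update hp v (hp v + if kd o = 1 then 1 else 0)) := by
  have key : ∀ j < k + 1, ∃ i < k, own (ord i) = own (ord j) := by
    intro j hj
    rcases Nat.lt_succ_iff_lt_or_eq.1 hj with hj' | rfl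
    · exact ⟨j, hj', rfl⟩
    · exact ⟨j - 1, by omega, by rw [hprev, ho, hown]⟩
  have hs := h.seg (k - 1) (by omega)
  have he := h.own_eq (k - 1) (by omega)
  rw [hprev] at hs he
  constructor
  case hp_iff =>
    intro u
    by_cases hu : u = v
    · subst hu
      rw [Function.update_self]
      constructor
      · intro hne
        by_cases h1 : kd o = 1
        · exact ⟨k, by omega, by rw [ho, h1], by rw [ho, hown]⟩
        · rw [if_neg h1, add_zero, h.hp_iff] at hne
          obtain ⟨j, h2, h3⟩ := hne
          exact ⟨j, by omega, h3⟩
      · rintro ⟨j, h1, h2, h3⟩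
        rcases Nat.lt_succ_iff_lt_or_eq.1 h1 with hj' | rfl
        · have := (h.hp_iff u).2 ⟨j, hj', h2, h3⟩
          omega
        · rw [ho] at h2
          simp [h2]
    · rw [Function.update_of_ne hu, h.hp_iff]
      constructor
      · rintro ⟨j, h1, h2⟩
        exact ⟨j, by omega, h2⟩
      · rintro ⟨j, h1, h2, h3⟩
        refine ⟨j, ?_, h2, h3⟩
        have : j ≠ k := by rintro rfl; rw [ho, hown] at h3; exact hu h3.symm
        omega
  case hp_le =>
    intro u
    rw [Function.update_apply]
    have h1 := h.hp_le u
    have h2 := h.hp_le v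
    split_ifs <;> omega
  case seg =>
    intro j hj
    by_cases hv : own (ord j) = v
    · rw [hv, Function.update_self]
      refine ⟨?_, by omega, by omega⟩
      rcases Nat.lt_succ_iff_lt_or_eq.1 hj with hj' | rfl
      · have := h.seg j hj'
        rw [hv] at this
        omega
      · omega
    · have hj' : j < k := by
        have : j ≠ k := by rintro rfl; exact hv (by rw [ho, hown])
        omega
      rw [Function.update_of_ne hv]
      have := h.seg j hj'
      omega
  case own_eq =>
    intro j hj i h1 h2
    by_cases hv : own (ord j) = v
    · rw [hv] at h1 h2 ⊢
      rw [Function.update_self] at h2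
      rcases Nat.lt_succ_iff_lt_or_eq.1 h2 with hj' | rfl
      · exact he i h1 (by omega)
      · rw [ho, hown]
    · have hj' : j < k := by
        have : j ≠ k := by rintro rfl; exact hv (by rw [ho, hown])
        omega
      rw [Function.update_of_ne hv] at h2
      exact h.own_eq j hj' i h1 h2
  case b_le =>
    intro j hj
    rw [Function.update_apply]
    rcases Nat.lt_succ_iff_lt_or_eq.1 hj with hj' | rfl
    · have := h.b_le j hj'
      split_ifs with hv
      · rw [hv] at this
        omega
      · exact this
    · rw [ho, hown, if_pos rfl]
      omega
  case c_le =>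
    intro j hj
    rw [Function.update_apply]
    rcases Nat.lt_succ_iff_lt_or_eq.1 hj with hj' | rfl
    · have := h.c_le j hj'
      split_ifs with hv
      · rw [hv] at this
        omega
      · exact this
    · rw [ho, hown, if_pos rfl]
      omega
  case b_mem =>
    intro j hj
    obtain ⟨j', hj', hjj⟩ := key j hj
    obtain ⟨i, h1, h2, h3⟩ := h.b_mem j' hj'
    rw [hjj] at h2 h3
    rw [Function.update_apply]
    split_ifs with hv
    · rw [hv] at h2 h3 ⊢
      rcases Nat.le_total (b v) (pR o) with hle | hle
      · exact ⟨i, by omega, h2, by omega⟩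
      · exact ⟨k, by omega, by rw [ho, hown], by rw [ho]; omega⟩
    · exact ⟨i, by omega, h2, h3⟩
  case c_mem =>
    intro j hj
    obtain ⟨j', hj', hjj⟩ := key j hj
    obtain ⟨i, h1, h2, h3⟩ := h.c_mem j' hj'
    rw [hjj] at h2 h3
    rw [Function.update_apply]
    split_ifs with hv
    · rw [hv] at h2 h3 ⊢
      rcases Nat.le_total (pI o) (c v) with hle | hle
      · exact ⟨i, by omega, h2, by omega⟩
      · exact ⟨k, by omega, by rw [ho, hown], by rw [ho]; omega⟩
    · exact ⟨i, by omega, h2, h3⟩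

end Collect

/-- Collect the data of the values from the sorted list of operations. -/
def collectProg : Program :=
  (30 ≔ 𝐜 0) ;; .loop (𝐯 30 <ₑ 𝐯 25)
    ((2 ≔ .get 3 (𝐯 30)) ;; (3 ≔ .get 1 (𝐜 2 *ₑ 𝐯 2)) ;; (4 ≔ .get 1 (𝐜 2 *ₑ 𝐯 2 +ₑ 𝐜 1)) ;;
      .ite (.method (𝐯 2) =ₑ 𝐜 0)
        ((31 ≔ 𝐯 2) ;; .put 5 (𝐯 2) (𝐯 30) ;; .put 7 (𝐯 2) (𝐯 4) ;; .put 8 (𝐯 2) (𝐯 3))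
        (.put 7 (𝐯 31) (.get 7 (𝐯 31) -ₑ (.get 7 (𝐯 31) -ₑ 𝐯 4)) ;;
          .put 8 (𝐯 31) (.get 8 (𝐯 31) +ₑ (𝐯 3 -ₑ .get 8 (𝐯 31))) ;;
          .put 9 (𝐯 31) (.get 9 (𝐯 31) +ₑ (.method (𝐯 2) =ₑ 𝐜 1))) ;;
      .put 6 (𝐯 31) (𝐯 30 +ₑ 𝐜 1) ;; (30 ≔ 𝐯 30 +ₑ 𝐜 1))

/-- Values without a pop are never removed. -/
def fixProg : Program :=
  (30 ≔ 𝐜 0) ;; .loop (𝐯 30 <ₑ 𝐯 20)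
    (.ite (.get 9 (𝐯 30) =ₑ 𝐜 0) (.put 8 (𝐯 30) (𝐯 21)) .skip ;; (30 ≔ 𝐯 30 +ₑ 𝐜 1))

section Collect

variable {W : ℕ} {I : Input} {Ls : List ℕ} {n B m : ℕ} {own pI pR ord : ℕ → ℕ}

theorem Run.collectProg {s : Store} (hG : Grouped I.method own ord m)
    (hord : ∀ k < m, ord k < n ∧ I.method (ord k) < 3) (hm : m ≤ n)
    (hI : ∀ i < n, pI i < 2 * n) (hR : ∀ i < n, pR i < 2 * n) (hW : 8 * n + 8 < W) (hB : n ≤ B)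
    (h25 : s.var 25 = m) (h1 : ∀ i, s.arr 1 (2 * i) = pI i) (h1' : ∀ i, s.arr 1 (2 * i + 1) = pR i)
    (h3 : s.arr 3 = ord) (h9 : ∀ i, s.arr 9 i = 0) :
    Run W I (B :: Ls) collectProg s (fun s' => Collected I.method own pI pR ord m (s'.arr 5)
      (s'.arr 6) (s'.arr 7) (s'.arr 8) (s'.arr 9)) := by
  refine Run.assign_seq 0 (by simp) ?_
  refine (Run.forLoop (fun k s' => Collected I.method own pI pR ord k (s'.arr 5)
      (s'.arr 6) (s'.arr 7) (s'.arr 8) (s'.arr 9) ∧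
      (0 < k → s'.var 31 = own (ord (k - 1)) ∧ s'.arr 6 (s'.var 31) = k)) m 30 (by simp) ?_
      (by omega) ?_ ?_).mono (fun s' _ h => h.1)
  · simp only [Store.setVar_var, Store.setVar_arr, if_true]
    refine ⟨⟨?_, ?_, ?_, ?_, ?_, ?_, ?_, ?_⟩, by omega⟩
    · intro j hj; omega
    · intro j hj; omega
    · intro j hj; omega
    · intro j hj; omega
    · intro j hj; omega
    · intro j hj; omega
    · simp [h9]
    · simp [h9]
  · intro s' hf
    have e1 : s'.var 25 = m := by rw [hf.var 25 rfl]; simp [h25]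
    simp [e1, ite_one_zero_mod (show 1 < W by omega)]
  · rintro s' hf hlt ⟨hC, hcur⟩
    have e3 : s'.arr 3 = ord := by rw [hf.arr 3 rfl]; simpa using h3
    have e1 : s'.arr 1 = s.arr 1 := by rw [hf.arr 1 rfl]; simp
    generalize hk : s'.var 30 = k at *
    obtain ⟨ho, hoK⟩ := hord k hlt
    generalize hoo : ord k = o at *
    have mo : I.method o % W = I.method o := Nat.mod_eq_of_lt (by omega)
    have hIo := hI o ho
    have hRo := hR o ho
    refine Run.assign_seq o (by simp [e3, hk, hoo]) ?_
    refine Run.assign_seq (pI o) (by simp (disch := omega) [Nat.mod_eq_of_lt, e1, h1]) ?_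
    refine Run.assign_seq (pR o) (by simp (disch := omega) [Nat.mod_eq_of_lt, e1, h1']) ?_
    -- Both branches share the later write to the end of the segment, so the intermediate assertion
    -- anticipates it with an updated array.
    refine Run.seq (R := fun s'' => s''.var 31 = own o ∧ Collected I.method own pI pR ord (k + 1)
      (s''.arr 5) (Function.update (s''.arr 6) (s''.var 31) (k + 1)) (s''.arr 7) (s''.arr 8)
      (s''.arr 9)) ?_ ?_
    · refine Run.ite (fun c => ?_) (fun c => ?_)
      · have hk0 : I.method o = 0 := by
          by_contra h
          simp [h, mo] at c
        obtain ⟨g1, g2⟩ := hG.push k hlt (by rw [hoo, hk0])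
        rw [hoo] at g1 g2
        refine Run.assign_seq o (by simp) ?_
        refine Run.put_seq o k (by simp) (by simp [hk]) ?_
        refine Run.put_seq o (pR o) (by simp) (by simp) ?_
        refine Run.put (j := o) (v := pI o) (by simp) (by simp) ?_
        simp only [Store.setArr_arr, Store.setVar_arr, Store.setArr_var, Store.setVar_var]
        norm_num
        exact ⟨g1.symm, hC.push hoo hk0 g1 g2⟩
      · have hk0 : I.method o ≠ 0 := by
          intro h
          simp [h, show W ≠ 1 by omega] at c
        obtain ⟨g1, g2⟩ := hG.step k hlt (by rw [hoo]; exact hk0)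
        rw [hoo] at g2
        obtain ⟨hv, hen⟩ := hcur g1
        generalize hvv : own o = v at *
        have hv' : s'.var 31 = v := by rw [hv, g2]
        have hb : s'.arr 7 v < 2 * n := by
          obtain ⟨i, i1, i2, i3⟩ := hC.b_mem (k - 1) (by omega)
          rw [g2] at i3
          rw [i3]
          exact hR _ (hord i (by omega)).1
        have hc : s'.arr 8 v < 2 * n := by
          obtain ⟨i, i1, i2, i3⟩ := hC.c_mem (k - 1) (by omega)
          rw [g2] at i3
          rw [i3]
          exact hI _ (hord i (by omega)).1
        have hhp := hC.hp_le v
        rw [hv'] at hen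
        refine Run.put_seq v (s'.arr 7 v - (s'.arr 7 v - pR o)) (by simp [hv']) ?_ ?_
        · simp (disch := omega) [Nat.mod_eq_of_lt, hv']
        refine Run.put_seq v (s'.arr 8 v + (pI o - s'.arr 8 v)) (by simp [hv']) ?_ ?_
        · simp (disch := omega) [Nat.mod_eq_of_lt, hv', Store.setArr_arr]
        refine Run.put (j := v) (v := s'.arr 9 v + if I.method o = 1 then 1 else 0) (by simp [hv'])
          ?_ ?_
        · simp (disch := omega) [Nat.mod_eq_of_lt, hv', Store.setArr_arr, mo]
          split_ifs <;> simp (disch := omega) [Nat.mod_eq_of_lt]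
        simp only [Store.setArr_arr, Store.setVar_arr, Store.setArr_var, Store.setVar_var]
        norm_num
        rw [hv']
        exact ⟨rfl, hC.same hoo hvv g1 g2 hen⟩
    · rintro s2 hf2 ⟨h31, hC2⟩
      have e30 : s2.var 30 = k := by rw [hf2.var 30 rfl]; simp [hk]
      refine Run.put_seq (own o) (k + 1) (by simp [h31])
        (by simp (disch := omega) [Nat.mod_eq_of_lt, e30]) ?_
      refine Run.assign (v := k + 1) (by simp (disch := omega) [Nat.mod_eq_of_lt, e30]) ?_
      refine ⟨by simp, ?_, fun _ => ?_⟩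
      · rw [h31] at hC2
        simpa [Store.setArr_arr] using hC2
      · simp [Store.setArr_arr, h31, hoo]

theorem Run.fixProg {N : ℕ} {s : Store} (hS : Sizes n N s) (hW : 8 * n + 8 < W) (hB : n ≤ B) :
    Run W I (B :: Ls) fixProg s (fun s' => ∀ v < n, s'.arr 8 v =
      if s.arr 9 v = 0 then 2 * n else s.arr 8 v) := by
  refine Run.assign_seq 0 (by simp) ?_
  refine (Run.forLoop (fun k s' => ∀ v < n, s'.arr 8 v =
    if v < k ∧ s.arr 9 v = 0 then 2 * n else s.arr 8 v) n 30 (by simp) (by simp) hB ?_ ?_).mono ?_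
  · intro s' hf
    have e1 : s'.var 20 = n := by rw [hf.var 20 rfl]; simp [hS.v20]
    simp [e1, ite_one_zero_mod (show 1 < W by omega)]
  · intro s' hf hlt hI
    have e1 : s'.var 21 = 2 * n := by rw [hf.var 21 rfl]; simp [hS.v21]
    have e9 : s'.arr 9 = s.arr 9 := by rw [hf.arr 9 rfl]; simp
    refine Run.seq (R := fun s'' => ∀ v < n, s''.arr 8 v =
      if v < s'.var 30 + 1 ∧ s.arr 9 v = 0 then 2 * n else s.arr 8 v) ?_ ?_
    · refine Run.ite (fun c => ?_) (fun c => ?_)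
      · have c' : s.arr 9 (s'.var 30) = 0 := by
          by_contra h
          simp [h, e9] at c
        refine Run.put (j := s'.var 30) (v := 2 * n) (by simp) (by simp [e1]) fun v hv => ?_
        rw [Store.setArr_arr_apply, hI v hv]
        by_cases hvk : v = s'.var 30
        · simp [hvk, c']
        · have : v < s'.var 30 + 1 ↔ v < s'.var 30 := by omega
          simp [hvk, this]
      · have c' : s.arr 9 (s'.var 30) ≠ 0 := by
          intro h
          simp [h, e9, show W ≠ 1 by omega] at c
        refine Run.skip fun v hv => ?_
        rw [hI v hv]
        by_cases hvk : v = s'.var 30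
        · simp [hvk, c']
        · have : v < s'.var 30 + 1 ↔ v < s'.var 30 := by omega
          simp [this]
    · intro s2 hf2 h2
      have e30 : s2.var 30 = s'.var 30 := hf2.var 30 rfl
      exact Run.assign (v := s'.var 30 + 1) (by simp (disch := omega) [Nat.mod_eq_of_lt, e30])
        ⟨by simp, by simpa using h2⟩
  · intro s' _ h v hv
    rw [h v hv]
    simp [hv]

end Collect

/-! ### The complete discrete data, with the operations of each value in one segment. -/

section Setup

variable {P V : Type*} [LinearOrder V]

/-- Discrete data of `H` with the list `ord` in which the operations of the value `v` are those
with the indices from `st v` to `en v`. -/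
structure History.Setup (H : History P V) (own pI pR b c ord st en : ℕ → ℕ) : Prop where
  isDisc : H.IsDisc own pI pR b c
  st_lt : ∀ v < H.size, H.input.method v = 0 → st v < en v
  en_le : ∀ v < H.size, H.input.method v = 0 → en v ≤ H.size
  seg : ∀ v < H.size, H.input.method v = 0 → ∀ k, st v ≤ k → k < en v →
    ord k < H.size ∧ H.input.method (ord k) < 3 ∧ own (ord k) = v
  exists_seg : ∀ o < H.size, H.input.method o < 3 → ∃ k, st (own o) ≤ k ∧ k < en (own o) ∧ ord k = o

variable {H : History P V} {own pI pR b c ord st en : ℕ → ℕ}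

theorem Collected.setup {rk hp c' : ℕ → ℕ} {A : Finset ℕ}
    (hA : A = (Finset.range H.size).filter fun i => H.input.method i < 3)
    (hown : H.Owner own) (hT : H.TimePos pI pR)
    (hS : Sorted H.valKey A ord rk) (hU : H.Unambiguous)
    (hC : Collected H.input.method own pI pR ord A.card st en b c hp)
    (hc : ∀ v < H.size, c' v = if hp v = 0 then 2 * H.size else c v) :
    H.Setup own pI pR b c' ord st en := by
  have hmem : ∀ k < A.card, ord k < H.size ∧ H.input.method (ord k) < 3 := by
    intro k hk
    have := (hS.mem k hk).1
    rw [hA] at this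
    simpa using this
  have hex : ∀ o < H.size, H.input.method o < 3 → ∃ k < A.card, ord k = o := by
    intro o ho hk
    have := hS.rank o (by rw [hA]; simp [ho, hk])
    exact ⟨_, this⟩
  have hcard : A.card ≤ H.size := by
    rw [hA]
    exact (Finset.card_filter_le _ _).trans (Finset.card_range _).le
  have hpush : ∀ v < H.size, H.input.method v = 0 → own v = v := fun v hv hk =>
    ((hown v hv (by omega)).2.2.2 v hv hk rfl).symm
  have hhp : ∀ v, hp v ≠ 0 ↔ ∃ i < H.size, H.input.method i = 1 ∧ own i = v := by
    intro v
    rw [hC.hp_iff]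
    constructor
    · rintro ⟨j, hj, h1, h2⟩
      exact ⟨_, (hmem j hj).1, h1, h2⟩
    · rintro ⟨i, hi, h1, h2⟩
      obtain ⟨k, hk, rfl⟩ := hex i hi (by omega)
      exact ⟨k, hk, h1, h2⟩
  have hval : ∀ i j : Fin H.size, H.input.method i < 3 → H.input.method j < 3 → own i = own j →
      H.val i = H.val j := by
    intro i j hi hj he
    rw [← (hown i i.2 hi).2.2.1, ← (hown j j.2 hj).2.2.1, he]
  have hidx : ∀ v < H.size, H.input.method v = 0 → ∃ k < A.card, ord k = v ∧ own (ord k) = v := by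
    intro v hv hk
    obtain ⟨k, hkc, hkv⟩ := hex v hv (by omega)
    exact ⟨k, hkc, hkv, by rw [hkv, hpush v hv hk]⟩
  refine ⟨⟨⟨hT.pI_lt, hT.pR_lt, hT.pI_inj, hT.pR_ne_pI, ?_, ?_, hpush, ?_, ?_, ?_, ?_, ?_, ?_⟩, ?_,
    hT.pos⟩, ?_, ?_, ?_, ?_⟩
  · exact fun i hi hk => (hown i hi hk).1
  · exact fun i hi hk => (hown i hi hk).2.1
  · intro i hi j hj h1 h2 he
    have hv := hval ⟨i, hi⟩ ⟨j, hj⟩ (by simp only; omega) (by simp only; omega) he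
    rw [show H.input.method i = _ from H.method_eq ⟨i, hi⟩, StackOp.code_eq_one] at h1
    rw [show H.input.method j = _ from H.method_eq ⟨j, hj⟩, StackOp.code_eq_one] at h2
    obtain ⟨v, h1⟩ := h1
    obtain ⟨w, h2⟩ := h2
    have : v = w := by
      simpa [History.val, hi, hj, h1, h2, StackOp.value] using hv
    subst this
    exact congrArg Fin.val ((hU v ⟨⟨i, hi⟩, by rw [h1]; rfl⟩).2 _ _ h1 h2)
  · intro i hi hk
    obtain ⟨k, hkc, rfl⟩ := hex i hi hk
    exact hC.b_le k hkc
  · intro v hv hk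
    obtain ⟨k, hkc, hkv, hko⟩ := hidx v hv hk
    obtain ⟨i, i1, i2, i3⟩ := hC.b_mem k hkc
    rw [hko] at i2 i3
    exact ⟨_, (hmem i i1).1, (hmem i i1).2, i2, i3⟩
  · intro i hi hk
    obtain ⟨k, hkc, rfl⟩ := hex i hi hk
    rw [hc _ (hown _ hi hk).1]
    have h1 := hT.pI_lt _ hi
    have h2 := hT.pR_lt _ hi
    split_ifs
    · omega
    · exact hC.c_le k hkc
  · intro v hv hk hpop
    obtain ⟨k, hkc, hkv, hko⟩ := hidx v hv hk
    obtain ⟨i, i1, i2, i3⟩ := hC.c_mem k hkc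
    rw [hko] at i2 i3
    rw [hc v hv, if_neg ((hhp v).2 hpop)]
    exact ⟨_, (hmem i i1).1, (hmem i i1).2, i2, i3⟩
  · intro v hv hk hpop
    rw [hc v hv, if_pos]
    by_contra h
    exact hpop ((hhp v).1 h)
  · intro i v hv
    have hk : H.input.method i < 3 := by
      rw [H.method_eq]
      revert hv
      cases (H.opr i).op <;> simp [StackOp.code, StackOp.value]
    obtain ⟨o1, o2, o3, -⟩ := hown i i.2 hk
    refine ⟨o1, ?_⟩
    rw [show H.input.method (own i) = _ from H.method_eq ⟨own i, o1⟩, StackOp.code_eq_zero] at o2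
    obtain ⟨w, hw⟩ := o2
    have hvi : H.val i = some v := by simp [History.val, hv]
    rw [hvi] at o3
    rw [hw]
    simp only [History.val, o1, dif_pos, hw, StackOp.value, Option.some.injEq] at o3
    rw [o3]
  · intro v hv hk
    obtain ⟨k, hkc, hkv, hko⟩ := hidx v hv hk
    have := hC.seg k hkc
    rw [hko] at this
    omega
  · intro v hv hk
    obtain ⟨k, hkc, hkv, hko⟩ := hidx v hv hk
    have := hC.seg k hkc
    rw [hko] at this
    omega
  · intro v hv hk j h1 h2
    obtain ⟨k, hkc, hkv, hko⟩ := hidx v hv hk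
    have h3 := hC.seg k hkc
    have h4 := hC.own_eq k hkc j
    rw [hko] at h3 h4
    have := hmem j (by omega)
    exact ⟨this.1, this.2, h4 h1 h2⟩
  · intro o ho hk
    obtain ⟨k, hkc, rfl⟩ := hex o ho hk
    have := hC.seg k hkc
    exact ⟨k, this.1, this.2.1, rfl⟩

/-- The operation at a list index determines its value, so segments of different values are
disjoint. This bounds the share of the pointers in the initial potential. -/
theorem History.Setup.sum_le (h : H.Setup own pI pR b c ord st en) {S : Finset ℕ}
    (hS : ∀ v ∈ S, v < H.size ∧ H.input.method v = 0) : ∑ v ∈ S, (en v - st v) ≤ H.size := by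
  calc ∑ v ∈ S, (en v - st v) = ∑ v ∈ S, (Finset.Ico (st v) (en v)).card := by simp
    _ = (S.biUnion fun v => Finset.Ico (st v) (en v)).card := by
      refine (Finset.card_biUnion fun v hv w hw hvw => ?_).symm
      rw [Function.onFun, Finset.disjoint_left]
      intro k hk hk'
      simp only [Finset.mem_Ico] at hk hk'
      have h1 := h.seg v (hS v hv).1 (hS v hv).2 k hk.1 hk.2
      have h2 := h.seg w (hS w hw).1 (hS w hw).2 k hk'.1 hk'.2
      exact hvw (h1.2.2.symm.trans h2.2.2)
    _ ≤ (Finset.range H.size).card := by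
      refine Finset.card_le_card fun k hk => ?_
      simp only [Finset.mem_biUnion, Finset.mem_Ico, Finset.mem_range] at hk ⊢
      obtain ⟨v, hv, h1, h2⟩ := hk
      have := h.en_le v (hS v hv).1 (hS v hv).2
      omega
    _ = H.size := Finset.card_range _

end Setup

/-! ### Preparation of the elimination -/

/-- Insert the values that have to be on the stack into the tree and into the worklist. -/
def insertProg : Program :=
  (27 ≔ 𝐜 0) ;; (30 ≔ 𝐜 0) ;; .loop (𝐯 30 <ₑ 𝐯 20)
    (.ite ((.method (𝐯 30) =ₑ 𝐜 0) *ₑ (.get 7 (𝐯 30) <ₑ .get 8 (𝐯 30)))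
      ((7 ≔ .get 7 (𝐯 30)) ;; (8 ≔ .get 8 (𝐯 30)) ;; (9 ≔ 𝐯 23 +ₑ 𝐯 30) ;; coverUpd .add ;;
        .put 18 (𝐯 27) (𝐯 30) ;; (27 ≔ 𝐯 27 +ₑ 𝐜 1)) .skip ;;
      (30 ≔ 𝐯 30 +ₑ 𝐜 1))

/-- Nobody is waiting. -/
def stabInit : Program :=
  (30 ≔ 𝐜 0) ;; .loop (𝐯 30 <ₑ 𝐜 2 *ₑ 𝐯 22) (.put 15 (𝐯 30) (𝐯 22) ;; (30 ≔ 𝐯 30 +ₑ 𝐜 1))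

/-- Set `𝐯 24` if some `empty` sees no gap with an empty stack. -/
def emptiesProg : Program :=
  (24 ≔ 𝐜 0) ;; (30 ≔ 𝐜 0) ;; .loop (𝐯 30 <ₑ 𝐯 20)
    (.ite (.method (𝐯 30) =ₑ 𝐜 3)
      ((7 ≔ .get 1 (𝐜 2 *ₑ 𝐯 30)) ;; (8 ≔ 𝐜 1) ;; findFrom 10 11 12 ;;
        .ite (𝐯 9 <ₑ .get 1 (𝐜 2 *ₑ 𝐯 30 +ₑ 𝐜 1)) .skip (24 ≔ 𝐜 1)) .skip ;;
      (30 ≔ 𝐯 30 +ₑ 𝐜 1))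

/-- The first `k` entries of `a` list the elements of `Q` without repetition. -/
structure Listing (a : ℕ → ℕ) (k : ℕ) (Q : Finset ℕ) : Prop where
  image : (Finset.range k).image a = Q
  inj : ∀ i < k, ∀ j < k, a i = a j → i = j

theorem Listing.card {a : ℕ → ℕ} {k : ℕ} {Q : Finset ℕ} (h : Listing a k Q) : Q.card = k := by
  rw [← h.image, Finset.card_image_of_injOn, Finset.card_range]
  intro i hi j hj he
  simp only [Finset.coe_range, Set.mem_Iio] at hi hj
  exact h.inj i hi j hj he

theorem Listing.congr {a a' : ℕ → ℕ} {k : ℕ} {Q : Finset ℕ} (h : Listing a k Q)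
    (ha : ∀ i < k, a' i = a i) : Listing a' k Q := by
  refine ⟨?_, fun i hi j hj he => h.inj i hi j hj ?_⟩
  · rw [← h.image]
    exact Finset.image_congr fun i hi => ha i (by simpa using hi)
  · rwa [ha i hi, ha j hj] at he

theorem Listing.push {a : ℕ → ℕ} {k v : ℕ} {Q : Finset ℕ} (h : Listing a k Q) (hv : v ∉ Q) :
    Listing (Function.update a k v) (k + 1) (insert v Q) := by
  have h' : Listing (Function.update a k v) k Q :=
    h.congr fun i hi => Function.update_of_ne (by omega) _ _
  have hmem : ∀ i < k, Function.update a k v i ≠ v := by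
    intro i hi he
    rw [← he, ← h'.image] at hv
    exact hv (Finset.mem_image_of_mem _ (by simpa using hi))
  refine ⟨?_, fun i hi j hj he => ?_⟩
  · rw [Finset.range_add_one, Finset.image_insert, h'.image, Function.update_self]
  · rcases Nat.lt_succ_iff_lt_or_eq.1 hi with hi' | rfl <;>
    rcases Nat.lt_succ_iff_lt_or_eq.1 hj with hj' | rfl
    · exact h'.inj i hi' j hj' he
    · rw [Function.update_self] at he
      exact absurd he (hmem i hi')
    · rw [Function.update_self] at he
      exact absurd he.symm (hmem j hj')
    · rfl

theorem Listing.pop {a : ℕ → ℕ} {k : ℕ} {Q : Finset ℕ} (h : Listing a (k + 1) Q) :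
    a k ∈ Q ∧ Listing a k (Q.erase (a k)) := by
  have hk : a k ∈ Q := by
    rw [← h.image]
    exact Finset.mem_image_of_mem _ (by simp)
  refine ⟨hk, ?_, fun i hi j hj he => h.inj i (by omega) j (by omega) he⟩
  rw [← h.image, Finset.range_add_one, Finset.image_insert, Finset.erase_insert]
  intro hmem
  obtain ⟨i, hi, he⟩ := Finset.mem_image.1 hmem
  rw [Finset.mem_range] at hi
  have := h.inj i (by omega) k (by omega) he
  omega

theorem load_eq_zero_iff {w b c : ℕ → ℕ} (hw : ∀ v, 0 < w v) {S : Finset ℕ} {g : ℕ} :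
    load w b c S g = 0 ↔ ∀ v ∈ S, ¬ Covers b c v g := by
  unfold load Covers
  rw [Finset.sum_eq_zero_iff]
  constructor
  · intro h v hv hc
    have := h v (Finset.mem_filter.2 ⟨hv, hc⟩)
    have := hw v
    omega
  · intro h v hv
    exact absurd (Finset.mem_filter.1 hv).2 (h v (Finset.mem_filter.1 hv).1)

/-- Weight of the value `v` in a history with `n` operations. -/
def weight (n v : ℕ) : ℕ := n + 1 + v

/-- Bound for the entries of the trees. -/
def treeBound (n : ℕ) : ℕ := 2 * (n + 1) ^ 2 + 4 * n + 2

theorem sum_weight_le {n : ℕ} {S : Finset ℕ} (hS : ∀ v ∈ S, v < n) :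
    ∑ v ∈ S, weight n v ≤ treeBound n := by
  have h1 : S ⊆ Finset.range n := fun v hv => by simpa using hS v hv
  calc ∑ v ∈ S, weight n v ≤ ∑ _v ∈ S, 2 * n := Finset.sum_le_sum fun v hv => by
        have := hS v hv
        unfold weight
        omega
    _ = S.card * (2 * n) := by simp
    _ ≤ n * (2 * n) := Nat.mul_le_mul_right _ ((Finset.card_le_card h1).trans (by simp))
    _ ≤ treeBound n := by unfold treeBound; nlinarith

/-- The arrays contain the given data. -/
structure Loaded (n N : ℕ) (pI pR b c ord en : ℕ → ℕ) (s : Store) : Prop where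
  sizes : Sizes n N s
  arrI : ∀ i, s.arr 1 (2 * i) = pI i
  arrR : ∀ i, s.arr 1 (2 * i + 1) = pR i
  arr3 : s.arr 3 = ord
  arr6 : s.arr 6 = en
  arr7 : s.arr 7 = b
  arr8 : s.arr 8 = c

theorem Loaded.frame {n N : ℕ} {pI pR b c ord en : ℕ → ℕ} {p : Program} {s s' : Store}
    (h : Loaded n N pI pR b c ord en s) (hf : Frame p s s')
    (h20 : p.writesVar 20 = false := by rfl) (h21 : p.writesVar 21 = false := by rfl)
    (h22 : p.writesVar 22 = false := by rfl) (h23 : p.writesVar 23 = false := by rfl)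
    (h1 : p.writesArr 1 = false := by rfl) (h3 : p.writesArr 3 = false := by rfl)
    (h6 : p.writesArr 6 = false := by rfl) (h7 : p.writesArr 7 = false := by rfl)
    (h8 : p.writesArr 8 = false := by rfl) : Loaded n N pI pR b c ord en s' :=
  ⟨h.sizes.frame hf h20 h21 h22 h23, by rw [hf.arr 1 h1]; exact h.arrI,
    by rw [hf.arr 1 h1]; exact h.arrR, (hf.arr 3 h3).trans h.arr3, (hf.arr 6 h6).trans h.arr6,
    (hf.arr 7 h7).trans h.arr7, (hf.arr 8 h8).trans h.arr8⟩

theorem Loaded.setVar {n N x v : ℕ} {pI pR b c ord en : ℕ → ℕ} {s : Store}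
    (h : Loaded n N pI pR b c ord en s) (hx : x < 20 ∨ 23 < x) :
    Loaded n N pI pR b c ord en (s.setVar x v) :=
  ⟨h.sizes.setVar hx, h.arrI, h.arrR, h.arr3, h.arr6, h.arr7, h.arr8⟩

theorem CoverTree.congr {w b c : ℕ → ℕ} {N : ℕ} {S : Finset ℕ} {s s' : Store}
    (h : CoverTree w b c N S s) (h10 : s'.arr 10 = s.arr 10) (h11 : s'.arr 11 = s.arr 11)
    (h12 : s'.arr 12 = s.arr 12) : CoverTree w b c N S s' := by
  unfold CoverTree
  rw [h10, h11, h12]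
  exact h

section Prepare

variable {W : ℕ} {I : Input} {Ls : List ℕ} {n N B L : ℕ} {pI pR b c ord en : ℕ → ℕ}

/-- Bounds for the word size, the trees and their depth. -/
structure Fits (W n N L : ℕ) : Prop where
  leaf : LeafCount n N
  word : 64 * (n + 2) ^ 2 ≤ W
  depth : Nat.log 2 (2 * N) ≤ L

theorem Fits.hN (h : Fits W n N L) : 4 * N + 2 < W := by
  have := h.leaf.le
  have := h.word
  nlinarith

theorem Fits.hn (h : Fits W n N L) : 8 * n + 8 < W := by
  have := h.word
  nlinarith

theorem Fits.hT (h : Fits W n N L) : 8 * treeBound n < W := by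
  have := h.word
  unfold treeBound
  nlinarith

theorem Run.insertProg {s : Store} (hF : Fits W n N L)
    (hl : Loaded n N pI pR b c ord en s) (hb : ∀ v < n, I.method v = 0 → b v < 2 * n)
    (hc : ∀ v < n, I.method v = 0 → c v ≤ 2 * n) (hnB : n ≤ B)
    (hM : ∀ i, I.method i < 5) (h10 : ∀ i, s.arr 10 i = 0) (h11 : ∀ i, s.arr 11 i = 0) (h12 : ∀ i, s.arr 12 i = 0) :
    Run W I (B :: L :: Ls) insertProg s (fun s' =>
      CoverTree (weight n) b c N (solidValues I.method b c n) s' ∧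
      Listing (s'.arr 18) (s'.var 27) (solidValues I.method b c n)) := by
  have hn := hF.hn
  have hNn := hF.leaf.lt
  refine Run.assign_seq 0 (by simp) ?_
  refine Run.assign_seq 0 (by simp) ?_
  refine (Run.forLoop (fun k s' => CoverTree (weight n) b c N (solidValues I.method b c k) s' ∧
      Listing (s'.arr 18) (s'.var 27) (solidValues I.method b c k)) n 30 (by simp) ?_ hnB ?_ ?_).mono
      (fun s' _ h => h)
  · have h0 : solidValues I.method b c 0 = ∅ := by simp [solidValues]
    simp only [Store.setVar_var, if_true, h0]
    refine ⟨⟨fun i hi => ?_, fun i hi => ?_, fun i hi => ?_, fun i h1 h2 => ?_⟩, ?_, ?_⟩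
    · simp [h10, weightAt]
    · simp [h11, weightAt]
    · simp [h12, weightAt]
    · simp [MinNode, h10, h11, h12]
    · simp
    · simp
  · intro s' hf
    have e1 : s'.var 20 = n := by rw [hf.var 20 rfl]; simp [hl.sizes.v20]
    simp [e1, ite_one_zero_mod (show 1 < W by omega)]
  · rintro s' hf hlt ⟨hC, hL⟩
    have hl' : Loaded n N pI pR b c ord en s' :=
      ((hl.setVar (by norm_num)).setVar (by norm_num)).frame hf
    generalize hk : s'.var 30 = k at *
    have hcard : s'.var 27 ≤ n := by
      rw [← hL.card]
      calc _ ≤ (Finset.range k).card := Finset.card_filter_le _ _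
        _ ≤ n := by simp; omega
    refine Run.seq (R := fun s'' => CoverTree (weight n) b c N (solidValues I.method b c (k + 1)) s'' ∧
      Listing (s''.arr 18) (s''.var 27) (solidValues I.method b c (k + 1))) ?_ ?_
    · have hM' : I.method k % W = I.method k := Nat.mod_eq_of_lt (by have := hM k; omega)
      have hsol : ∀ v, v ∈ solidValues I.method b c (k + 1) ↔
          v ∈ solidValues I.method b c k ∨ v = k ∧ I.method k = 0 ∧ b k < c k := by
        intro v
        simp only [solidValues, Finset.mem_filter, Finset.mem_range]
        constructor
        · rintro ⟨h1, h2, h3⟩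
          rcases Nat.lt_succ_iff_lt_or_eq.1 h1 with h | rfl
          · exact .inl ⟨h, h2, h3⟩
          · exact .inr ⟨rfl, h2, h3⟩
        · rintro (⟨h1, h2, h3⟩ | ⟨rfl, h2, h3⟩)
          · exact ⟨by omega, h2, h3⟩
          · exact ⟨by omega, h2, h3⟩
      refine Run.ite (fun c' => ?_) (fun c' => ?_)
      · have hcond : I.method k = 0 ∧ b k < c k := by
          by_contra h
          rw [not_and_or] at h
          rcases h with h | h <;> simp [hk, hl'.arr7, hl'.arr8, hM', h] at c'
        have hbk := hb k hlt hcond.1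
        have hck := hc k hlt hcond.1
        have hnotin : k ∉ solidValues I.method b c k := by simp [solidValues]
        have hins : solidValues I.method b c (k + 1) = insert k (solidValues I.method b c k) := by
          ext v
          rw [hsol, Finset.mem_insert]
          simp [hcond, or_comm]
        have h22 := hl'.sizes.v22
        have h23 := hl'.sizes.v23
        obtain ⟨H, hH⟩ := hF.leaf.pow
        refine Run.assign_seq (b k) (by simp [hk, hl'.arr7]) ?_
        refine Run.assign_seq (c k) (by simp [hk, hl'.arr8]) ?_
        refine Run.assign_seq (weight n k) (by
          simp (disch := omega) [Nat.mod_eq_of_lt, hk, h23, weight]) ?_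
        refine Run.seq (Run.coverInsert (v := k) (H := H) (B := treeBound n)
          (S := solidValues I.method b c k) (w := weight n) (b := b) (c := c) (N := N)
          (hC.congr rfl rfl rfl) hnotin ?_ hH hF.hN hF.hT hF.depth
          (by omega) (by omega) (by simp [h22]) (by simp) (by simp) (by simp)) ?_
        · rw [← hins]
          exact sum_weight_le fun v hv => by
            have := Finset.mem_range.1 (Finset.mem_filter.1 hv).1
            omega
        · intro s2 hf2 hC2
          have e27 : s2.var 27 = s'.var 27 := by rw [hf2.var 27 rfl]; simp
          have e30 : s2.var 30 = k := by rw [hf2.var 30 rfl]; simp [hk]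
          have e18 : s2.arr 18 = s'.arr 18 := by rw [hf2.arr 18 rfl]; simp
          refine Run.put_seq (s'.var 27) k (by simp [e27]) (by simp [e30]) ?_
          refine Run.assign (v := s'.var 27 + 1)
            (by simp (disch := omega) [Nat.mod_eq_of_lt, e27]) ?_
          rw [hins]
          refine ⟨hC2.congr rfl rfl rfl, ?_⟩
          simpa [Store.setArr_arr, e18] using hL.push hnotin
      · have hcond : ¬ (I.method k = 0 ∧ b k < c k) := by
          rintro ⟨h1, h2⟩
          simp [hk, hl'.arr7, hl'.arr8, h1, h2, show W ≠ 1 by omega] at c'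
        have hins : solidValues I.method b c (k + 1) = solidValues I.method b c k := by
          ext v
          rw [hsol]
          tauto
        rw [hins]
        exact Run.skip ⟨hC, hL⟩
    · rintro s2 hf2 ⟨h1, h2⟩
      have e30 : s2.var 30 = k := by rw [hf2.var 30 rfl, hk]
      refine Run.assign (v := k + 1) (by simp (disch := omega) [Nat.mod_eq_of_lt, e30]) ?_
      refine ⟨by simp, h1, ?_⟩
      simpa using h2

/-- The entry `N` means that nobody waits: it exceeds `2 * n`, hence every threshold used in
queries. With zero sums the constant filling already satisfies the node equations. -/
theorem Run.stabInit {s : Store} (hF : Fits W n N L) (hS : Sizes n N s) (hB : 8 * n + 2 ≤ B)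
    (h13 : ∀ i, s.arr 13 i = 0) (h14 : ∀ i, s.arr 14 i = 0) :
    Run W I (B :: Ls) stabInit s (fun s' => StabTree N (fun _ => N) s') := by
  have hN := hF.hN
  have hNn := hF.leaf.le
  refine Run.assign_seq 0 (by simp) ?_
  refine (Run.forLoop (fun k s' => ∀ i < k, s'.arr 15 i = N) (2 * N) 30 (by simp) (by simp)
    (by omega) ?_ ?_).mono ?_
  · intro s' hf
    have e1 : s'.var 22 = N := by rw [hf.var 22 rfl]; simp [hS.v22]
    simp (disch := omega) [e1, Nat.mod_eq_of_lt, ite_one_zero_mod (show 1 < W by omega)]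
  · intro s' hf hlt hI
    have e1 : s'.var 22 = N := by rw [hf.var 22 rfl]; simp [hS.v22]
    refine Run.put_seq (s'.var 30) N (by simp) (by simp [e1]) ?_
    refine Run.assign (v := s'.var 30 + 1) (by simp (disch := omega) [Nat.mod_eq_of_lt]) ?_
    refine ⟨by simp, fun i hi => ?_⟩
    rw [Store.setVar_arr, Store.setArr_arr_apply]
    split_ifs with h
    · rfl
    · exact hI i (by omega)
  · intro s' hf h
    have e13 : ∀ i, s'.arr 13 i = 0 := by rw [hf.arr 13 rfl]; simpa using h13
    have e14 : ∀ i, s'.arr 14 i = 0 := by rw [hf.arr 14 rfl]; simpa using h14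
    refine ⟨fun i hi => ?_, fun i hi => ?_, fun i hi => ?_, fun i h1 h2 => ?_⟩
    · simp [e13]
    · simp [e14]
    · exact h _ (by omega)
    · simp [MinNode, e13, e14, h i (by omega), h (2 * i) (by omega), h (2 * i + 1) (by omega)]

/-- Weights are positive, so a load below 1 means an uncovered gap. The first such gap from the
invocation on decides, and it is compared with the response. -/
theorem Run.emptiesProg {s : Store} (hF : Fits W n N L)
    (hl : Loaded n N pI pR b c ord en s) (hM : ∀ i, I.method i < 5) (hnB : n ≤ B)
    (hI : ∀ i < n, pI i < pR i) (hR : ∀ i < n, pR i < 2 * n)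
    (hC : CoverTree (weight n) b c N (solidValues I.method b c n) s) :
    Run W I (B :: L :: Ls) emptiesProg s
      (fun s' => s'.var 24 = 0 ↔ EmptiesOK I.method pI pR b c n) := by
  have hn := hF.hn
  have hNn := hF.leaf.lt
  refine Run.assign_seq 0 (by simp) ?_
  refine Run.assign_seq 0 (by simp) ?_
  refine (Run.forLoop (fun k s' => s'.var 24 = 0 ↔ ∀ e < k, I.method e = 3 →
      ∃ g, pI e ≤ g ∧ g < pR e ∧ ∀ w ∈ solidValues I.method b c n, ¬ Covers b c w g) n 30
      (by simp) (by simp) hnB ?_ ?_).mono (fun s' _ h => h)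
  · intro s' hf
    have e1 : s'.var 20 = n := by rw [hf.var 20 rfl]; simp [hl.sizes.v20]
    simp [e1, ite_one_zero_mod (show 1 < W by omega)]
  · intro s' hf hlt h24
    have hl' : Loaded n N pI pR b c ord en s' :=
      ((hl.setVar (by norm_num)).setVar (by norm_num)).frame hf
    have hC' : CoverTree (weight n) b c N (solidValues I.method b c n) s' :=
      hC.congr (hf.arr 10 rfl) (hf.arr 11 rfl) (hf.arr 12 rfl)
    generalize hk : s'.var 30 = k at *
    have hM' : I.method k % W = I.method k := Nat.mod_eq_of_lt (by have := hM k; omega)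
    have hIk := hI k hlt
    have hRk := hR k hlt
    refine Run.seq (R := fun s'' => s''.var 24 = 0 ↔ ∀ e < k + 1, I.method e = 3 →
      ∃ g, pI e ≤ g ∧ g < pR e ∧ ∀ w ∈ solidValues I.method b c n, ¬ Covers b c w g) ?_ ?_
    · refine Run.ite (fun c' => ?_) (fun c' => ?_)
      · have hcond : I.method k = 3 := by
          by_contra h
          simp [hk, hM', h, Nat.mod_eq_of_lt (show 3 < W by omega)] at c'
        obtain ⟨H, hH⟩ := hF.leaf.pow
        refine Run.assign_seq (pI k) (by
          simp (disch := omega) [Nat.mod_eq_of_lt, hk, hl'.arrI]) ?_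
        refine Run.assign_seq 1 (by simp (disch := omega) [Nat.mod_eq_of_lt]) ?_
        refine Run.seq (Run.findCover (i := pI k) (t := 1) (H := H) (B := treeBound n)
          (S := solidValues I.method b c n) (w := weight n) (b := b) (c := c) (N := N)
          (hC'.congr rfl rfl rfl) (fun v hv => (Finset.mem_filter.1 hv).2.2)
          (sum_weight_le fun v hv => Finset.mem_range.1 (Finset.mem_filter.1 hv).1) hH hF.hN hF.hT
          (by unfold treeBound; omega) (by omega) hF.depth (by simp [hl'.sizes.v22]) (by simp)
          (by simp)) ?_
        rintro s2 hf2 ⟨h1, h2, h3⟩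
        have e24 : s2.var 24 = s'.var 24 := by rw [hf2.var 24 rfl]; simp
        have e30 : s2.var 30 = k := by rw [hf2.var 30 rfl]; simp [hk]
        have eR : s2.arr 1 (2 * k + 1) = pR k := by
          rw [hf2.arr 1 rfl]; simpa using hl'.arrR k
        have hpos : ∀ v, 0 < weight n v := fun v => by unfold weight; omega
        have hex : s2.var 9 < pR k ↔ ∃ g, pI k ≤ g ∧ g < pR k ∧
            ∀ w ∈ solidValues I.method b c n, ¬ Covers b c w g := by
          constructor
          · intro h
            obtain ⟨a1, a2, -⟩ := h2 (by omega)
            exact ⟨_, a1, h, (load_eq_zero_iff hpos).1 (by omega)⟩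
          · rintro ⟨g, g1, g2, g3⟩
            by_contra h
            have h4 := h3 g g1 (by omega)
            rw [(load_eq_zero_iff hpos).2 g3] at h4
            omega
        refine Run.ite (fun c'' => ?_) (fun c'' => ?_)
        · have hlt' : s2.var 9 < pR k := by
            by_contra h
            simp (disch := omega) [Nat.mod_eq_of_lt, e30, eR, h] at c''
          refine Run.skip ?_
          rw [e24, h24]
          constructor
          · intro h e he hke
            rcases Nat.lt_succ_iff_lt_or_eq.1 he with he' | rfl
            · exact h e he' hke
            · exact hex.1 hlt'
          · exact fun h e he => h e (by omega)
        · have hlt' : ¬ s2.var 9 < pR k := by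
            intro h
            simp (disch := omega) [Nat.mod_eq_of_lt, e30, eR, h] at c''
          refine Run.assign (v := 1) (by simp (disch := omega) [Nat.mod_eq_of_lt]) ?_
          simp only [Store.setVar_var, if_true]
          constructor
          · intro h; omega
          · exact fun h => absurd (hex.2 (h k (by omega) hcond)) hlt'
      · have hcond : I.method k ≠ 3 := by
          intro h
          simp (disch := omega) [Nat.mod_eq_of_lt, hk, h] at c'
        refine Run.skip ?_
        rw [h24]
        constructor
        · intro h e he hke
          rcases Nat.lt_succ_iff_lt_or_eq.1 he with he' | rfl
          · exact h e he' hke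
          · exact absurd hke hcond
        · exact fun h e he => h e (by omega)
    · rintro s2 hf2 h1
      have e30 : s2.var 30 = k := by rw [hf2.var 30 rfl, hk]
      refine Run.assign (v := k + 1) (by simp (disch := omega) [Nat.mod_eq_of_lt, e30]) ?_
      exact ⟨by simp, by simpa using h1⟩

end Prepare

/-- Arrays: 0 and 2 are the sorting trees; 19 lists the time points and 1 holds their ranks; 3 lists
the operations and 20 holds their ranks; 5 and 6 delimit the segments of the values; 7 and 8 are `b`
and `c`; 9 counts pops; 10 to 12 form the cover tree and 13 to 15 the tree of waiting operations; 18
is the worklist. The elimination later advances 5 as a pointer, records in 16 who waits at a leaf,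
and marks waiting values in 17. -/
def prepProg : Program :=
  initProg ;; sortProg 0 19 1 21 (𝐜 1) timeLess ;;
    sortProg 2 3 20 20 (.method (𝐯 30) <ₑ 𝐜 3) valLess ;; collectProg ;; fixProg ;; insertProg ;;
    stabInit ;; emptiesProg

/-- The state before the elimination. -/
structure History.Ready {P V : Type*} [LinearOrder V] (H : History P V) (N : ℕ)
    (own pI pR b c ord st en : ℕ → ℕ) (s : Store) : Prop where
  setup : H.Setup own pI pR b c ord st en
  loaded : Loaded H.size N pI pR b c ord en s
  ptr : s.arr 5 = st
  cover : CoverTree (weight H.size) b c N (solidValues H.input.method b c H.size) s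
  stab : StabTree N (fun _ => N) s
  list : Listing (s.arr 18) (s.var 27) (solidValues H.input.method b c H.size)
  waiting : ∀ v, s.arr 17 v = 0
  empties : s.var 24 = 0 ↔ EmptiesOK H.input.method pI pR b c H.size

theorem History.method_lt {P V : Type*} [LinearOrder V] (H : History P V) (i : ℕ) :
    H.input.method i < 5 := by
  unfold History.input
  simp only
  split_ifs with h
  · cases (H.opr ⟨i, h⟩).op <;> simp [StackOp.code]
  · norm_num

theorem Run.prepProg {P V : Type*} [LinearOrder V] {H : History P V} (hU : H.Unambiguous)
    {W B L : ℕ} {Ls : List ℕ} (hW : 64 * (H.size + 2) ^ 2 ≤ W) (hB : 8 * H.size + 2 ≤ B)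
    (hL : ∀ N, LeafCount H.size N → Nat.log 2 (2 * N) ≤ L) :
    Run W H.input (B :: L :: Ls) prepProg (initStore H.input.size) (fun s =>
      ∃ N own pI pR b c ord st en, LeafCount H.size N ∧ H.Ready N own pI pR b c ord st en s) := by
  obtain ⟨own, hown⟩ := hU.exists_owner
  have hM := H.method_lt
  refine Run.seq (Run.initProg (n := H.size) hW (by omega)) ?_
  rintro s1 - ⟨⟨N, hN, hS1⟩, hz1⟩
  have hF : Fits W H.size N L := ⟨hN, hW, hL N hN⟩
  have hn := hF.hn
  have hNn := hN.lt
  have hNW := hF.hN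
  refine Run.seq (Run.sortProg (N := N) (A := Finset.range (2 * H.size)) (key := H.timeKey)
    (by norm_num) (by norm_num) (by norm_num) (by norm_num) (compares_timeLess (by omega))
    (by rw [hS1.v21]) ?_ hS1.v22 hNW hF.depth (by rw [hS1.v21]; omega) (by rw [hS1.v21]; omega)
    (by simp [hz1])) ?_
  · intro s' h30
    rw [hS1.v21] at h30
    simp [h30, show W ≠ 1 by omega]
  rintro s2 hf2 ⟨-, hT⟩
  have hS2 : Sizes H.size N s2 := hS1.frame hf2
  refine Run.seq (Run.sortProg (N := N)
    (A := (Finset.range H.size).filter fun i => H.input.method i < 3) (key := H.valKey)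
    (by norm_num) (by norm_num) (by norm_num) (by norm_num) (compares_valLess (by omega))
    (by rw [hS2.v20]; exact Finset.filter_subset _ _) ?_ hS2.v22 hNW hF.depth
    (by rw [hS2.v20]; omega) (by rw [hS2.v20]; omega) (by rw [hf2.arr 2 rfl]; simp [hz1])) ?_
  · intro s' h30
    rw [hS2.v20] at h30
    have := hM (s'.var 30)
    simp (disch := omega) [h30, ite_one_zero_mod (show 1 < W by omega), Nat.mod_eq_of_lt]
  rintro s3 hf3 ⟨h25, hV⟩
  have hS3 : Sizes H.size N s3 := hS2.frame hf3
  set A := (Finset.range H.size).filter fun i => H.input.method i < 3 with hA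
  have hTP := hT.timePos
  have e1 : s3.arr 1 = s2.arr 1 := hf3.arr 1 rfl
  set pI : ℕ → ℕ := fun i => s2.arr 1 (2 * i) with hpI
  set pR : ℕ → ℕ := fun i => s2.arr 1 (2 * i + 1) with hpR
  have hmem : ∀ k < A.card, s3.arr 3 k < H.size ∧ H.input.method (s3.arr 3 k) < 3 := by
    intro k hk
    simpa [hA] using (hV.mem k hk).1
  have hRlt := hTP.pR_lt
  have hIR := hTP.pI_lt
  refine Run.seq (Run.collectProg (n := H.size) (pI := pI) (pR := pR) (hV.grouped hA hown) hmem
    ((Finset.card_filter_le _ _).trans (Finset.card_range _).le)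
    (fun i hi => (hIR i hi).trans (hRlt i hi)) hRlt hn (by omega) h25 (by simp [e1, hpI])
    (by simp [e1, hpR]) rfl ?_) ?_
  · rw [hf3.arr 9 rfl, hf2.arr 9 rfl]
    simp [hz1]
  intro s4 hf4 hC
  have hS4 : Sizes H.size N s4 := hS3.frame hf4
  refine Run.seq (Run.fixProg hS4 hn (by omega)) ?_
  intro s5 hf5 h8
  have hS5 : Sizes H.size N s5 := hS4.frame hf5
  have hset := hC.setup (c' := s5.arr 8) hA hown hTP hV hU h8
  have hl5 : Loaded H.size N pI pR (s4.arr 7) (s5.arr 8) (s3.arr 3) (s4.arr 6) s5 := by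
    refine ⟨hS5, ?_, ?_, ?_, hf5.arr 6 rfl, hf5.arr 7 rfl, rfl⟩
    · rw [hf5.arr 1 rfl, hf4.arr 1 rfl, e1]
      exact fun _ => rfl
    · rw [hf5.arr 1 rfl, hf4.arr 1 rfl, e1]
      exact fun _ => rfl
    · rw [hf5.arr 3 rfl, hf4.arr 3 rfl]
  have hz5 : ∀ a, 10 ≤ a → a ≤ 17 → ∀ i, s5.arr a i = 0 := by
    intro a h1 h2
    have : s5.arr a = s1.arr a := by
      interval_cases a <;> rw [hf5.arr _ rfl, hf4.arr _ rfl, hf3.arr _ rfl, hf2.arr _ rfl]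
    rw [this, hz1]
    exact fun _ => rfl
  have D := hset.isDisc.disc
  refine Run.seq (Run.insertProg hF hl5 ?_ ?_ (by omega) hM (hz5 10 (by omega) (by omega))
    (hz5 11 (by omega) (by omega)) (hz5 12 (by omega) (by omega))) ?_
  · intro v hv hk
    obtain ⟨i, hi, -, -, hb⟩ := D.b_mem v hv hk
    rw [hb]
    exact hRlt i hi
  · intro v hv hk
    by_cases hp : ∃ i < H.size, H.input.method i = 1 ∧ own i = v
    · obtain ⟨i, hi, -, -, hc⟩ := D.c_mem v hv hk hp
      rw [hc]
      exact ((hIR i hi).trans (hRlt i hi)).le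
    · rw [D.c_eq v hv hk hp]
  rintro s6 hf6 ⟨hcov, hlist⟩
  have hl6 := hl5.frame hf6
  refine Run.seq (Run.stabInit (L := L) hF hl6.sizes hB ?_ ?_) ?_
  · rw [hf6.arr 13 rfl]
    exact hz5 13 (by omega) (by omega)
  · rw [hf6.arr 14 rfl]
    exact hz5 14 (by omega) (by omega)
  intro s7 hf7 hstab
  have hl7 := hl6.frame hf7
  have hcov7 : CoverTree (weight H.size) (s4.arr 7) (s5.arr 8) N
      (solidValues H.input.method (s4.arr 7) (s5.arr 8) H.size) s7 :=
    hcov.congr (hf7.arr 10 rfl) (hf7.arr 11 rfl) (hf7.arr 12 rfl)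
  refine (Run.emptiesProg hF hl7 hM (by omega) hIR hRlt hcov7).mono ?_
  intro s8 hf8 h24
  refine ⟨N, own, pI, pR, s4.arr 7, s5.arr 8, s3.arr 3, s4.arr 5, s4.arr 6, hN, hset,
    hl7.frame hf8, ?_, ?_, ?_, ?_, ?_, h24⟩
  · rw [hf8.arr 5 rfl, hf7.arr 5 rfl, hf6.arr 5 rfl, hf5.arr 5 rfl]
  · exact hcov7.congr (hf8.arr 10 rfl) (hf8.arr 11 rfl) (hf8.arr 12 rfl)
  · unfold StabTree
    rw [hf8.arr 13 rfl, hf8.arr 14 rfl, hf8.arr 15 rfl]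
    exact hstab
  · rw [hf8.arr 18 rfl, hf8.var 27 rfl, hf7.arr 18 rfl, hf7.var 27 rfl]
    exact hlist
  · rw [hf8.arr 17 rfl, hf7.arr 17 rfl, hf6.arr 17 rfl]
    exact hz5 17 (by omega) (by omega)

/-! ### The elimination process -/

section Steps

variable (b c : ℕ → ℕ)

/-- Number of values of `S` covering the gap `g`. -/
def coverCount (S : Finset ℕ) (g : ℕ) : ℕ := (S.filter fun v => b v ≤ g ∧ g < c v).card

/-- The gaps between `g` and `h` covered at most once. -/
def lightGaps (S : Finset ℕ) (g h : ℕ) : Finset ℕ :=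
  (Finset.Ico g h).filter fun x => coverCount b c S x ≤ 1

/-- Decreases in every step of the elimination process. -/
def potential (n : ℕ) (en : ℕ → ℕ) (S Q : Finset ℕ) (ptr : ℕ → ℕ) (g h : ℕ) : ℕ :=
  4 * (∑ x ∈ Finset.range (2 * n), min (coverCount b c S x) 2 + (lightGaps b c S g h).card) +
    4 * ∑ v ∈ S, (en v - ptr v) + 2 * Q.card + if g < h then 1 else 0

/-- State of the elimination process: the values `S` have not been removed; the values of `Q` have
to be processed, the others wait with their operation number `ptr v`; a visible gap for a waiting
operation lies between `g` and `h`. -/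
structure Elim (n : ℕ) (kd own pI pR b c ord st en : ℕ → ℕ) (S Q : Finset ℕ) (ptr : ℕ → ℕ)
    (g h : ℕ) : Prop where
  sub : S ⊆ solidValues kd b c n
  Q_sub : Q ⊆ S
  ptr_mem : ∀ v ∈ S, st v ≤ ptr v ∧ ptr v ≤ en v
  placed : ∀ v ∈ S, ∀ k, st v ≤ k → k < ptr v → Placeable kd own pI pR b c S v (ord k)
  ptr_lt : ∀ v ∈ S, v ∉ Q → ptr v < en v
  visible : ∀ v ∈ S, v ∉ Q → ∀ x, lowGap kd own pI c (ord (ptr v)) ≤ x →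
    x < highGap kd own pR b (ord (ptr v)) → Visible b c S v x → g ≤ x ∧ x < h
  elim : Eliminable kd own pI pR b c n S →
    Eliminable kd own pI pR b c n (solidValues kd b c n)
  le : h ≤ 2 * n

variable {b c} {n : ℕ} {kd own pI pR ord st en : ℕ → ℕ} {S Q : Finset ℕ} {ptr : ℕ → ℕ} {g h x : ℕ}

theorem coverCount_le_one_of_visible {v : ℕ} (hv : Visible b c S v x) :
    coverCount b c S x ≤ 1 := by
  unfold coverCount
  refine (Finset.card_le_card (t := {v}) fun w hw => ?_).trans (by simp)
  rw [Finset.mem_filter] at hw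
  rw [Finset.mem_singleton]
  by_contra hne
  exact hv w hw.1 hne hw.2

theorem coverCount_eq_zero : coverCount b c S x = 0 ↔ ∀ v ∈ S, ¬ Covers b c v x := by
  unfold coverCount Covers
  rw [Finset.card_eq_zero, Finset.filter_eq_empty_iff]

theorem lightGaps_subset {g' h' : ℕ} (hg : g ≤ g') (hh : h' ≤ h) :
    lightGaps b c S g' h' ⊆ lightGaps b c S g h := by
  intro x hx
  simp only [lightGaps, Finset.mem_filter, Finset.mem_Ico] at hx ⊢
  exact ⟨by omega, hx.2⟩

theorem card_lightGaps_lt (hx : g ≤ x) (hxh : x < h) (hc : coverCount b c S x ≤ 1) :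
    (lightGaps b c S (x + 1) h).card + 1 ≤ (lightGaps b c S g h).card := by
  have h1 : x ∉ lightGaps b c S (x + 1) h := by
    simp [lightGaps]
  rw [← Finset.card_insert_of_notMem h1]
  refine Finset.card_le_card fun y hy => ?_
  rcases Finset.mem_insert.1 hy with rfl | hy
  · simp [lightGaps, hx, hxh, hc]
  · exact lightGaps_subset (by omega) le_rfl hy

/-- A gap covered twice is visible to no value, so a window without light gaps can be dropped. The
last summand of the potential pays for this. -/
theorem Elim.skip (he : Elim n kd own pI pR b c ord st en S Q ptr g h) (hgh : g < h)
    (hx : ∀ y, g ≤ y → y < h → 2 ≤ coverCount b c S y) :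
    Elim n kd own pI pR b c ord st en S Q ptr h h ∧
      potential b c n en S Q ptr h h < potential b c n en S Q ptr g h := by
  refine ⟨{ he with visible := fun v hv hQ y h1 h2 h3 => ?_ }, ?_⟩
  · obtain ⟨h4, h5⟩ := he.visible v hv hQ y h1 h2 h3
    have := hx y h4 h5
    have := coverCount_le_one_of_visible h3
    omega
  · have := Finset.card_le_card (lightGaps_subset (b := b) (c := c) (S := S) hgh.le (le_refl h))
    unfold potential
    rw [if_pos hgh, if_neg (lt_irrefl _)]
    omega

theorem Elim.advance (he : Elim n kd own pI pR b c ord st en S Q ptr g h)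
    (hx : ∀ y, g ≤ y → y < x → 2 ≤ coverCount b c S y) :
    Elim n kd own pI pR b c ord st en S Q ptr x h := by
  refine { he with visible := fun v hv hQ y h1 h2 h3 => ?_ }
  obtain ⟨h4, h5⟩ := he.visible v hv hQ y h1 h2 h3
  refine ⟨?_, h5⟩
  by_contra hlt
  have := hx y h4 (by omega)
  have := coverCount_le_one_of_visible h3
  omega

theorem sum_update_ptr {v : ℕ} (hv : v ∈ S) (hlt : ptr v < en v) :
    ∑ w ∈ S, (en w - Function.update ptr v (ptr v + 1) w) + 1 = ∑ w ∈ S, (en w - ptr w) := by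
  rw [← Finset.sum_erase_add _ _ hv, ← Finset.sum_erase_add _ _ hv]
  rw [Function.update_self]
  have : ∑ w ∈ S.erase v, (en w - Function.update ptr v (ptr v + 1) w) =
      ∑ w ∈ S.erase v, (en w - ptr w) :=
    Finset.sum_congr rfl fun w hw => by rw [Function.update_of_ne (Finset.ne_of_mem_erase hw)]
  omega

/-- The next operation of `v` is placeable, and `v` has to be processed. -/
theorem Elim.place (he : Elim n kd own pI pR b c ord st en S Q ptr g h) {v : ℕ} (hv : v ∈ S)
    (hlt : ptr v < en v) (hp : Placeable kd own pI pR b c S v (ord (ptr v))) :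
    Elim n kd own pI pR b c ord st en S (insert v Q) (Function.update ptr v (ptr v + 1)) g h where
  sub := he.sub
  Q_sub := Finset.insert_subset hv he.Q_sub
  ptr_mem w hw := by
    have h1 := he.ptr_mem w hw
    rw [Function.update_apply]
    split_ifs with hwv
    · subst hwv
      omega
    · exact h1
  placed w hw k h1 h2 := by
    rw [Function.update_apply] at h2
    split_ifs at h2 with hwv
    · subst hwv
      rcases Nat.lt_succ_iff_lt_or_eq.1 h2 with h3 | rfl
      · exact he.placed w hw k h1 h3
      · exact hp
    · exact he.placed w hw k h1 h2
  ptr_lt w hw hQ := by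
    rw [Finset.mem_insert, not_or] at hQ
    rw [Function.update_of_ne hQ.1]
    exact he.ptr_lt w hw hQ.2
  visible w hw hQ := by
    rw [Finset.mem_insert, not_or] at hQ
    rw [Function.update_of_ne hQ.1]
    exact he.visible w hw hQ.2
  elim := he.elim
  le := he.le

theorem potential_place {v : ℕ} (hv : v ∈ S) (hlt : ptr v < en v) :
    potential b c n en S (insert v Q) (Function.update ptr v (ptr v + 1)) g h + 2 ≤
      potential b c n en S Q ptr g h := by
  have h1 := sum_update_ptr hv hlt
  have h2 := Finset.card_insert_le v Q
  unfold potential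
  omega

theorem potential_advance (hgx : g ≤ x) :
    potential b c n en S Q ptr x h ≤ potential b c n en S Q ptr g h := by
  have := Finset.card_le_card (lightGaps_subset (b := b) (c := c) (S := S) hgx (le_refl h))
  unfold potential
  split_ifs <;> omega

/-- An uncovered gap is visible to all values, so a waiting operation whose range contains it is
placed. The window still begins at `x`, as further values may wait for the same gap. The pointer
pays 4 and the worklist takes at most 2. -/
theorem Elim.stab (he : Elim n kd own pI pR b c ord st en S Q ptr g h) (hgx : g ≤ x)
    (hx : ∀ y, g ≤ y → y < x → 2 ≤ coverCount b c S y) (h0 : coverCount b c S x = 0) {v : ℕ}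
    (hv : v ∈ S) (hQ : v ∉ Q) (hlo : lowGap kd own pI c (ord (ptr v)) ≤ x)
    (hhi : x < highGap kd own pR b (ord (ptr v))) :
    Elim n kd own pI pR b c ord st en S (insert v Q) (Function.update ptr v (ptr v + 1)) x h ∧
      potential b c n en S (insert v Q) (Function.update ptr v (ptr v + 1)) x h <
        potential b c n en S Q ptr g h := by
  refine ⟨(he.advance hx).place hv (he.ptr_lt v hv hQ)
    ⟨x, hlo, hhi, fun w hw _ => coverCount_eq_zero.1 h0 w hw⟩, ?_⟩
  have h1 := potential_place (b := b) (c := c) (n := n) (Q := Q) (g := x) (h := h) hv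
    (he.ptr_lt v hv hQ)
  have h2 := potential_advance (b := b) (c := c) (n := n) (en := en) (S := S) (Q := Q) (ptr := ptr)
    (h := h) hgx
  omega

theorem Elim.pass (he : Elim n kd own pI pR b c ord st en S Q ptr g h) (hgx : g ≤ x) (hxh : x < h)
    (hx : ∀ y, g ≤ y → y < x → 2 ≤ coverCount b c S y) (h0 : coverCount b c S x ≤ 1)
    (hn : ∀ v ∈ S, v ∉ Q → lowGap kd own pI c (ord (ptr v)) ≤ x →
      ¬ x < highGap kd own pR b (ord (ptr v))) :
    Elim n kd own pI pR b c ord st en S Q ptr (x + 1) h ∧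
      potential b c n en S Q ptr (x + 1) h < potential b c n en S Q ptr g h := by
  refine ⟨{ he with visible := fun v hv hQ y h1 h2 h3 => ?_ }, ?_⟩
  · obtain ⟨h4, h5⟩ := (he.advance hx).visible v hv hQ y h1 h2 h3
    have : y ≠ x := by rintro rfl; exact hn v hv hQ h1 h2
    omega
  · have := card_lightGaps_lt hgx hxh h0
    unfold potential
    split_ifs <;> omega

/-- Only `u` can see a gap that it alone covers. Once `u` is in the worklist the gap is settled,
whether or not it suits the next operation of `u`. The light gap pays 4 and the worklist takes at
most 2. -/
theorem Elim.sole (he : Elim n kd own pI pR b c ord st en S Q ptr g h) (hgx : g ≤ x) (hxh : x < h)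
    (hx : ∀ y, g ≤ y → y < x → 2 ≤ coverCount b c S y) (h0 : coverCount b c S x ≤ 1) {u : ℕ}
    (hu : u ∈ S) (hux : Covers b c u x) :
    Elim n kd own pI pR b c ord st en S (insert u Q) ptr (x + 1) h ∧
      potential b c n en S (insert u Q) ptr (x + 1) h < potential b c n en S Q ptr g h := by
  refine ⟨{ he with
    Q_sub := Finset.insert_subset hu he.Q_sub
    ptr_lt := fun v hv hQ => he.ptr_lt v hv fun h => hQ (Finset.mem_insert_of_mem h)
    visible := fun v hv hQ y h1 h2 h3 => ?_ }, ?_⟩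
  · rw [Finset.mem_insert, not_or] at hQ
    obtain ⟨h4, h5⟩ := (he.advance hx).visible v hv hQ.2 y h1 h2 h3
    have : y ≠ x := by rintro rfl; exact h3 u hu (Ne.symm hQ.1) hux
    omega
  · have := card_lightGaps_lt hgx hxh h0
    have := Finset.card_insert_le u Q
    unfold potential
    split_ifs <;> omega

/-- This monotonicity makes the greedy removal safe: placements found once never have to be revised.
-/
theorem Placeable.mono {S' : Finset ℕ} (hS : S' ⊆ S) {v o : ℕ}
    (hp : Placeable kd own pI pR b c S v o) : Placeable kd own pI pR b c S' v o := by
  obtain ⟨y, h1, h2, h3⟩ := hp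
  exact ⟨y, h1, h2, fun w hw => h3 w (hS hw)⟩

theorem coverCount_erase {v : ℕ} (hv : v ∈ S) (x : ℕ) :
    coverCount b c (S.erase v) x + (if b v ≤ x ∧ x < c v then 1 else 0) = coverCount b c S x := by
  unfold coverCount
  rw [Finset.filter_erase]
  split_ifs with h
  · rw [Finset.card_erase_add_one (Finset.mem_filter.2 ⟨hv, h⟩)]
  · have : v ∉ S.filter fun v => b v ≤ x ∧ x < c v := fun h' => h (Finset.mem_filter.1 h').2
    rw [Finset.erase_eq_of_notMem this, add_zero]

/-- Visibility changes only in gaps covered by `v`, so these form the new window. Each gap of it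
that becomes light had its capped cover count lowered by one, which pays for its entry among the
light gaps. The shrinking worklist releases 2, covering the unit for a nonempty window. -/
theorem Elim.remove (he : Elim n kd own pI pR b c ord st en S Q ptr g h)
    (hex : ∀ o < n, kd o < 3 → ∃ k, st (own o) ≤ k ∧ k < en (own o) ∧ ord k = o)
    (hc : ∀ v ∈ S, c v ≤ 2 * n) (hgh : ¬ g < h) {v : ℕ} (hv : v ∈ Q) (hend : ptr v = en v) :
    Elim n kd own pI pR b c ord st en (S.erase v) (Q.erase v) ptr (b v) (c v) ∧
      potential b c n en (S.erase v) (Q.erase v) ptr (b v) (c v) <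
        potential b c n en S Q ptr g h := by
  have hvS := he.Q_sub hv
  have hsub := Finset.erase_subset v S
  constructor
  · constructor
    · exact hsub.trans he.sub
    · exact Finset.erase_subset_erase v he.Q_sub
    · exact fun w hw => he.ptr_mem w (hsub hw)
    · exact fun w hw k h1 h2 => (he.placed w (hsub hw) k h1 h2).mono hsub
    · exact fun w hw hQ => he.ptr_lt w (hsub hw) fun h =>
        hQ (Finset.mem_erase.2 ⟨Finset.ne_of_mem_erase hw, h⟩)
    · intro w hw hQ y h1 h2 h3
      by_contra hcov
      have hvis : Visible b c S w y := by
        intro u hu huw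
        by_cases huv : u = v
        · rw [huv]
          exact hcov
        · exact h3 u (Finset.mem_erase.2 ⟨huv, hu⟩) huw
      have := he.visible w (hsub hw) (fun h =>
        hQ (Finset.mem_erase.2 ⟨Finset.ne_of_mem_erase hw, h⟩)) y h1 h2 hvis
      omega
    · intro hel
      refine he.elim (.erase hvS (fun o ho hk how => ?_) hel)
      obtain ⟨k, h1, h2, rfl⟩ := hex o ho hk
      rw [how] at h1 h2
      exact he.placed v hvS k h1 (by omega)
    · exact hc v hvS
  · have hcv := hc v hvS
    have h1 : ∑ x ∈ Finset.range (2 * n), min (coverCount b c (S.erase v) x) 2 +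
        (lightGaps b c (S.erase v) (b v) (c v)).card ≤
        ∑ x ∈ Finset.range (2 * n), min (coverCount b c S x) 2 := by
      have h2 : lightGaps b c (S.erase v) (b v) (c v) = (Finset.range (2 * n)).filter fun x =>
          (b v ≤ x ∧ x < c v) ∧ coverCount b c (S.erase v) x ≤ 1 := by
        ext x
        simp only [lightGaps, Finset.mem_filter, Finset.mem_Ico, Finset.mem_range]
        constructor
        · exact fun h => ⟨by omega, h⟩
        · exact fun h => h.2
      rw [h2, Finset.card_filter, ← Finset.sum_add_distrib]
      refine Finset.sum_le_sum fun x _ => ?_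
      have := coverCount_erase (b := b) (c := c) hvS x
      split_ifs at this ⊢ <;> omega
    have h3 := Finset.card_erase_add_one hv
    have h4 : ∑ w ∈ S.erase v, (en w - ptr w) ≤ ∑ w ∈ S, (en w - ptr w) :=
      Finset.sum_le_sum_of_subset hsub
    unfold potential
    rw [if_neg hgh]
    split_ifs <;> omega

theorem Elim.process (he : Elim n kd own pI pR b c ord st en S Q ptr g h) {v : ℕ} (hv : v ∈ Q)
    (hlt : ptr v < en v) (hp : Placeable kd own pI pR b c S v (ord (ptr v))) :
    Elim n kd own pI pR b c ord st en S Q (Function.update ptr v (ptr v + 1)) g h ∧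
      potential b c n en S Q (Function.update ptr v (ptr v + 1)) g h <
        potential b c n en S Q ptr g h := by
  have h1 := he.place (he.Q_sub hv) hlt hp
  have h2 := potential_place (b := b) (c := c) (n := n) (Q := Q) (g := g) (h := h)
    (he.Q_sub hv) hlt
  rw [Finset.insert_eq_of_mem hv] at h1 h2
  exact ⟨h1, by omega⟩

theorem Elim.wait (he : Elim n kd own pI pR b c ord st en S Q ptr g h) {v : ℕ} (hv : v ∈ Q)
    (hlt : ptr v < en v) (hp : ¬ Placeable kd own pI pR b c S v (ord (ptr v))) :
    Elim n kd own pI pR b c ord st en S (Q.erase v) ptr g h ∧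
      potential b c n en S (Q.erase v) ptr g h < potential b c n en S Q ptr g h := by
  refine ⟨{ he with
    Q_sub := (Finset.erase_subset _ _).trans he.Q_sub
    ptr_lt := fun w hw hQ => ?_
    visible := fun w hw hQ x h1 h2 h3 => ?_ }, ?_⟩
  · by_cases hwv : w = v
    · rwa [hwv]
    · exact he.ptr_lt w hw fun h => hQ (Finset.mem_erase.2 ⟨hwv, h⟩)
  · by_cases hwv : w = v
    · subst hwv
      exact absurd ⟨x, h1, h2, h3⟩ hp
    · exact he.visible w hw (fun h => hQ (Finset.mem_erase.2 ⟨hwv, h⟩)) x h1 h2 h3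
  · have := Finset.card_erase_add_one hv
    unfold potential
    omega

/-- With an empty worklist and an exhausted window, every remaining value has an operation without a
visible gap, so no remaining value can be removed, as `Disc.necessary` would require. -/
theorem Elim.not_placeable (he : Elim n kd own pI pR b c ord st en S ∅ ptr g h) (hgh : ¬ g < h)
    {v : ℕ} (hv : v ∈ S) : ptr v < en v ∧ ¬ Placeable kd own pI pR b c S v (ord (ptr v)) := by
  refine ⟨he.ptr_lt v hv (by simp), ?_⟩
  rintro ⟨x, h1, h2, h3⟩
  have := he.visible v hv (by simp) x h1 h2 h3
  omega

/-- The capped counts of `2 * n` gaps contribute at most `16 * n`, the pointers `4 * n` and the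
worklist `2 * n`; the window is empty. -/
theorem potential_init_le (hR : ∑ v ∈ S, (en v - ptr v) ≤ n) (hQ : Q.card ≤ n) :
    potential b c n en S Q ptr 0 0 ≤ 22 * n := by
  have h1 : ∑ x ∈ Finset.range (2 * n), min (coverCount b c S x) 2 ≤ 4 * n := by
    calc _ ≤ ∑ _x ∈ Finset.range (2 * n), 2 := Finset.sum_le_sum fun x _ => min_le_right _ _
      _ = 4 * n := by simp; omega
  have h2 : lightGaps b c S 0 0 = ∅ := by simp [lightGaps]
  unfold potential
  rw [h2, if_neg (lt_irrefl _), Finset.card_empty]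
  omega

/-- Weights lie between `n + 1` and `2 * n`: two of them always reach `2 * (n + 1)`, a single one
never does. -/
theorem load_lt_iff (hS : ∀ v ∈ S, v < n) :
    load (weight n) b c S x < 2 * (n + 1) ↔ coverCount b c S x ≤ 1 := by
  unfold load coverCount
  constructor
  · intro hlt
    by_contra hc
    have : (S.filter fun v => b v ≤ x ∧ x < c v).card * (n + 1) ≤
        ∑ v ∈ S with b v ≤ x ∧ x < c v, weight n v := by
      rw [← smul_eq_mul, ← Finset.sum_const]
      exact Finset.sum_le_sum fun v _ => by unfold weight; omega
    nlinarith
  · intro hc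
    rcases Nat.le_one_iff_eq_zero_or_eq_one.1 hc with h | h
    · rw [Finset.card_eq_zero.1 h]
      simp
    · obtain ⟨u, hu⟩ := Finset.card_eq_one.1 h
      have huS : u ∈ S := (Finset.mem_filter.1 (hu ▸ Finset.mem_singleton_self u)).1
      rw [hu, Finset.sum_singleton]
      have := hS u huS
      unfold weight
      omega

theorem load_eq_zero : load (weight n) b c S x = 0 ↔ coverCount b c S x = 0 := by
  rw [load_eq_zero_iff (fun v => by unfold weight; omega), coverCount_eq_zero]

/-- The reason for unequal weights: if a gap has a single covering value, subtracting the offset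
from the load names it. -/
theorem load_sole (h0 : coverCount b c S x ≤ 1) (hne : load (weight n) b c S x ≠ 0) :
    load (weight n) b c S x - (n + 1) ∈ S ∧ Covers b c (load (weight n) b c S x - (n + 1)) x := by
  rw [Ne, load_eq_zero] at hne
  obtain ⟨u, hu⟩ := Finset.card_eq_one.1 (show _ = 1 from (by unfold coverCount at *; omega :
    (S.filter fun v => b v ≤ x ∧ x < c v).card = 1))
  have hu' := Finset.mem_filter.1 (hu ▸ Finset.mem_singleton_self u)
  unfold load
  rw [hu, Finset.sum_singleton]
  unfold weight
  rw [show n + 1 + u - (n + 1) = u by omega]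
  exact hu'

/-- A visible gap is either free or covered by `v` alone. These two cases correspond to two searches
in the cover tree. -/
theorem visible_iff {v : ℕ} (hv : v ∈ S) : Visible b c S v x ↔
    coverCount b c S x = 0 ∨ coverCount b c S x ≤ 1 ∧ b v ≤ x ∧ x < c v := by
  constructor
  · intro hvis
    by_cases hc : b v ≤ x ∧ x < c v
    · exact .inr ⟨coverCount_le_one_of_visible hvis, hc⟩
    · refine .inl (coverCount_eq_zero.2 fun w hw => ?_)
      by_cases hwv : w = v
      · rw [hwv]
        exact hc
      · exact hvis w hw hwv
  · rintro (h | ⟨h, hc⟩) w hw hwv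
    · exact coverCount_eq_zero.1 h w hw
    · intro hw'
      unfold coverCount at h
      rw [Finset.card_le_one] at h
      exact hwv (h w (Finset.mem_filter.2 ⟨hw, hw'⟩) v (Finset.mem_filter.2 ⟨hv, hc⟩))

end Steps

/-! ### The elimination program -/

/-- Loop rule with a rank. -/
theorem Run.loopRank {W : ℕ} {I : Input} {Ls : List ℕ} {L k : ℕ} {b : Expr} {p : Program}
    {s : Store} (Inv : ℕ → Store → Prop) (h0 : Inv k s) (hL : k ≤ L)
    (hstep : ∀ k s', Frame p s s' → Inv k s' → b.eval W I s' ≠ 0 →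
      Run W I Ls p s' (fun s'' => ∃ k' < k, Inv k' s'')) :
    Run W I (L :: Ls) (.loop b p) s (fun s' => (∃ k, Inv k s') ∧ b.eval W I s' = 0) := by
  refine Run.loop (fun s' => ∃ k, Inv k s') (fun s' => sInf {k | Inv k s'}) ⟨k, h0⟩
    ((Nat.sInf_le h0).trans hL) fun s' hf hI hb => ?_
  refine (hstep _ s' hf (Nat.sInf_mem hI) hb).mono ?_
  rintro s'' - ⟨k', hlt, hI'⟩
  exact ⟨⟨k', hI'⟩, (Nat.sInf_le hI').trans_lt hlt⟩

/-- The values of `A` wait in the second tree, with the lower and upper gaps `lo` and `hi`. -/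
structure Stabs (n N : ℕ) (lo hi : ℕ → ℕ) (A : Finset ℕ) (μ who : ℕ → ℕ) : Prop where
  mem : ∀ v ∈ A, μ (2 * n - lo v) = 2 * n - hi v ∧ who (2 * n - lo v) = v
  other : ∀ x < N, μ x = N ∨ ∃ v ∈ A, x = 2 * n - lo v

section Stabs

variable {n N : ℕ} {lo hi : ℕ → ℕ} {A : Finset ℕ} {μ who : ℕ → ℕ}

theorem Stabs.congr {lo' hi' : ℕ → ℕ} (h : Stabs n N lo hi A μ who) (hlo : ∀ v ∈ A, lo' v = lo v)
    (hhi : ∀ v ∈ A, hi' v = hi v) : Stabs n N lo' hi' A μ who := by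
  refine ⟨fun v hv => ?_, fun x hx => ?_⟩
  · rw [hlo v hv, hhi v hv]
    exact h.mem v hv
  · rcases h.other x hx with h1 | ⟨v, hv, h1⟩
    · exact .inl h1
    · exact .inr ⟨v, hv, by rw [hlo v hv, h1]⟩

theorem Stabs.insert {v : ℕ} (h : Stabs n N lo hi A μ who)
    (hlo : ∀ w ∈ A, 2 * n - lo w ≠ 2 * n - lo v) :
    Stabs n N lo hi (insert v A) (Function.update μ (2 * n - lo v) (2 * n - hi v))
      (Function.update who (2 * n - lo v) v) := by
  refine ⟨fun w hw => ?_, fun x hx => ?_⟩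
  · rcases Finset.mem_insert.1 hw with rfl | hw
    · simp
    · rw [Function.update_of_ne (hlo w hw), Function.update_of_ne (hlo w hw)]
      exact h.mem w hw
  · by_cases hxv : x = 2 * n - lo v
    · exact .inr ⟨v, Finset.mem_insert_self _ _, hxv⟩
    · rw [Function.update_of_ne hxv]
      rcases h.other x hx with h1 | ⟨w, hw, h1⟩
      · exact .inl h1
      · exact .inr ⟨w, Finset.mem_insert_of_mem hw, h1⟩

theorem Stabs.erase {v : ℕ} (h : Stabs n N lo hi A μ who)
    (hlo : ∀ w ∈ A, w ≠ v → 2 * n - lo w ≠ 2 * n - lo v) :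
    Stabs n N lo hi (A.erase v) (Function.update μ (2 * n - lo v) N) who := by
  refine ⟨fun w hw => ?_, fun x hx => ?_⟩
  · rw [Finset.mem_erase] at hw
    rw [Function.update_of_ne (hlo w hw.2 hw.1)]
    exact h.mem w hw.2
  · by_cases hxv : x = 2 * n - lo v
    · rw [hxv, Function.update_self]
      exact .inl rfl
    · rw [Function.update_of_ne hxv]
      rcases h.other x hx with h1 | ⟨w, hw, h1⟩
      · exact .inl h1
      · refine .inr ⟨w, Finset.mem_erase.2 ⟨?_, hw⟩, h1⟩
        rintro rfl
        exact hxv h1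

theorem Stabs.le {B : ℕ} (h : Stabs n N lo hi A μ who) (hN : N ≤ B) (hn : 2 * n ≤ B) :
    ∀ x < N, μ x ≤ B := by
  intro x hx
  rcases h.other x hx with h1 | ⟨w, hw, rfl⟩
  · omega
  · rw [(h.mem w hw).1]
    omega

end Stabs

/-- The store represents the state of the elimination process. -/
structure Rep (n N : ℕ) (kd own pI pR b c ord en : ℕ → ℕ) (S Q : Finset ℕ) (ptr : ℕ → ℕ)
    (g h : ℕ) (s : Store) : Prop where
  loaded : Loaded n N pI pR b c ord en s
  ptr_eq : s.arr 5 = ptr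
  cover : CoverTree (weight n) b c N S s
  list : Listing (s.arr 18) (s.var 27) Q
  card : s.var 26 = S.card
  cur : s.var 28 = g
  top : s.var 29 = h
  waiting : ∀ v ∈ S, s.arr 17 v = 0 ↔ v ∈ Q
  stab : ∃ μ, StabTree N μ s ∧ Stabs n N (fun v => lowGap kd own pI c (ord (ptr v)))
    (fun v => highGap kd own pR b (ord (ptr v))) (S \ Q) μ (s.arr 16)

section Rep

variable {n N : ℕ} {kd own pI pR b c ord en : ℕ → ℕ} {S Q : Finset ℕ} {ptr : ℕ → ℕ} {g h : ℕ}
  {s s' : Store}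

theorem Rep.congr (hR : Rep n N kd own pI pR b c ord en S Q ptr g h s)
    (hl : Loaded n N pI pR b c ord en s') (h5 : s'.arr 5 = s.arr 5) (h10 : s'.arr 10 = s.arr 10)
    (h11 : s'.arr 11 = s.arr 11) (h12 : s'.arr 12 = s.arr 12) (h13 : s'.arr 13 = s.arr 13)
    (h14 : s'.arr 14 = s.arr 14) (h15 : s'.arr 15 = s.arr 15) (h16 : s'.arr 16 = s.arr 16)
    (h17 : s'.arr 17 = s.arr 17) (h18 : s'.arr 18 = s.arr 18) (h26 : s'.var 26 = s.var 26)
    (h27 : s'.var 27 = s.var 27) (h28 : s'.var 28 = s.var 28) (h29 : s'.var 29 = s.var 29) :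
    Rep n N kd own pI pR b c ord en S Q ptr g h s' where
  loaded := hl
  ptr_eq := h5.trans hR.ptr_eq
  cover := hR.cover.congr h10 h11 h12
  list := by rw [h18, h27]; exact hR.list
  card := h26.trans hR.card
  cur := h28.trans hR.cur
  top := h29.trans hR.top
  waiting := by rw [h17]; exact hR.waiting
  stab := by
    obtain ⟨μ, h1, h2⟩ := hR.stab
    refine ⟨μ, ?_, ?_⟩
    · unfold StabTree
      rw [h13, h14, h15]
      exact h1
    · rw [h16]
      exact h2

theorem Rep.frame {p : Program} (hR : Rep n N kd own pI pR b c ord en S Q ptr g h s)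
    (hf : Frame p s s')
    (hv : ([20, 21, 22, 23, 26, 27, 28, 29].all fun x => !p.writesVar x) = true := by rfl)
    (ha : ([1, 3, 5, 6, 7, 8, 10, 11, 12, 13, 14, 15, 16, 17, 18].all fun x => !p.writesArr x) =
      true := by rfl) : Rep n N kd own pI pR b c ord en S Q ptr g h s' := by
  simp only [List.all_cons, List.all_nil, Bool.and_true, Bool.and_eq_true, Bool.not_eq_true'] at hv ha
  obtain ⟨v0, v1, v2, v3, v6, v7, v8, v9⟩ := hv
  obtain ⟨a1, a3, a5, a6, a7, a8, a10, a11, a12, a13, a14, a15, a16, a17, a18⟩ := ha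
  exact hR.congr (hR.loaded.frame hf v0 v1 v2 v3 a1 a3 a6 a7 a8) (hf.arr _ a5) (hf.arr _ a10)
    (hf.arr _ a11) (hf.arr _ a12) (hf.arr _ a13) (hf.arr _ a14) (hf.arr _ a15) (hf.arr _ a16)
    (hf.arr _ a17) (hf.arr _ a18) (hf.var _ v6) (hf.var _ v7) (hf.var _ v8) (hf.var _ v9)

theorem Rep.setVar {x v : ℕ} (hR : Rep n N kd own pI pR b c ord en S Q ptr g h s)
    (hx : x < 20 ∨ 30 ≤ x) : Rep n N kd own pI pR b c ord en S Q ptr g h (s.setVar x v) := by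
  refine hR.congr (hR.loaded.setVar (by omega)) rfl rfl rfl rfl rfl rfl rfl rfl rfl rfl ?_ ?_ ?_ ?_
  all_goals rw [Store.setVar_var, if_neg (by omega)]

theorem Rep.setCur (hR : Rep n N kd own pI pR b c ord en S Q ptr g h s) (x : ℕ) :
    Rep n N kd own pI pR b c ord en S Q ptr x h (s.setVar 28 x) :=
  { hR with
    loaded := hR.loaded.setVar (by norm_num)
    list := by simpa using hR.list
    card := by simpa using hR.card
    cur := by simp
    top := by simpa using hR.top }

theorem Loaded.setArr {a i v : ℕ} (hl : Loaded n N pI pR b c ord en s)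
    (ha : a ∉ [1, 3, 6, 7, 8] := by decide) : Loaded n N pI pR b c ord en (s.setArr a i v) := by
  simp only [List.mem_cons, List.not_mem_nil, or_false, not_or] at ha
  obtain ⟨a1, a3, a6, a7, a8⟩ := ha
  have : ∀ d, a ≠ d → (s.setArr a i v).arr d = s.arr d := fun d hd => by
    rw [Store.setArr_arr, if_neg hd.symm]
  refine ⟨hl.sizes.setArr, ?_, ?_, ?_, ?_, ?_, ?_⟩
  · rw [this 1 a1]; exact hl.arrI
  · rw [this 1 a1]; exact hl.arrR
  · rw [this 3 a3, hl.arr3]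
  · rw [this 6 a6, hl.arr6]
  · rw [this 7 a7, hl.arr7]
  · rw [this 8 a8, hl.arr8]

/-- Values in the worklist are absent from the tree of waiting operations, so their pointers can
move without touching it. -/
theorem Rep.incr {v : ℕ} (hR : Rep n N kd own pI pR b c ord en S Q ptr g h s) (hv : v ∈ Q) :
    Rep n N kd own pI pR b c ord en S Q (Function.update ptr v (ptr v + 1)) g h
      (s.setArr 5 v (ptr v + 1)) := by
  have key : ∀ a, a ≠ 5 → (s.setArr 5 v (ptr v + 1)).arr a = s.arr a := fun a ha => by
    rw [Store.setArr_arr, if_neg ha]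
  obtain ⟨μ, h1, h2⟩ := hR.stab
  refine ⟨hR.loaded.setArr, ?_, ?_, ?_, hR.card, hR.cur, hR.top, ?_, ⟨μ, ?_, ?_⟩⟩
  · rw [Store.setArr_arr, if_pos rfl, hR.ptr_eq]
  · exact hR.cover.congr (key _ (by norm_num)) (key _ (by norm_num)) (key _ (by norm_num))
  · rw [key _ (by norm_num)]
    exact hR.list
  · rw [key _ (by norm_num)]
    exact hR.waiting
  · unfold StabTree
    rw [key _ (by norm_num), key _ (by norm_num), key _ (by norm_num)]
    exact h1
  · rw [key _ (by norm_num)]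
    have hne : ∀ w ∈ S \ Q, w ≠ v := by
      rintro w hw rfl
      exact (Finset.mem_sdiff.1 hw).2 hv
    refine h2.congr (fun w hw => ?_) (fun w hw => ?_)
    all_goals simp only [Function.update_of_ne (hne w hw)]

end Rep

/-- Compute the range of gaps of the next operation of the value `𝐯 31`. -/
def rangeProg : Program :=
  (34 ≔ .get 3 (.get 5 (𝐯 31))) ;;
  .ite (.method (𝐯 34) =ₑ 𝐜 1) (32 ≔ .get 8 (𝐯 31)) (32 ≔ .get 1 (𝐜 2 *ₑ 𝐯 34)) ;;
  .ite (.method (𝐯 34) =ₑ 𝐜 0) (33 ≔ .get 7 (𝐯 31)) (33 ≔ .get 1 (𝐜 2 *ₑ 𝐯 34 +ₑ 𝐜 1))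

/-- Stop waiting for the value `𝐯 31`. -/
def wakeProg : Program :=
  rangeProg ;; (7 ≔ 𝐯 21 -ₑ 𝐯 32) ;; (8 ≔ 𝐯 22) ;; stabSet ;; .put 17 (𝐯 31) (𝐜 0) ;;
    .put 18 (𝐯 27) (𝐯 31) ;; (27 ≔ 𝐯 27 +ₑ 𝐜 1)

/-- Process the gaps from `𝐯 28` to `𝐯 29`. -/
def gapProg : Program :=
  (7 ≔ 𝐯 28) ;; (8 ≔ 𝐜 2 *ₑ 𝐯 23) ;; findFrom 10 11 12 ;;
  .ite (𝐯 9 <ₑ 𝐯 29)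
    ((35 ≔ 𝐯 9) ;; (36 ≔ 𝐯 10) ;;
      .ite (𝐯 36 =ₑ 𝐜 0)
        ((7 ≔ 𝐯 21 -ₑ 𝐯 35) ;; (8 ≔ 𝐯 21 -ₑ 𝐯 35) ;; findFrom 13 14 15 ;;
          .ite (𝐯 9 <ₑ 𝐯 22)
            ((31 ≔ .get 16 (𝐯 9)) ;; wakeProg ;; .put 5 (𝐯 31) (.get 5 (𝐯 31) +ₑ 𝐜 1) ;;
              (28 ≔ 𝐯 35))
            (28 ≔ 𝐯 35 +ₑ 𝐜 1))
        ((31 ≔ 𝐯 36 -ₑ 𝐯 23) ;; .ite (.get 17 (𝐯 31) =ₑ 𝐜 0) .skip wakeProg ;;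
          (28 ≔ 𝐯 35 +ₑ 𝐜 1)))
    (28 ≔ 𝐯 29)

/-- Test whether the next operation of the value `𝐯 31` is placeable. -/
def testProg : Program :=
  rangeProg ;; (7 ≔ 𝐯 32) ;; (8 ≔ 𝐜 1) ;; findFrom 10 11 12 ;;
  .ite (𝐯 9 <ₑ 𝐯 33) (37 ≔ 𝐜 1)
    ((7 ≔ 𝐯 32 +ₑ (.get 7 (𝐯 31) -ₑ 𝐯 32)) ;; (8 ≔ 𝐜 2 *ₑ 𝐯 23) ;; findFrom 10 11 12 ;;
      (37 ≔ (𝐯 9 <ₑ 𝐯 33) *ₑ (𝐯 9 <ₑ .get 8 (𝐯 31))))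

/-- Process the last value in the worklist. -/
def workProg : Program :=
  (31 ≔ .get 18 (𝐯 27 -ₑ 𝐜 1)) ;;
  .ite (.get 5 (𝐯 31) =ₑ .get 6 (𝐯 31))
    ((7 ≔ .get 7 (𝐯 31)) ;; (8 ≔ .get 8 (𝐯 31)) ;; (9 ≔ 𝐯 23 +ₑ 𝐯 31) ;; coverUpd .sub ;;
      (26 ≔ 𝐯 26 -ₑ 𝐜 1) ;; (27 ≔ 𝐯 27 -ₑ 𝐜 1) ;; (28 ≔ .get 7 (𝐯 31)) ;; (29 ≔ .get 8 (𝐯 31)))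
    (testProg ;;
      .ite (𝐯 37 =ₑ 𝐜 0)
        ((7 ≔ 𝐯 21 -ₑ 𝐯 32) ;; (8 ≔ 𝐯 21 -ₑ 𝐯 33) ;; stabSet ;; .put 16 (𝐯 7) (𝐯 31) ;;
          .put 17 (𝐯 31) (𝐜 1) ;; (27 ≔ 𝐯 27 -ₑ 𝐜 1))
        (.put 5 (𝐯 31) (.get 5 (𝐯 31) +ₑ 𝐜 1)))

def elimProg : Program :=
  (26 ≔ 𝐯 27) ;; (28 ≔ 𝐜 0) ;; (29 ≔ 𝐜 0) ;;
    .loop ((𝐯 28 <ₑ 𝐯 29) +ₑ (𝐜 0 <ₑ 𝐯 27)) (.ite (𝐯 28 <ₑ 𝐯 29) gapProg workProg) ;;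
    (0 ≔ (𝐯 24 =ₑ 𝐜 0) *ₑ (𝐯 26 =ₑ 𝐜 0))

section Elim

variable {P V : Type*} [LinearOrder V] {H : History P V} {N W L : ℕ} {Ls : List ℕ}
  {own pI pR b c ord st en : ℕ → ℕ} {S Q : Finset ℕ} {ptr : ℕ → ℕ} {g h : ℕ} {s : Store}

/-- The next operation of `v`. -/
theorem History.Setup.next (hset : H.Setup own pI pR b c ord st en)
    (he : Elim H.size H.input.method own pI pR b c ord st en S Q ptr g h) {v : ℕ} (hv : v ∈ S)
    (hlt : ptr v < en v) : v < H.size ∧ H.input.method v = 0 ∧ b v < c v ∧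
      ord (ptr v) < H.size ∧ H.input.method (ord (ptr v)) < 3 ∧ own (ord (ptr v)) = v := by
  have h1 := he.sub hv
  simp only [solidValues, Finset.mem_filter, Finset.mem_range] at h1
  exact ⟨h1.1, h1.2.1, h1.2.2, hset.seg v h1.1 h1.2.1 _ (he.ptr_mem v hv).1 hlt⟩

theorem History.Setup.lowGap_eq (hset : H.Setup own pI pR b c ord st en)
    (he : Elim H.size H.input.method own pI pR b c ord st en S Q ptr g h) {v : ℕ} (hv : v ∈ S)
    (hlt : ptr v < en v) : ∃ i < H.size, own i = v ∧
      lowGap H.input.method own pI c (ord (ptr v)) = pI i := by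
  obtain ⟨h1, h2, h3, h4, h5, h6⟩ := hset.next he hv hlt
  unfold lowGap
  split_ifs with hk
  · obtain ⟨i, i1, i2, i3, i4⟩ := hset.isDisc.disc.c_mem v h1 h2 ⟨_, h4, hk, h6⟩
    exact ⟨i, i1, i3, by rw [h6, i4]⟩
  · exact ⟨_, h4, h6, rfl⟩

theorem History.Setup.lowGap_lt (hset : H.Setup own pI pR b c ord st en)
    (he : Elim H.size H.input.method own pI pR b c ord st en S Q ptr g h) {v : ℕ} (hv : v ∈ S)
    (hlt : ptr v < en v) : lowGap H.input.method own pI c (ord (ptr v)) < 2 * H.size := by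
  obtain ⟨i, hi, -, he⟩ := hset.lowGap_eq he hv hlt
  rw [he]
  exact (hset.isDisc.disc.pI_lt i hi).trans (hset.isDisc.disc.pR_lt i hi)

/-- The lower gap of a next operation is the rank of an invocation of some operation of the same
value. Such ranks are distinct, so no two values wait at the same leaf and one entry for each leaf
suffices. -/
theorem History.Setup.lowGap_inj (hset : H.Setup own pI pR b c ord st en)
    (he : Elim H.size H.input.method own pI pR b c ord st en S Q ptr g h) {v w : ℕ} (hv : v ∈ S)
    (hlt : ptr v < en v) (hw : w ∈ S) (hlt' : ptr w < en w) (hvw : v ≠ w) :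
    2 * H.size - lowGap H.input.method own pI c (ord (ptr v)) ≠
      2 * H.size - lowGap H.input.method own pI c (ord (ptr w)) := by
  have h1 := hset.lowGap_lt he hv hlt
  have h2 := hset.lowGap_lt he hw hlt'
  obtain ⟨i, i1, i2, i3⟩ := hset.lowGap_eq he hv hlt
  obtain ⟨j, j1, j2, j3⟩ := hset.lowGap_eq he hw hlt'
  rw [i3] at h1 ⊢
  rw [j3] at h2 ⊢
  intro heq
  have := hset.isDisc.disc.pI_inj i i1 j j1 (by omega)
  exact hvw (by rw [← i2, ← j2, this])

theorem History.Setup.b_lt (hset : H.Setup own pI pR b c ord st en) {v : ℕ} (hv : v < H.size)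
    (hk : H.input.method v = 0) : b v < 2 * H.size := by
  obtain ⟨i, hi, -, -, hb⟩ := hset.isDisc.disc.b_mem v hv hk
  rw [hb]
  exact hset.isDisc.disc.pR_lt i hi

theorem History.Setup.c_le (hset : H.Setup own pI pR b c ord st en) {v : ℕ} (hv : v < H.size)
    (hk : H.input.method v = 0) : c v ≤ 2 * H.size := by
  by_cases hp : ∃ i < H.size, H.input.method i = 1 ∧ own i = v
  · obtain ⟨i, hi, -, -, hc⟩ := hset.isDisc.disc.c_mem v hv hk hp
    rw [hc]
    exact ((hset.isDisc.disc.pI_lt i hi).trans (hset.isDisc.disc.pR_lt i hi)).le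
  · rw [hset.isDisc.disc.c_eq v hv hk hp]

theorem History.Setup.highGap_lt (hset : H.Setup own pI pR b c ord st en)
    (he : Elim H.size H.input.method own pI pR b c ord st en S Q ptr g h) {v : ℕ} (hv : v ∈ S)
    (hlt : ptr v < en v) : highGap H.input.method own pR b (ord (ptr v)) < 2 * H.size := by
  obtain ⟨h1, h2, h3, h4, h5, h6⟩ := hset.next he hv hlt
  unfold highGap
  split_ifs with hk
  · rw [h6]
    exact hset.b_lt h1 h2
  · exact hset.isDisc.disc.pR_lt _ h4

theorem Run.rangeProg (hset : H.Setup own pI pR b c ord st en) (hF : Fits W H.size N L)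
    (he : Elim H.size H.input.method own pI pR b c ord st en S Q ptr g h)
    (hR : Rep H.size N H.input.method own pI pR b c ord en S Q ptr g h s) {v : ℕ} (hv : v ∈ S)
    (hlt : ptr v < en v) (h31 : s.var 31 = v) :
    Run W H.input Ls rangeProg s (fun s' =>
      s'.var 32 = lowGap H.input.method own pI c (ord (ptr v)) ∧
      s'.var 33 = highGap H.input.method own pR b (ord (ptr v))) := by
  obtain ⟨h1, h2, h3, h4, h5, h6⟩ := hset.next he hv hlt
  have hn := hF.hn
  have hl := hR.loaded
  generalize ho : ord (ptr v) = o at *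
  have hM : H.input.method o % W = H.input.method o := Nat.mod_eq_of_lt (by omega)
  refine Run.assign_seq o (by simp [h31, hl.arr3, hR.ptr_eq, ho]) ?_
  refine Run.seq (R := fun s' => s'.var 32 = lowGap H.input.method own pI c o) ?_ ?_
  · refine Run.ite (fun c' => ?_) (fun c' => ?_)
    · have hk : H.input.method o = 1 := by
        by_contra hk
        simp (disch := omega) [Nat.mod_eq_of_lt, hk, hM] at c'
      exact Run.assign (v := c v) (by simp [h31, hl.arr8]) (by simp [lowGap, hk, h6])
    · have hk : H.input.method o ≠ 1 := by
        intro hk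
        simp (disch := omega) [Nat.mod_eq_of_lt, hk] at c'
      exact Run.assign (v := pI o) (by simp (disch := omega) [Nat.mod_eq_of_lt, hl.arrI])
        (by simp [lowGap, hk])
  · intro s2 hf2 h32
    have e34 : s2.var 34 = o := by rw [hf2.var 34 rfl]; simp
    have e31 : s2.var 31 = v := by rw [hf2.var 31 rfl]; simp [h31]
    have hl2 := (hl.setVar (x := 34) (v := o) (by norm_num)).frame hf2
    refine Run.ite (fun c' => ?_) (fun c' => ?_)
    · have hk : H.input.method o = 0 := by
        by_contra hk
        simp (disch := omega) [Nat.mod_eq_of_lt, hk, e34, hM] at c'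
      exact Run.assign (v := b v) (by simp [e31, hl2.arr7]) (by simp [highGap, hk, h6, h32])
    · have hk : H.input.method o ≠ 0 := by
        intro hk
        simp (disch := omega) [Nat.mod_eq_of_lt, hk, e34] at c'
      exact Run.assign (v := pR o) (by simp (disch := omega) [Nat.mod_eq_of_lt, hl2.arrR, e34])
        (by simp [highGap, hk, h32])

/-- The leaf is found by recomputing the range of the next operation, so waking must precede any
advance of the pointer. -/
theorem Run.wakeProg (hset : H.Setup own pI pR b c ord st en) (hF : Fits W H.size N L)
    (he : Elim H.size H.input.method own pI pR b c ord st en S Q ptr g h)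
    (hR : Rep H.size N H.input.method own pI pR b c ord en S Q ptr g h s) {v : ℕ} (hv : v ∈ S)
    (hQ : v ∉ Q) (h31 : s.var 31 = v) :
    Run W H.input (L :: Ls) wakeProg s
      (Rep H.size N H.input.method own pI pR b c ord en S (insert v Q) ptr g h) := by
  have hlt := he.ptr_lt v hv hQ
  obtain ⟨h1, h2, h3, h4, h5, h6⟩ := hset.next he hv hlt
  have hn := hF.hn
  have hNn := hF.leaf.lt
  have hNle := hF.leaf.le
  have hlo := hset.lowGap_lt he hv hlt
  obtain ⟨k, hk⟩ := hF.leaf.pow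
  refine Run.seq (Run.rangeProg hset hF he hR hv hlt h31) ?_
  rintro s1 hf1 ⟨h32, -⟩
  have hR1 := hR.frame hf1
  have e31 : s1.var 31 = v := (hf1.var 31 rfl).trans h31
  set x := 2 * H.size - lowGap H.input.method own pI c (ord (ptr v)) with hx
  have hs := hR1.loaded.sizes
  refine Run.assign_seq x (by
    simp (disch := omega) [Nat.mod_eq_of_lt, hs.v21, h32]
    exact hx.symm) ?_
  refine Run.assign_seq N (by simp [hs.v22]) ?_
  have hR2 := (hR1.setVar (x := 7) (v := x) (by norm_num)).setVar (x := 8) (v := N) (by norm_num)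
  obtain ⟨μ, hμ1, hμ2⟩ := hR2.stab
  refine Run.seq (Run.stabSet (B := treeBound H.size) (x := x) (t := N) hμ1
    (hμ2.le (by unfold treeBound; omega) (by unfold treeBound; omega)) (by unfold treeBound; omega)
    hk hF.hN hF.hT hF.depth (by omega) (by simp [hs.v22]) (by simp) (by simp)) ?_
  intro s3 hf3 hstab
  have hl3 := hR2.loaded.frame hf3
  have f31 : s3.var 31 = v := by rw [hf3.var 31 rfl]; simp [e31]
  have f27 : s3.var 27 = s1.var 27 := by rw [hf3.var 27 rfl]; simp
  have f18 : s3.arr 18 = s1.arr 18 := by rw [hf3.arr 18 rfl]; simp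
  have f17 : s3.arr 17 = s1.arr 17 := by rw [hf3.arr 17 rfl]; simp
  have f16 : s3.arr 16 = s1.arr 16 := by rw [hf3.arr 16 rfl]; simp
  have f5 : s3.arr 5 = s1.arr 5 := by rw [hf3.arr 5 rfl]; simp
  have hcard : s1.var 27 ≤ H.size := by
    rw [← hR1.list.card]
    refine (Finset.card_le_card (he.Q_sub.trans he.sub)).trans
      ((Finset.card_filter_le _ _).trans (Finset.card_range _).le)
  refine Run.put_seq v 0 (by simp [f31]) (by simp) ?_
  refine Run.put_seq (s1.var 27) v (by simp [f27]) (by simp [f31]) ?_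
  refine Run.assign (v := s1.var 27 + 1) (by simp (disch := omega) [Nat.mod_eq_of_lt, f27]) ?_
  refine ⟨(hl3.setArr.setArr).setVar (by norm_num), ?_, ?_, ?_, ?_, ?_, ?_, ?_, ?_⟩
  · simp [Store.setArr_arr, f5, hR1.ptr_eq]
  · refine hR2.cover.congr ?_ ?_ ?_
    all_goals
      simp only [Store.setVar_arr, Store.setArr_arr]
      norm_num
      rw [hf3.arr _ rfl]
      simp
  · simpa [Store.setArr_arr, f18] using hR1.list.push hQ
  · simp [hf3.var 26 rfl, hR1.card]
  · simp [hf3.var 28 rfl, hR1.cur]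
  · simp [hf3.var 29 rfl, hR1.top]
  · intro w hw
    have := hR1.waiting w hw
    simp only [Store.setVar_arr, Store.setArr_arr]
    norm_num
    rw [Function.update_apply, f17]
    by_cases hwv : w = v
    · simp [hwv]
    · simp [hwv, this]
  · refine ⟨Function.update μ x N, ?_, ?_⟩
    · exact hstab
    · simp only [Store.setVar_arr, Store.setArr_arr]
      norm_num
      rw [f16]
      have hset' : S \ insert v Q = (S \ Q).erase v := by
        ext w
        simp only [Finset.mem_sdiff, Finset.mem_insert, Finset.mem_erase]
        tauto
      rw [hset']
      refine hμ2.erase fun w hw hwv => ?_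
      rw [Finset.mem_sdiff] at hw
      exact hset.lowGap_inj he hw.1 (he.ptr_lt w hw.1 hw.2) hv hlt hwv

end Elim

/-! ### Scanning the window and processing the worklist. -/

section Elim

variable {P V : Type*} [LinearOrder V] {H : History P V} {N W L : ℕ} {Ls : List ℕ}
  {own pI pR b c ord st en : ℕ → ℕ} {S Q : Finset ℕ} {ptr : ℕ → ℕ} {g h : ℕ} {s : Store}

theorem Elim.lt (he : Elim H.size H.input.method own pI pR b c ord st en S Q ptr g h) :
    ∀ v ∈ S, v < H.size := fun v hv => by
  have := he.sub hv
  simp only [solidValues, Finset.mem_filter, Finset.mem_range] at this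
  exact this.1

theorem Elim.b_lt_c (he : Elim H.size H.input.method own pI pR b c ord st en S Q ptr g h) :
    ∀ v ∈ S, b v < c v := fun _ hv => (Finset.mem_filter.1 (he.sub hv)).2.2

/-- Find the first gap `𝐯 9 ≥ 𝐯 7` that is covered at most once. -/
theorem Run.findLight (hF : Fits W H.size N L)
    (he : Elim H.size H.input.method own pI pR b c ord st en S Q ptr g h)
    (hC : CoverTree (weight H.size) b c N S s) (hS : Sizes H.size N s) {i : ℕ} (hi : i < N)
    (h7 : s.var 7 = i) (h8 : s.var 8 = 2 * (H.size + 1)) :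
    Run W H.input (L :: Ls) (StackMonitoring.findFrom 10 11 12) s (fun s' => s'.var 9 ≤ N ∧
      (s'.var 9 < N → i ≤ s'.var 9 ∧ coverCount b c S (s'.var 9) ≤ 1 ∧
        s'.var 10 = load (weight H.size) b c S (s'.var 9)) ∧
      ∀ x, i ≤ x → x < s'.var 9 → 2 ≤ coverCount b c S x) := by
  obtain ⟨k, hk⟩ := hF.leaf.pow
  refine (Run.findCover hC he.b_lt_c (sum_weight_le he.lt) hk hF.hN hF.hT
    (by unfold treeBound; nlinarith) hi hF.depth hS.v22 h7 h8).mono ?_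
  rintro s' - ⟨h1, h2, h3⟩
  refine ⟨h1, fun hlt => ?_, fun x hx hx' => ?_⟩
  · obtain ⟨a1, a2, a3⟩ := h2 hlt
    exact ⟨a1, (load_lt_iff he.lt).1 a2, a3⟩
  · by_contra hc
    have := (load_lt_iff (x := x) he.lt).2 (show coverCount b c S x ≤ 1 by omega)
    have := h3 x hx hx'
    omega

/-- Find the first gap `𝐯 9 ≥ 𝐯 7` that is not covered. -/
theorem Run.findFree (hF : Fits W H.size N L)
    (he : Elim H.size H.input.method own pI pR b c ord st en S Q ptr g h)
    (hC : CoverTree (weight H.size) b c N S s) (hS : Sizes H.size N s) {i : ℕ} (hi : i < N)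
    (h7 : s.var 7 = i) (h8 : s.var 8 = 1) :
    Run W H.input (L :: Ls) (StackMonitoring.findFrom 10 11 12) s (fun s' => s'.var 9 ≤ N ∧
      (s'.var 9 < N → i ≤ s'.var 9 ∧ coverCount b c S (s'.var 9) = 0) ∧
      ∀ x, i ≤ x → x < s'.var 9 → coverCount b c S x ≠ 0) := by
  obtain ⟨k, hk⟩ := hF.leaf.pow
  refine (Run.findCover hC he.b_lt_c (sum_weight_le he.lt) hk hF.hN hF.hT
    (by unfold treeBound; nlinarith) hi hF.depth hS.v22 h7 h8).mono ?_
  rintro s' - ⟨h1, h2, h3⟩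
  refine ⟨h1, fun hlt => ?_, fun x hx hx' => ?_⟩
  · obtain ⟨a1, a2, -⟩ := h2 hlt
    exact ⟨a1, (load_eq_zero (n := H.size)).1 (by omega)⟩
  · intro hc
    have := load_eq_zero (n := H.size).2 hc
    have := h3 x hx hx'
    omega

/-- By `visible_iff`, either the first free gap from the lower end on lies in the range, or a gap of
the range is covered by `v` alone. In the latter case the first light gap from the maximum of the
lower end and `b v` on will do, provided that it lies before `c v`. -/
theorem Run.testProg (hset : H.Setup own pI pR b c ord st en) (hF : Fits W H.size N L)
    (he : Elim H.size H.input.method own pI pR b c ord st en S Q ptr g h)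
    (hR : Rep H.size N H.input.method own pI pR b c ord en S Q ptr g h s) {v : ℕ} (hv : v ∈ S)
    (hlt : ptr v < en v) (h31 : s.var 31 = v) :
    Run W H.input (L :: Ls) testProg s (fun s' =>
      s'.var 32 = lowGap H.input.method own pI c (ord (ptr v)) ∧
      s'.var 33 = highGap H.input.method own pR b (ord (ptr v)) ∧
      (s'.var 37 ≠ 0 ↔ Placeable H.input.method own pI pR b c S v (ord (ptr v)))) := by
  have hn := hF.hn
  have hNn := hF.leaf.lt
  have hlo := hset.lowGap_lt he hv hlt
  have hhi := hset.highGap_lt he hv hlt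
  obtain ⟨hvn, hvk, -, -⟩ := hset.next he hv hlt
  have hbv := hset.b_lt hvn hvk
  have hcv := hset.c_le hvn hvk
  unfold Placeable
  generalize hlo' : lowGap H.input.method own pI c (ord (ptr v)) = lo at *
  generalize hhi' : highGap H.input.method own pR b (ord (ptr v)) = hi at *
  refine Run.seq (Run.rangeProg hset hF he hR hv hlt h31) ?_
  rintro s1 hf1 ⟨h32, h33⟩
  rw [hlo'] at h32
  rw [hhi'] at h33
  have hR1 := hR.frame hf1
  have e31 : s1.var 31 = v := (hf1.var 31 rfl).trans h31
  refine Run.assign_seq lo (by simp [h32]) ?_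
  refine Run.assign_seq 1 (by simp (disch := omega) [Nat.mod_eq_of_lt]) ?_
  have hR2 := (hR1.setVar (x := 7) (v := lo) (by norm_num)).setVar (x := 8) (v := 1) (by norm_num)
  refine Run.seq (Run.findFree hF he hR2.cover hR2.loaded.sizes (i := lo) (by omega) (by simp)
    (by simp)) ?_
  rintro s3 hf3 ⟨a1, a2, a3⟩
  have hR3 := hR2.frame hf3
  have f31 : s3.var 31 = v := by rw [hf3.var 31 rfl]; simp [e31]
  have f32 : s3.var 32 = lo := by rw [hf3.var 32 rfl]; simp [h32]
  have f33 : s3.var 33 = hi := by rw [hf3.var 33 rfl]; simp [h33]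
  refine Run.ite (fun c' => ?_) (fun c' => ?_)
  · have h9 : s3.var 9 < hi := by
      by_contra h9
      simp [f33, h9] at c'
    refine Run.assign (v := 1) (by simp (disch := omega) [Nat.mod_eq_of_lt]) ?_
    obtain ⟨b1, b2⟩ := a2 (by omega)
    refine ⟨by simp [f32], by simp [f33], ?_⟩
    simp only [Store.setVar_var, if_true]
    refine ⟨fun _ => ⟨_, b1, h9, (visible_iff hv).2 (.inl b2)⟩, fun _ => one_ne_zero⟩
  · have h9 : ¬ s3.var 9 < hi := by
      intro h9
      simp (disch := omega) [f33, h9, Nat.mod_eq_of_lt] at c'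
    have hl3 := hR3.loaded
    -- With truncated subtraction this is the maximum of `lo` and `b v`.
    refine Run.assign_seq (lo + (b v - lo)) (by
      simp (disch := omega) [f31, f32, hl3.arr7, Nat.mod_eq_of_lt]) ?_
    refine Run.assign_seq (2 * (H.size + 1)) (by
      simp (disch := omega) [hl3.sizes.v23, Nat.mod_eq_of_lt]) ?_
    have hR4 := (hR3.setVar (x := 7) (v := lo + (b v - lo)) (by norm_num)).setVar (x := 8)
      (v := 2 * (H.size + 1)) (by norm_num)
    refine Run.seq (Run.findLight hF he hR4.cover hR4.loaded.sizes (i := lo + (b v - lo))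
      (by omega) (by simp) (by simp)) ?_
    rintro s5 hf5 ⟨d1, d2, d3⟩
    have hR5 := hR4.frame hf5
    have g31 : s5.var 31 = v := by rw [hf5.var 31 rfl]; simp [f31]
    have g32 : s5.var 32 = lo := by rw [hf5.var 32 rfl]; simp [f32]
    have g33 : s5.var 33 = hi := by rw [hf5.var 33 rfl]; simp [f33]
    have hl5 := hR5.loaded
    refine Run.assign (v := if s5.var 9 < hi ∧ s5.var 9 < c v then 1 else 0) ?_ ?_
    · by_cases q1 : s5.var 9 < hi <;> by_cases q2 : s5.var 9 < c v <;>
        simp (disch := omega) [g31, g33, hl5.arr8, q1, q2, Nat.mod_eq_of_lt]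
    refine ⟨by simp [g32], by simp [g33], ?_⟩
    simp only [Store.setVar_var, if_true]
    constructor
    · intro hne
      have hcond : s5.var 9 < hi ∧ s5.var 9 < c v := by
        by_contra hcon
        rw [if_neg hcon] at hne
        exact hne rfl
      obtain ⟨b1, b2, -⟩ := d2 (by omega)
      exact ⟨_, by omega, hcond.1, (visible_iff hv).2 (.inr ⟨b2, by omega, hcond.2⟩)⟩
    · rintro ⟨x, x1, x2, x3⟩
      rcases (visible_iff hv).1 x3 with h0 | ⟨h0, x4, x5⟩
      · exact absurd h0 (a3 x x1 (by omega))
      · have : s5.var 9 ≤ x := by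
          by_contra hlt'
          have := d3 x (by omega) (by omega)
          omega
        rw [if_pos ⟨by omega, by omega⟩]
        exact one_ne_zero

/-- Invariant of the elimination loop. -/
def ElimInv (H : History P V) (N : ℕ) (own pI pR b c ord st en : ℕ → ℕ) (k : ℕ) (s : Store) : Prop :=
  ∃ S Q ptr g h, Elim H.size H.input.method own pI pR b c ord st en S Q ptr g h ∧
    Rep H.size N H.input.method own pI pR b c ord en S Q ptr g h s ∧
    potential b c H.size en S Q ptr g h = k

/-- The outcomes of the searches match `Elim.skip`, `Elim.stab`, `Elim.pass` and `Elim.sole`. -/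
theorem Run.gapProg (hset : H.Setup own pI pR b c ord st en) (hF : Fits W H.size N L)
    (he : Elim H.size H.input.method own pI pR b c ord st en S Q ptr g h)
    (hR : Rep H.size N H.input.method own pI pR b c ord en S Q ptr g h s) (hgh : g < h) :
    Run W H.input (L :: Ls) gapProg s (fun s' => ∃ k < potential b c H.size en S Q ptr g h,
      ElimInv H N own pI pR b c ord st en k s') := by
  have hn := hF.hn
  have hNn := hF.leaf.lt
  have hNle := hF.leaf.le
  have hh := he.le
  obtain ⟨k, hk⟩ := hF.leaf.pow
  refine Run.assign_seq g (by simp [hR.cur]) ?_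
  refine Run.assign_seq (2 * (H.size + 1)) (by
    simp (disch := omega) [hR.loaded.sizes.v23, Nat.mod_eq_of_lt]) ?_
  have hR1 := (hR.setVar (x := 7) (v := g) (by norm_num)).setVar (x := 8)
    (v := 2 * (H.size + 1)) (by norm_num)
  refine Run.seq (Run.findLight hF he hR1.cover hR1.loaded.sizes (i := g) (by omega) (by simp)
    (by simp)) ?_
  rintro s2 hf2 ⟨a1, a2, a3⟩
  have hR2 := hR1.frame hf2
  refine Run.ite (fun c' => ?_) (fun c' => ?_)
  · have h9 : s2.var 9 < h := by
      by_contra h9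
      simp [hR2.top, h9] at c'
    obtain ⟨b1, b2, b3⟩ := a2 (by omega)
    generalize hx : s2.var 9 = x at *
    refine Run.assign_seq x (by simp [hx]) ?_
    refine Run.assign_seq (load (weight H.size) b c S x) (by simp [b3]) ?_
    generalize hl : load (weight H.size) b c S x = l at *
    have hR3 := (hR2.setVar (x := 35) (v := x) (by norm_num)).setVar (x := 36) (v := l)
      (by norm_num)
    refine Run.ite (fun c' => ?_) (fun c' => ?_)
    · have hl0 : l = 0 := by
        by_contra hl0
        simp [hl0] at c'
      have hc0 : coverCount b c S x = 0 := load_eq_zero.1 (hl.trans hl0)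
      have hs3 := hR3.loaded.sizes
      refine Run.assign_seq (2 * H.size - x) (by
        have := hs3.v21
        simp (disch := omega) [hR2.loaded.sizes.v21, Nat.mod_eq_of_lt]) ?_
      refine Run.assign_seq (2 * H.size - x) (by
        simp (disch := omega) [hR2.loaded.sizes.v21, Nat.mod_eq_of_lt]) ?_
      have hR4 := (hR3.setVar (x := 7) (v := 2 * H.size - x) (by norm_num)).setVar (x := 8)
        (v := 2 * H.size - x) (by norm_num)
      obtain ⟨μ, hμ1, hμ2⟩ := hR4.stab
      -- A stabbing query in reflected coordinates: `lowGap ≤ x < highGap` says that a leaf with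
      -- number at least `2 * n - x` holds an entry below `2 * n - x`.
      refine Run.seq (Run.findStab (B := treeBound H.size) (i := 2 * H.size - x)
        (t := 2 * H.size - x) hμ1 (hμ2.le (by unfold treeBound; omega) (by unfold treeBound; omega))
        hk hF.hN hF.hT (by unfold treeBound; omega) (by omega) hF.depth hR4.loaded.sizes.v22
        (by simp) (by simp)) ?_
      rintro s5 hf5 ⟨d1, d2, d3⟩
      have hR5 := hR4.frame hf5
      have f35 : s5.var 35 = x := by rw [hf5.var 35 rfl]; simp
      have f16 : s5.arr 16 = s2.arr 16 := by rw [hf5.arr 16 rfl]; simp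
      refine Run.ite (fun c' => ?_) (fun c' => ?_)
      · have hp : s5.var 9 < N := by
          by_contra hp
          simp [hR5.loaded.sizes.v22, hp] at c'
        obtain ⟨e1, e2⟩ := d2 hp
        -- A leaf at which nobody waits holds `N`, which is too large to be found.
        rcases hμ2.other _ hp with e3 | ⟨w, hw, e3⟩
        · omega
        · obtain ⟨e4, e5⟩ := hμ2.mem w hw
          rw [Finset.mem_sdiff] at hw
          have hlt := he.ptr_lt w hw.1 hw.2
          have hlo := hset.lowGap_lt he hw.1 hlt
          rw [← e3] at e4 e5
          refine Run.assign_seq w (by simpa [f16] using e5) ?_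
          refine Run.seq (Run.wakeProg hset hF he (hR5.setVar (by norm_num)) hw.1 hw.2
            (by simp)) ?_
          intro s6 hf6 hR6
          have g31 : s6.var 31 = w := by rw [hf6.var 31 rfl]; simp
          have g35 : s6.var 35 = x := by rw [hf6.var 35 rfl]; simp [f35]
          have hen := hset.en_le w (he.lt w hw.1)
            (Finset.mem_filter.1 (he.sub hw.1)).2.1
          refine Run.put_seq w (ptr w + 1) (by simp [g31]) (by
            simp (disch := omega) [g31, hR6.ptr_eq, Nat.mod_eq_of_lt]) ?_
          refine Run.assign (v := x) (by simp [g35]) ?_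
          obtain ⟨i1, i2⟩ := he.stab b1 a3 hc0 hw.1 hw.2 (by omega) (by omega)
          exact ⟨_, i2, _, _, _, _, _, i1,
            (hR6.incr (Finset.mem_insert_self _ _)).setCur x, rfl⟩
      · have hp : ¬ s5.var 9 < N := by
          intro hp
          simp (disch := omega) [hR5.loaded.sizes.v22, hp, Nat.mod_eq_of_lt] at c'
        refine Run.assign (v := x + 1) (by simp (disch := omega) [f35, Nat.mod_eq_of_lt]) ?_
        have hno : ∀ v ∈ S, v ∉ Q → lowGap H.input.method own pI c (ord (ptr v)) ≤ x →
            ¬ x < highGap H.input.method own pR b (ord (ptr v)) := by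
          intro w hw hwQ h1 h2
          have hlt := he.ptr_lt w hw hwQ
          have hlo := hset.lowGap_lt he hw hlt
          have hhi := hset.highGap_lt he hw hlt
          obtain ⟨e4, -⟩ := hμ2.mem w (Finset.mem_sdiff.2 ⟨hw, hwQ⟩)
          have := d3 (2 * H.size - lowGap H.input.method own pI c (ord (ptr w))) (by omega)
            (by omega)
          omega
        obtain ⟨i1, i2⟩ := he.pass b1 h9 a3 b2 hno
        exact ⟨_, i2, _, _, _, _, _, i1, hR5.setCur (x + 1), rfl⟩
    · have hl0 : l ≠ 0 := by
        rintro rfl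
        simp (disch := omega) [Nat.mod_eq_of_lt] at c'
      obtain ⟨u1, u2⟩ := load_sole (n := H.size) b2 (by rw [hl]; exact hl0)
      rw [hl] at u1 u2
      generalize hu : l - (H.size + 1) = u at *
      obtain ⟨i1, i2⟩ := he.sole b1 h9 a3 b2 u1 u2
      have hun := he.lt u u1
      refine Run.assign_seq u (by
        simp [hR2.loaded.sizes.v23, hu]
        exact Nat.mod_eq_of_lt (by omega)) ?_
      have hR4 := hR3.setVar (x := 31) (v := u) (by norm_num)
      refine Run.seq (R := fun s' => Rep H.size N H.input.method own pI pR b c ord en S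
        (insert u Q) ptr g h s') ?_ ?_
      · have hwt := hR4.waiting u u1
        refine Run.ite (fun c' => ?_) (fun c' => ?_)
        · have huQ : u ∈ Q := by
            rw [← hwt]
            by_contra hne
            simp at hne
            simp [hne] at c'
          rw [Finset.insert_eq_of_mem huQ]
          exact Run.skip hR4
        · have huQ : u ∉ Q := by
            intro hQ
            have := hwt.2 hQ
            simp at this
            simp [this, show W ≠ 1 by omega] at c'
          exact Run.wakeProg hset hF he hR4 u1 huQ (by simp)
      · intro s5 hf5 hR5
        have f35 : s5.var 35 = x := by rw [hf5.var 35 rfl]; simp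
        refine Run.assign (v := x + 1) (by simp (disch := omega) [f35, Nat.mod_eq_of_lt]) ?_
        exact ⟨_, i2, _, _, _, _, _, i1, hR5.setCur (x + 1), rfl⟩
  · have h9 : ¬ s2.var 9 < h := by
      intro h9
      simp (disch := omega) [hR2.top, h9, Nat.mod_eq_of_lt] at c'
    refine Run.assign (v := h) (by simp [hR2.top]) ?_
    obtain ⟨i1, i2⟩ := he.skip hgh fun y h1 h2 => a3 y h1 (by omega)
    exact ⟨_, i2, _, _, _, _, _, i1, hR2.setCur h, rfl⟩

/-- The branches match `Elim.remove`, `Elim.wait` and `Elim.process`. A removal happens only when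
the window is exhausted, so the old window may be overwritten. -/
theorem Run.workProg (hset : H.Setup own pI pR b c ord st en) (hF : Fits W H.size N L)
    (he : Elim H.size H.input.method own pI pR b c ord st en S Q ptr g h)
    (hR : Rep H.size N H.input.method own pI pR b c ord en S Q ptr g h s) (hgh : ¬ g < h)
    (hQ : s.var 27 ≠ 0) :
    Run W H.input (L :: Ls) workProg s (fun s' => ∃ k < potential b c H.size en S Q ptr g h,
      ElimInv H N own pI pR b c ord st en k s') := by
  have hn := hF.hn
  have hNn := hF.leaf.lt
  have hNle := hF.leaf.le
  obtain ⟨k, hk⟩ := hF.leaf.pow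
  obtain ⟨q, hq⟩ := Nat.exists_eq_succ_of_ne_zero hQ
  have hlist := hR.list
  rw [hq] at hlist
  obtain ⟨hvQ, hpop⟩ := hlist.pop
  have hcard : q < H.size := by
    have h1 : Q.card ≤ H.size := (Finset.card_le_card (he.Q_sub.trans he.sub)).trans
      ((Finset.card_filter_le _ _).trans (Finset.card_range _).le)
    rw [hlist.card] at h1
    omega
  generalize hv : s.arr 18 q = v at *
  have hvS := he.Q_sub hvQ
  have hvn := he.lt v hvS
  have hvk : H.input.method v = 0 := (Finset.mem_filter.1 (he.sub hvS)).2.1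
  have hbv := hset.b_lt hvn hvk
  have hcv := hset.c_le hvn hvk
  have hl := hR.loaded
  refine Run.assign_seq v (by simp (disch := omega) [Nat.mod_eq_of_lt, hq, hv]) ?_
  have hR1 := hR.setVar (x := 31) (v := v) (by norm_num)
  refine Run.ite (fun c' => ?_) (fun c' => ?_)
  · have hend : ptr v = en v := by
      by_contra hne
      simp [hR.ptr_eq, hl.arr6, hne] at c'
    obtain ⟨i1, i2⟩ := he.remove hset.exists_seg
      (fun w hw => hset.c_le (he.lt w hw) (Finset.mem_filter.1 (he.sub hw)).2.1) hgh hvQ hend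
    refine Run.assign_seq (b v) (by simp [hl.arr7]) ?_
    refine Run.assign_seq (c v) (by simp [hl.arr8]) ?_
    refine Run.assign_seq (weight H.size v) (by
      simp (disch := omega) [Nat.mod_eq_of_lt, hl.sizes.v23, weight]) ?_
    have hR2 := ((hR1.setVar (x := 7) (v := b v) (by norm_num)).setVar (x := 8) (v := c v)
      (by norm_num)).setVar (x := 9) (v := weight H.size v) (by norm_num)
    refine Run.seq (Run.coverErase (v := v) hR2.cover hvS (sum_weight_le he.lt) hk hF.hN hF.hT
      hF.depth (by omega) (by omega) hR2.loaded.sizes.v22 (by simp) (by simp) (by simp)) ?_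
    intro s3 hf3 hC3
    have hl3 := hR2.loaded.frame hf3
    have f26 : s3.var 26 = S.card := by rw [hf3.var 26 rfl]; simpa using hR.card
    have f27 : s3.var 27 = q + 1 := by rw [hf3.var 27 rfl]; simp [hq]
    have f31 : s3.var 31 = v := by rw [hf3.var 31 rfl]; simp
    have hSc := Finset.card_erase_add_one hvS
    have hSn : S.card ≤ H.size := (Finset.card_le_card he.sub).trans
      ((Finset.card_filter_le _ _).trans (Finset.card_range _).le)
    refine Run.assign_seq (S.erase v).card (by
      simp (disch := omega) [f26, Nat.mod_eq_of_lt]) ?_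
    refine Run.assign_seq q (by simp (disch := omega) [f27, Nat.mod_eq_of_lt]) ?_
    refine Run.assign_seq (b v) (by simp [f31, hl3.arr7]) ?_
    refine Run.assign (v := c v) (by simp [f31, hl3.arr8]) ?_
    refine ⟨_, i2, _, _, _, _, _, i1, ?_, rfl⟩
    obtain ⟨μ, hμ1, hμ2⟩ := hR2.stab
    refine ⟨(((hl3.setVar (by norm_num)).setVar (by norm_num)).setVar (by norm_num)).setVar
      (by norm_num), ?_, hC3.congr rfl rfl rfl, ?_, by simp, by simp, by simp, ?_, ⟨μ, ?_, ?_⟩⟩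
    · simp [hf3.arr 5 rfl, hR.ptr_eq]
    · simpa [hf3.arr 18 rfl] using hpop
    · intro w hw
      have := hR.waiting w (Finset.mem_of_mem_erase hw)
      simp [hf3.arr 17 rfl, this, Finset.ne_of_mem_erase hw]
    · unfold StabTree
      simp only [Store.setVar_arr]
      rw [hf3.arr 13 rfl, hf3.arr 14 rfl, hf3.arr 15 rfl]
      exact hμ1
    · simp only [Store.setVar_arr]
      rw [hf3.arr 16 rfl]
      have hset' : S.erase v \ Q.erase v = S \ Q := by
        ext w
        simp only [Finset.mem_sdiff, Finset.mem_erase]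
        constructor
        · rintro ⟨⟨h1, h2⟩, h3⟩
          exact ⟨h2, fun h => h3 ⟨h1, h⟩⟩
        · rintro ⟨h1, h2⟩
          exact ⟨⟨by rintro rfl; exact h2 hvQ, h1⟩, fun h => h2 h.2⟩
      rw [hset']
      exact hμ2
  · have hne : ptr v ≠ en v := by
      intro hend
      simp [hR.ptr_eq, hl.arr6, hend, show W ≠ 1 by omega] at c'
    have hlt : ptr v < en v := by
      have := (he.ptr_mem v hvS).2
      omega
    have hen := hset.en_le v hvn hvk
    have hlo := hset.lowGap_lt he hvS hlt
    have hhi := hset.highGap_lt he hvS hlt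
    refine Run.seq (Run.testProg hset hF he hR1 hvS hlt (by simp)) ?_
    rintro s2 hf2 ⟨h32, h33, h37⟩
    have hR2 := hR1.frame hf2
    have f31 : s2.var 31 = v := by rw [hf2.var 31 rfl]; simp
    have f27 : s2.var 27 = q + 1 := by rw [hf2.var 27 rfl]; simp [hq]
    have hl2 := hR2.loaded
    refine Run.ite (fun c' => ?_) (fun c' => ?_)
    · have hnp : ¬ Placeable H.input.method own pI pR b c S v (ord (ptr v)) := by
        rw [← h37]
        intro hne
        simp [hne] at c'
      obtain ⟨i1, i2⟩ := he.wait hvQ hlt hnp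
      generalize hlo' : lowGap H.input.method own pI c (ord (ptr v)) = lo at *
      generalize hhi' : highGap H.input.method own pR b (ord (ptr v)) = hi at *
      refine Run.assign_seq (2 * H.size - lo) (by
        simp (disch := omega) [hl2.sizes.v21, h32, Nat.mod_eq_of_lt]) ?_
      refine Run.assign_seq (2 * H.size - hi) (by
        simp (disch := omega) [hl2.sizes.v21, h33, Nat.mod_eq_of_lt]) ?_
      have hR3 := (hR2.setVar (x := 7) (v := 2 * H.size - lo) (by norm_num)).setVar (x := 8)
        (v := 2 * H.size - hi) (by norm_num)
      obtain ⟨μ, hμ1, hμ2⟩ := hR3.stab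
      refine Run.seq (Run.stabSet (B := treeBound H.size) hμ1
        (hμ2.le (by unfold treeBound; omega) (by unfold treeBound; omega))
        (t := 2 * H.size - hi) (x := 2 * H.size - lo) (by unfold treeBound; omega)
        hk hF.hN hF.hT hF.depth (by omega) hR3.loaded.sizes.v22 (by simp) (by simp)) ?_
      intro s4 hf4 hT4
      have hl4 := hR3.loaded.frame hf4
      have g31 : s4.var 31 = v := by rw [hf4.var 31 rfl]; simp [f31]
      have g27 : s4.var 27 = q + 1 := by rw [hf4.var 27 rfl]; simp [f27]
      have g7 : s4.var 7 = 2 * H.size - lo := by rw [hf4.var 7 rfl]; simp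
      refine Run.put_seq (2 * H.size - lo) v (by simp [g7]) (by simp [g31]) ?_
      refine Run.put_seq v 1 (by simp [g31]) (by simp (disch := omega) [Nat.mod_eq_of_lt]) ?_
      refine Run.assign (v := q) (by simp (disch := omega) [g27, Nat.mod_eq_of_lt]) ?_
      refine ⟨_, i2, _, _, _, _, _, i1, ?_, rfl⟩
      refine ⟨(hl4.setArr.setArr).setVar (by norm_num), ?_, ?_, ?_, ?_, ?_, ?_, ?_,
        ⟨Function.update μ (2 * H.size - lo) (2 * H.size - hi), hT4, ?_⟩⟩
      · simp [Store.setArr_arr, hf4.arr 5 rfl, hR2.ptr_eq]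
      · refine hR3.cover.congr ?_ ?_ ?_
        all_goals
          simp only [Store.setVar_arr, Store.setArr_arr]
          norm_num
          rw [hf4.arr _ rfl]
          simp
      · have e18 : s4.arr 18 = s.arr 18 := by
          rw [hf4.arr 18 rfl]
          simp [hf2.arr 18 rfl]
        simpa [Store.setArr_arr, e18] using hpop
      · simp [hf4.var 26 rfl, hR2.card]
      · simp [hf4.var 28 rfl, hR2.cur]
      · simp [hf4.var 29 rfl, hR2.top]
      · intro w hw
        have := hR2.waiting w hw
        have e17 : s4.arr 17 = s2.arr 17 := by rw [hf4.arr 17 rfl]; simp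
        simp only [Store.setVar_arr, Store.setArr_arr]
        norm_num
        rw [Function.update_apply, e17]
        by_cases hwv : w = v
        · simp [hwv]
        · simp [hwv, this]
      · have e16 : s4.arr 16 = s2.arr 16 := by rw [hf4.arr 16 rfl]; simp
        simp only [Store.setVar_arr, Store.setArr_arr]
        norm_num
        rw [e16]
        have hset' : S \ Q.erase v = insert v (S \ Q) := by
          ext w
          simp only [Finset.mem_sdiff, Finset.mem_erase, Finset.mem_insert]
          constructor
          · rintro ⟨h1, h2⟩
            by_cases hwv : w = v
            · exact .inl hwv
            · exact .inr ⟨h1, fun h => h2 ⟨hwv, h⟩⟩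
          · rintro (rfl | ⟨h1, h2⟩)
            · exact ⟨hvS, fun h => h.1 rfl⟩
            · exact ⟨h1, fun h => h2 h.2⟩
        rw [hset']
        have hins := hμ2.insert (v := v) (fun w hw => by
          rw [Finset.mem_sdiff] at hw
          exact hset.lowGap_inj he hw.1 (he.ptr_lt w hw.1 hw.2) hvS hlt
            (by rintro rfl; exact hw.2 hvQ))
        simp only [hlo', hhi'] at hins
        exact hins
    · have hp : Placeable H.input.method own pI pR b c S v (ord (ptr v)) := by
        rw [← h37]
        intro h0
        simp [h0, show W ≠ 1 by omega] at c'
      obtain ⟨i1, i2⟩ := he.process hvQ hlt hp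
      refine Run.put (j := v) (v := ptr v + 1) (by simp [f31]) (by
        simp (disch := omega) [f31, hR2.ptr_eq, Nat.mod_eq_of_lt]) ?_
      exact ⟨_, i2, _, _, _, _, _, i1, hR2.incr hvQ, rfl⟩

end Elim

/-! ### Correctness of the decision and the running time. -/

section Decision

variable {P V : Type*} [LinearOrder V] {H : History P V}

theorem Run.elimProg (hU : H.Unambiguous) {N W B L : ℕ} {Ls : List ℕ}
    {own pI pR b c ord st en : ℕ → ℕ} {s : Store} (hF : Fits W H.size N L)
    (hs : H.Ready N own pI pR b c ord st en s) (hB : 22 * H.size ≤ B) :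
    Run W H.input (B :: L :: Ls) elimProg s (fun s' =>
      (H.Linearizable ∧ s'.var 0 = 1) ∨ (¬ H.Linearizable ∧ s'.var 0 = 0)) := by
  have hn := hF.hn
  have hset := hs.setup
  have hSn : ∀ v ∈ solidValues H.input.method b c H.size, v < H.size ∧ H.input.method v = 0 := by
    intro v hv
    simp only [solidValues, Finset.mem_filter, Finset.mem_range] at hv
    exact ⟨hv.1, hv.2.1⟩
  set S := solidValues H.input.method b c H.size with hS
  have hScard : S.card ≤ H.size :=
    (Finset.card_filter_le _ _).trans (Finset.card_range _).le
  refine Run.assign_seq S.card (by simpa using hs.list.card.symm) ?_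
  refine Run.assign_seq 0 (by simp) ?_
  refine Run.assign_seq 0 (by simp) ?_
  have he : Elim H.size H.input.method own pI pR b c ord st en S S st 0 0 := by
    refine ⟨subset_rfl, subset_rfl, fun v hv => ⟨le_rfl, ?_⟩, fun v hv k h1 h2 => by omega,
      fun v hv hQ => absurd hv hQ, fun v hv hQ => absurd hv hQ, id, by omega⟩
    exact (hset.st_lt v (hSn v hv).1 (hSn v hv).2).le
  refine Run.seq (Run.loopRank (ElimInv H N own pI pR b c ord st en)
    (k := potential b c H.size en S S st 0 0) ⟨S, S, st, 0, 0, he, ?_, rfl⟩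
    ((potential_init_le (hset.sum_le hSn) hScard).trans hB) ?_) ?_
  · refine ⟨((hs.loaded.setVar (by norm_num)).setVar (by norm_num)).setVar (by norm_num), ?_,
      hs.cover.congr rfl rfl rfl, ?_, by simp, by simp, by simp, ?_, ⟨fun _ => N, hs.stab, ?_⟩⟩
    · simpa using hs.ptr
    · simpa using hs.list
    · intro v hv
      simp [hs.waiting, hv]
    · exact ⟨by simp, fun x _ => .inl rfl⟩
  · rintro k s' - ⟨S', Q, ptr, g, h, he', hR, rfl⟩ hb
    refine Run.ite (fun c' => ?_) (fun c' => ?_)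
    · refine Run.gapProg hset hF he' hR ?_
      by_contra hgh
      simp [hR.cur, hR.top, hgh] at c'
    · have hgh : ¬ g < h := by
        intro hgh
        simp (disch := omega) [hR.cur, hR.top, hgh, Nat.mod_eq_of_lt] at c'
      refine Run.workProg hset hF he' hR hgh ?_
      intro h0
      simp [hR.cur, hR.top, hgh, h0] at hb
  · rintro s' hf ⟨⟨k, S', Q, ptr, g, h, he', hR, -⟩, hb⟩
    have e24 : s'.var 24 = s.var 24 := by rw [hf.var 24 rfl]; simp
    have hgh : ¬ g < h := by
      intro hgh
      by_cases h0 : 0 < s'.var 27 <;>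
        simp (disch := omega) [hR.cur, hR.top, hgh, h0, Nat.mod_eq_of_lt] at hb
    have h0 : s'.var 27 = 0 := by
      by_contra h0
      have h0' : 0 < s'.var 27 := by omega
      simp (disch := omega) [hR.cur, hR.top, hgh, h0', Nat.mod_eq_of_lt] at hb
    have hQ : Q = ∅ := by
      rw [← Finset.card_eq_zero, hR.list.card, h0]
    subst hQ
    have hiff : H.Linearizable ↔ s'.var 24 = 0 ∧ s'.var 26 = 0 := by
      rw [e24, hs.empties, hR.card, Finset.card_eq_zero]
      constructor
      · intro hl
        obtain ⟨h1, h2⟩ := hset.isDisc.of_linearizable hU hl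
        refine ⟨h1, ?_⟩
        by_contra hne
        -- If values remain, linearizability would make one of them removable, but each of them has
        -- a blocked operation.
        obtain ⟨v, hv, hpl⟩ := h2 S' he'.sub (Finset.nonempty_iff_ne_empty.2 hne)
        obtain ⟨h3, h4⟩ := he'.not_placeable hgh hv
        obtain ⟨-, -, -, h5, h6, h7⟩ := hset.next he' hv h3
        exact h4 (hpl _ h5 h6 h7)
      · rintro ⟨h1, rfl⟩
        exact hset.isDisc.linearizable hU h1 (he'.elim .empty)
    by_cases hl : H.Linearizable
    · obtain ⟨h1, h2⟩ := hiff.1 hl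
      refine Run.assign (v := 1) ?_ (.inl ⟨hl, by simp⟩)
      simp (disch := omega) [h1, h2, Nat.mod_eq_of_lt]
    · refine Run.assign (v := 0) ?_ (.inr ⟨hl, by simp⟩)
      rw [hiff] at hl
      by_cases h1 : s'.var 24 = 0 <;> by_cases h2 : s'.var 26 = 0
      · exact absurd ⟨h1, h2⟩ hl
      all_goals simp [h1, h2]

/-- The decision procedure. -/
def decideProg : Program := prepProg ;; elimProg

/-- Running time of the decision procedure for `n` operations. -/
def decideTime (n : ℕ) : ℕ := decideProg.nodes * ((22 * n + 3) * (Nat.log 2 (8 * n + 2) + 1))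

theorem decideProg_decides (hU : H.Unambiguous) {W : ℕ} (hW : (H.size + 2) ^ 8 ≤ W) :
    decideProg.DecidesWithin W H.input (decideTime H.size) H.Linearizable := by
  -- The exponent 8 absorbs the constant: `H.size + 2 ≥ 2` gives `64 ≤ (H.size + 2) ^ 6`.
  have hW' : 64 * (H.size + 2) ^ 2 ≤ W := by
    calc 64 * (H.size + 2) ^ 2 = 2 ^ 6 * (H.size + 2) ^ 2 := by norm_num
      _ ≤ (H.size + 2) ^ 6 * (H.size + 2) ^ 2 :=
        Nat.mul_le_mul_right _ (Nat.pow_le_pow_left (by omega) 6)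
      _ = (H.size + 2) ^ 8 := by rw [← pow_add]
      _ ≤ W := hW
  have hL : ∀ N, LeafCount H.size N → Nat.log 2 (2 * N) ≤ Nat.log 2 (8 * H.size + 2) :=
    fun N hN => Nat.log_mono_right (by have := hN.le; omega)
  -- Two loop levels suffice: outer loops with linearly many rounds, and walks in trees of
  -- logarithmic depth inside them.
  obtain ⟨s, t, h1, h2, h3⟩ : Run W H.input [22 * H.size + 2, Nat.log 2 (8 * H.size + 2)] decideProg
      (initStore H.input.size) (fun s' =>
        (H.Linearizable ∧ s'.var 0 = 1) ∨ (¬ H.Linearizable ∧ s'.var 0 = 0)) := by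
    refine Run.seq (Run.prepProg hU hW' (by omega) hL) ?_
    rintro s - ⟨N, own, pI, pR, b, c, ord, st, en, hN, hs⟩
    exact Run.elimProg hU ⟨hN, hW', hL N hN⟩ hs (by omega)
  refine ⟨s, t, h1, h2.trans ((Program.stat_le _ _).trans ?_), h3⟩
  simp [decideTime]

end Decision

theorem decideTime_isBigO :
    (fun n : ℕ => (decideTime n : ℝ)) =O[Filter.atTop] (fun n : ℕ => (n : ℝ) * Real.log n) := by
  -- From `n = 16` on, `22 * n + 3 ≤ 25 * n`. Also `8 * n + 2 ≤ n ^ 2` and `1 ≤ log n`, so the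
  -- logarithmic factor is at most `5 * log n`; this gives `125 = 25 * 5`.
  refine Asymptotics.IsBigO.of_bound (decideProg.nodes * 125 : ℝ) ?_
  filter_upwards [Filter.eventually_ge_atTop 16] with n hn
  have hn' : (16 : ℝ) ≤ n := by exact_mod_cast hn
  have hlog1 : 1 ≤ Real.log n := by
    rw [Real.le_log_iff_exp_le (by linarith)]
    have := Real.exp_one_lt_d9
    linarith
  have hlog2 : (Nat.log 2 (8 * n + 2) : ℝ) ≤ 4 * Real.log n := by
    have h1 : Nat.log 2 (8 * n + 2) ≤ Nat.log 2 (n ^ 2) := Nat.log_mono_right (by nlinarith)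
    have h2 : (Nat.log 2 (n ^ 2) : ℝ) ≤ Real.logb 2 ((n ^ 2 : ℕ) : ℝ) := by
      exact_mod_cast Real.natLog_le_logb (n ^ 2) 2
    have h3 : (Nat.log 2 (8 * n + 2) : ℝ) ≤ Nat.log 2 (n ^ 2) := by exact_mod_cast h1
    have h4 : Real.logb 2 ((n ^ 2 : ℕ) : ℝ) = 2 * Real.log n / Real.log 2 := by
      rw [Real.logb, Nat.cast_pow, Real.log_pow]
      norm_num
    have h5 := Real.log_two_gt_d9
    have h6 : 2 * Real.log n / Real.log 2 ≤ 4 * Real.log n := by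
      rw [div_le_iff₀ (by linarith)]
      nlinarith
    linarith
  have hpos : (0 : ℝ) ≤ decideProg.nodes := Nat.cast_nonneg _
  rw [Real.norm_of_nonneg (by positivity), Real.norm_of_nonneg (by positivity)]
  unfold decideTime
  push_cast
  calc (decideProg.nodes : ℝ) * ((22 * n + 3) * (Nat.log 2 (8 * n + 2) + 1))
      ≤ decideProg.nodes * ((25 * n) * (5 * Real.log n)) := by
        refine mul_le_mul_of_nonneg_left (mul_le_mul ?_ ?_ (by positivity) (by positivity)) hpos
        · linarith
        · linarith
    _ = decideProg.nodes * 125 * (n * Real.log n) := by ring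

end StackMonitoring

theorem mainTheorem1 :
    ∃ (p : StackMonitoring.Program) (k : ℕ) (T : ℕ → ℕ),
      (fun n : ℕ => (T n : ℝ)) =O[Filter.atTop] (fun n : ℕ => (n : ℝ) * Real.log n) ∧
      ∀ (P : Type*) (V : Type*) [LinearOrder V] (H : StackMonitoring.History P V),
        H.WellFormed → H.Unambiguous →
        ∀ W : ℕ, (H.size + 2) ^ k ≤ W →
          p.DecidesWithin W H.input (T H.size) H.Linearizable :=
  ⟨StackMonitoring.decideProg, 8, StackMonitoring.decideTime, StackMonitoring.decideTime_isBigO,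
    fun _ _ _ _ _ hU _ hW => StackMonitoring.decideProg_decides hU hW⟩
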